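/- Let $d_1,d_2\ge 1$ be integers, $d=\min(d_1,d_2)$, $p\in[1,\infty]$ and $s>0$. For a multi-index $\alpha\in\mathbf N^n$ let $h_\alpha$ be the ($L^2$-normalized) Hermite function on $\mathbf R^n$, and let $H=|x|^2-\Delta$ be the harmonic oscillator. Let $\mathcal H_s(\mathbf R^n)$ (resp. $\mathcal H_{0,s}(\mathbf R^n)$) be the set of all functions $f=\sum_{\alpha\in\mathbf N^n}c_\alpha h_\alpha$ such that for some (resp. every) $r>0$ one has $\sup_\alpha |c_\alpha|e^{r|\alpha|^{1/(2s)}}<\infty$. Let $K\in C^\infty(\mathbf R^{d_2}\times\mathbf R^{d_1})$ be complex-valued. For sequences $\{\lambda_j\}_{j\ge1}\subseteq[0,\infty)$ and $\{f_{k,j}\}_{j\ge1}$ of functions on $\mathbf R^{d_k}$, $k=1,2$, consider the expansion $$K(x_2,x_1)=\sum_{j=1}^\infty\lambda_j f_{1,j}(x_1)f_{2,j}(x_2)\tag{A}$$ and, for $r,h>0$, the estimates $$\sup_{j\ge1}\bigl(e^{rj^{1/(2ds)}}\lambda_j\bigr)<\infty,\qquad \sup_{j\ge1,\,N\ge0}\frac{e^{rj^{1/(2ds)}}\|H^Nf_{k,j}\|_{L^p(\mathbf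 R^{d_k})}}{h^N(N!)^{2s}}<\infty,\quad k=1,2,\tag{B}$$ where $H^Nf_{k,j}$ is taken in the sense of distributions and the norm is $\infty$ if $H^Nf_{k,j}\notin L^p$. (1) If $K\in\mathcal H_s(\mathbf R^{d_2}\times\mathbf R^{d_1})$ (resp. $K\in\mathcal H_{0,s}(\mathbf R^{d_2}\times\mathbf R^{d_1})$), then there are $\lambda_j\ge0$ and smooth functions $f_{k,j}$ such that, for $k=1,2$, $\{f_{k,j}\}_{j\ge1}$ is a sequence of nonzero, mutually orthogonal elements of $L^2(\mathbf R^{d_k})$, (A) holds at every point, and (B) holds for some $r,h>0$ (resp. for every $r,h>0$). (2) Conversely, if (A) holds almost everywhere for some $\lambda_j\ge0$ and some locally integrable, not necessarily orthogonal, $f_{k,j}$ for which (B) holds for some $r,h>0$ (resp. for every $r,h>0$), then $K\in\mathcal H_s(\mathbf R^{d_2}\times\mathbf R^{d_1})$ (resp. $K\in\mathcal H_{0,s}(\mathbf R^{d_2}\times\mathbf R^{d_1})$). -/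

import Mathlib

open MeasureTheory
open scoped ContDiff ENNReal

noncomputable section

namespace Pilipovic

/-- The normalized Hermite function of order `n` on `ℝ`. Mathlib's `Polynomial.hermite` is the
probabilists' polynomial `He_n`, and `H_n(t) = 2^(n/2) He_n(√2 t)`, so this is
`π^(-1/4) (2^n n!)^(-1/2) H_n(t) exp(-t²/2)`. -/
def hermiteFun1 (n : ℕ) (t : ℝ) : ℝ :=
  Polynomial.aeval (√2 * t) (Polynomial.hermite n) * Real.exp (-t ^ 2 / 2) /
    (Real.pi ^ (1 / 4 : ℝ) * √(n.factorial : ℝ))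

variable {ι : Type*} [Fintype ι]

/-- The Hermite function `h_α`, `α` a multi-index, on the Euclidean space with index set `ι`. -/
def hermiteFun (α : ι → ℕ) (x : EuclideanSpace ℝ ι) : ℝ :=
  ∏ i, hermiteFun1 (α i) (x i)

/-- The weighted sup bound `|c_α| ≤ C exp(-r |α|^(1/(2s)))` on Hermite coefficients. -/
def CoeffBound (s r : ℝ) (c : (ι → ℕ) → ℂ) : Prop :=
  ∃ C : ℝ, ∀ α : ι → ℕ, ‖c α‖ ≤ C * Real.exp (-r * ((∑ i, α i : ℕ) : ℝ) ^ (1 / (2 * s)))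

/-- `f` is the (pointwise) sum of the Hermite series with coefficients `c`. -/
def IsHermiteSeries (c : (ι → ℕ) → ℂ) (f : EuclideanSpace ℝ ι → ℂ) : Prop :=
  ∀ x, HasSum (fun α : ι → ℕ => c α * (hermiteFun α x : ℂ)) (f x)

/-- The Pilipović space `𝓗_s` of Roumieu type, for real `s > 0`. -/
def roumieuSpace (ι : Type*) [Fintype ι] (s : ℝ) : Set (EuclideanSpace ℝ ι → ℂ) :=
  {f | ∃ c : (ι → ℕ) → ℂ, (∃ r > 0, CoeffBound s r c) ∧ IsHermiteSeries c f}

/-- The Pilipović space `𝓗_{0,s}` of Beurling type, for real `s > 0`. -/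
def beurlingSpace (ι : Type*) [Fintype ι] (s : ℝ) : Set (EuclideanSpace ℝ ι → ℂ) :=
  {f | ∃ c : (ι → ℕ) → ℂ, (∀ r > 0, CoeffBound s r c) ∧ IsHermiteSeries c f}

/-- A function on `ℝ^m × ℝ^n` regarded as a function on `ℝ^(m+n)`. -/
def onSum {m n : ℕ} (K : EuclideanSpace ℝ (Fin m) × EuclideanSpace ℝ (Fin n) → ℂ) :
    EuclideanSpace ℝ (Fin m ⊕ Fin n) → ℂ :=
  fun z => K (WithLp.toLp 2 fun i => z (Sum.inl i), WithLp.toLp 2 fun i => z (Sum.inr i))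

/-- The harmonic oscillator `H = |x|² - Δ`, on smooth functions. -/
def harmOsc (φ : EuclideanSpace ℝ ι → ℂ) : EuclideanSpace ℝ ι → ℂ :=
  fun x => (‖x‖ ^ 2 : ℝ) * φ x - Laplacian.laplacian φ x

/-- `H^N f = g` in the sense of distributions. -/
def IsHarmOscPow (N : ℕ) (f g : EuclideanSpace ℝ ι → ℂ) : Prop :=
  ∀ φ : EuclideanSpace ℝ ι → ℂ, ContDiff ℝ ∞ φ → HasCompactSupport φ →
    ∫ x, g x * φ x = ∫ x, f x * (harmOsc^[N] φ) x

/-- `H^N f` belongs to `L^p` and its `L^p` norm is at most `B`. -/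
def HarmOscPowNormLE (p : ℝ≥0∞) (N : ℕ) (f : EuclideanSpace ℝ ι → ℂ) (B : ℝ) : Prop :=
  ∃ g : EuclideanSpace ℝ ι → ℂ, MemLp g p ∧ IsHarmOscPow N f g ∧ eLpNorm g p ≤ ENNReal.ofReal B

/-- Orthogonal sequences of nonzero elements of `L²`, not necessarily normalized. -/
def IsOG (f : ℕ → EuclideanSpace ℝ ι → ℂ) : Prop :=
  (∀ j, MemLp (f j) 2) ∧ (∀ j, ¬ f j =ᵐ[volume] 0) ∧
    ∀ i j, i ≠ j → ∫ x, f i x * starRingEnd ℂ (f j x) = 0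

/-- The weight `exp(r j^(1/(2ds)))`, `j ≥ 1`. Sequences are indexed by `ℕ`, the entry with index
`j` being the one of number `j + 1`. -/
def expWeight (d : ℕ) (s r : ℝ) (j : ℕ) : ℝ :=
  Real.exp (r * ((j : ℝ) + 1) ^ (1 / (2 * d * s)))

/-- `sup_j exp(r j^(1/(2ds))) l_j < ∞`. -/
def ScalarEstimate (d : ℕ) (s r : ℝ) (l : ℕ → ℝ) : Prop :=
  ∃ C : ℝ, ∀ j, expWeight d s r j * l j ≤ C

/-- `sup_{j,N} exp(r j^(1/(2ds))) ‖H^N f_j‖_{L^p} / (h^N (N!)^(2s)) < ∞`. -/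
def FunctionEstimate (p : ℝ≥0∞) (d : ℕ) (s r h : ℝ) (f : ℕ → EuclideanSpace ℝ ι → ℂ) : Prop :=
  ∃ C : ℝ, ∀ j N : ℕ,
    HarmOscPowNormLE p N (f j)
      (C * (h ^ N * (N.factorial : ℝ) ^ (2 * s)) / expWeight d s r j)

/-- The estimates on `l_j`, `f_{1,j}` and `f_{2,j}` with parameters `r` and `h`. -/
def ExpansionEstimates {d₁ d₂ : ℕ} (p : ℝ≥0∞) (s r h : ℝ) (l : ℕ → ℝ)
    (f₁ : ℕ → EuclideanSpace ℝ (Fin d₁) → ℂ) (f₂ : ℕ → EuclideanSpace ℝ (Fin d₂) → ℂ) : Prop :=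
  ScalarEstimate (min d₁ d₂) s r l ∧
    FunctionEstimate p (min d₁ d₂) s r h f₁ ∧ FunctionEstimate p (min d₁ d₂) s r h f₂

/-- `K = ∑_j l_j f_{1,j} ⊗ f_{2,j}` at the point `z = (x₂, x₁)`. -/
def ExpansionAt {d₁ d₂ : ℕ} (K : EuclideanSpace ℝ (Fin d₂) × EuclideanSpace ℝ (Fin d₁) → ℂ)
    (l : ℕ → ℝ) (f₁ : ℕ → EuclideanSpace ℝ (Fin d₁) → ℂ)
    (f₂ : ℕ → EuclideanSpace ℝ (Fin d₂) → ℂ)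
    (z : EuclideanSpace ℝ (Fin d₂) × EuclideanSpace ℝ (Fin d₁)) : Prop :=
  HasSum (fun j => (l j : ℂ) * (f₁ j z.2 * f₂ j z.1)) (K z)

/-- `K` has an expansion with nonnegative `l_j` and orthogonal sequences of smooth functions,
valid at every point, with property `P` of the sequences. -/
def HasOrthogonalExpansion {d₁ d₂ : ℕ}
    (K : EuclideanSpace ℝ (Fin d₂) × EuclideanSpace ℝ (Fin d₁) → ℂ)
    (P : (ℕ → ℝ) → (ℕ → EuclideanSpace ℝ (Fin d₁) → ℂ) →
      (ℕ → EuclideanSpace ℝ (Fin d₂) → ℂ) → Prop) : Prop :=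
  ∃ (l : ℕ → ℝ) (f₁ : ℕ → EuclideanSpace ℝ (Fin d₁) → ℂ)
    (f₂ : ℕ → EuclideanSpace ℝ (Fin d₂) → ℂ),
    (∀ j, 0 ≤ l j) ∧ IsOG f₁ ∧ IsOG f₂ ∧
    (∀ j, ContDiff ℝ ∞ (f₁ j)) ∧ (∀ j, ContDiff ℝ ∞ (f₂ j)) ∧
    (∀ z, ExpansionAt K l f₁ f₂ z) ∧ P l f₁ f₂

/-- `K` has an expansion with nonnegative `l_j` and locally integrable functions, not necessarily
orthogonal, valid almost everywhere, with property `P` of the sequences. -/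
def HasExpansion {d₁ d₂ : ℕ}
    (K : EuclideanSpace ℝ (Fin d₂) × EuclideanSpace ℝ (Fin d₁) → ℂ)
    (P : (ℕ → ℝ) → (ℕ → EuclideanSpace ℝ (Fin d₁) → ℂ) →
      (ℕ → EuclideanSpace ℝ (Fin d₂) → ℂ) → Prop) : Prop :=
  ∃ (l : ℕ → ℝ) (f₁ : ℕ → EuclideanSpace ℝ (Fin d₁) → ℂ)
    (f₂ : ℕ → EuclideanSpace ℝ (Fin d₂) → ℂ),
    (∀ j, 0 ≤ l j) ∧ (∀ j, LocallyIntegrable (f₁ j)) ∧ (∀ j, LocallyIntegrable (f₂ j)) ∧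
    (∀ᵐ z, ExpansionAt K l f₁ f₂ z) ∧ P l f₁ f₂

end Pilipovic

end

noncomputable section
namespace Pilipovic

/-! ### Hermite functions on the line -/

/-! Everything is read off Hermite coefficients. Since `h_α` is an eigenfunction of `H` with
eigenvalue `2|α| + n`, bounds `h^N (N!)^(2s)` on `H^N f` in `L^p` amount, up to a change of
constants, to coefficient decay `exp(-ρ |α|^(1/(2s)))`: see `SeqCoeffBound.functionEstimate` and
`FunctionEstimate.seqCoeffBound`. All `p` are treated at once through `weight = ∏ (1 + x_i²)⁻¹`,
which lies in every `L^p` and dominates each `h_α` with a constant polynomial in `|α|`. Completeness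
of the Hermite functions among functions integrable against `weight` (`ae_eq_hermiteSeries`)
identifies a function with its series.

From an expansion to membership: the coefficients of `∑ λ_j f_{1,j} ⊗ f_{2,j}` are `∑ λ_j a_j(β)
b_j(α)`. The weight in `j` makes the triple sum over `j, α, β` absolutely convergent, so it can be
rearranged into a Hermite series equal to `K` almost everywhere, hence everywhere by continuity.

From membership to an expansion: the coefficients of `K` form a matrix with absolutely summable
entries, hence a compact operator `T` on `ℓ²`, and the expansion is its singular value
decomposition. `T` has norm `O(exp(-ρ n^(1/(2s))))` on vectors vanishing on a box of side `n`, and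
the box has `n^(d₁)` points, so a dimension count bounds the singular value `σ_j` for `j ≈ n^(d₁)`
(`exists_singularValue_le`). The adjoint gives the same with `d₂`, and the smaller dimension wins.
The singular vectors satisfy only `σ_j |v_j(β)| ≤ C exp(-ρ |β|^(1/(2s)))`, so `σ_j` is split as
`σ_j^(1/2) · σ_j^(1/4) · σ_j^(1/4)`: the first factor is `λ_j`, the others go into the functions. By
`|v| ≤ 1`, `σ^(1/4) |v| ≤ (σ |v|)^(1/8) σ^(1/8)` decays both in `β` and in `j`.

In the Beurling case one expansion must work for all rates. The decomposition depends on `T` alone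
and each rate is lost only up to a fixed factor `k` (`exists_bilinear_expansion`). If `T` has finite
rank, the sequences are continued by finitely supported orthonormal vectors with `λ_j = 0`, scaled
by factors that decrease fast enough for every rate. -/

theorem derivative_hermite_succ (n : ℕ) :
    Polynomial.derivative (Polynomial.hermite (n + 1)) =
      ((n : Polynomial ℤ) + 1) * Polynomial.hermite n := by
  induction n with
  | zero => simp
  | succ n ih =>
    have h := congrArg Polynomial.derivative (Polynomial.hermite_succ (n + 1))
    have h2 := Polynomial.hermite_succ n
    rw [h]
    simp only [Polynomial.derivative_sub, Polynomial.derivative_mul, Polynomial.derivative_X, ih,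
      Polynomial.derivative_add, Polynomial.derivative_natCast, Polynomial.derivative_one]
    rw [h2]
    push_cast
    ring

theorem derivative_hermite (n : ℕ) :
    Polynomial.derivative (Polynomial.hermite n) =
      (n : Polynomial ℤ) * Polynomial.hermite (n - 1) := by
  cases n with
  | zero => simp
  | succ n => rw [derivative_hermite_succ]; simp

/-- The lowering coefficient `√(n/2)`. -/
def ladder (n : ℕ) : ℝ := √((n : ℝ) / 2)

theorem ladder_zero : ladder 0 = 0 := by simp [ladder]

theorem ladder_nonneg (n : ℕ) : 0 ≤ ladder n := Real.sqrt_nonneg _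

theorem ladder_sq (n : ℕ) : ladder n ^ 2 = (n : ℝ) / 2 := Real.sq_sqrt (by positivity)

theorem ladder_succ_pos (n : ℕ) : 0 < ladder (n + 1) :=
  Real.sqrt_pos.2 (by positivity)

theorem ladder_le (n : ℕ) : ladder n ≤ n := by
  rcases Nat.eq_zero_or_pos n with rfl | h
  · simp [ladder]
  · have : (1 : ℝ) ≤ n := by exact_mod_cast h
    rw [ladder, Real.sqrt_le_left (by positivity)]
    nlinarith

theorem hermiteFun1_zero (t : ℝ) :
    hermiteFun1 0 t = Real.exp (-t ^ 2 / 2) / Real.pi ^ (1 / 4 : ℝ) := by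
  simp [hermiteFun1]

theorem sqrt_factorial_succ (n : ℕ) :
    √((n + 1).factorial : ℝ) = √2 * ladder (n + 1) * √(n.factorial : ℝ) := by
  rw [ladder, ← Real.sqrt_mul (by positivity), ← Real.sqrt_mul (by positivity),
    Nat.factorial_succ]
  congr 1
  push_cast
  ring

theorem aeval_hermite_succ (n : ℕ) (y : ℝ) :
    Polynomial.aeval y (Polynomial.hermite (n + 1)) =
      y * Polynomial.aeval y (Polynomial.hermite n) -
        n * Polynomial.aeval y (Polynomial.hermite (n - 1)) := by
  rw [Polynomial.hermite_succ, derivative_hermite]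
  simp

/-- The three-term recurrence of the polynomials after normalization. At `n = 0` the index `n - 1`
truncates to `0`, harmlessly because `ladder 0 = 0`. -/
theorem mul_hermiteFun1 (n : ℕ) (t : ℝ) :
    t * hermiteFun1 n t =
      ladder n * hermiteFun1 (n - 1) t + ladder (n + 1) * hermiteFun1 (n + 1) t := by
  have h2 : (√2 : ℝ) ^ 2 = 2 := Real.sq_sqrt (by norm_num)
  have hpi : (0 : ℝ) < Real.pi ^ (1 / 4 : ℝ) := by positivity
  have hs2 : (0 : ℝ) < √2 := by positivity
  have hl := ladder_succ_pos n
  have hf : (0 : ℝ) < √(n.factorial : ℝ) := by positivity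
  unfold hermiteFun1
  rw [sqrt_factorial_succ, aeval_hermite_succ]
  cases n with
  | zero =>
    simp only [ladder_zero, Nat.cast_zero]
    field_simp
    ring
  | succ n =>
    have hl' := ladder_succ_pos n
    have hf : (0 : ℝ) < √(n.factorial : ℝ) := by positivity
    have hsq := ladder_sq (n + 1)
    rw [sqrt_factorial_succ]
    simp only [Nat.add_sub_cancel]
    field_simp
    rw [h2, hsq]
    push_cast
    ring

theorem hasDerivAt_hermiteFun1 (n : ℕ) (t : ℝ) :
    HasDerivAt (hermiteFun1 n)
      (ladder n * hermiteFun1 (n - 1) t - ladder (n + 1) * hermiteFun1 (n + 1) t) t := by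
  -- The polynomial factor contributes twice the lowering term and the Gaussian contributes `-t
  -- h_n`; the recurrence then yields the symmetric ladder form.
  have key : HasDerivAt (hermiteFun1 n)
      (2 * (ladder n * hermiteFun1 (n - 1) t) - t * hermiteFun1 n t) t := by
    have h1 : HasDerivAt (fun t : ℝ => Polynomial.aeval (√2 * t) (Polynomial.hermite n))
        (Polynomial.aeval (√2 * t) (Polynomial.derivative (Polynomial.hermite n)) * √2) t := by
      have := (Polynomial.hasDerivAt_aeval (Polynomial.hermite n) (√2 * t)).comp t
        (((hasDerivAt_id t).const_mul √2))
      rw [mul_one] at this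
      exact this
    have h2 : HasDerivAt (fun t : ℝ => Real.exp (-t ^ 2 / 2))
        (Real.exp (-t ^ 2 / 2) * (-t)) t := by
      have h3 : HasDerivAt (fun t : ℝ => -t ^ 2 / 2) (-t) t := by
        have := ((hasDerivAt_pow 2 t).neg.div_const 2)
        refine this.congr_deriv ?_
        norm_num
        ring
      exact h3.exp
    have h3 := (h1.mul h2).div_const (Real.pi ^ (1 / 4 : ℝ) * √(n.factorial : ℝ))
    refine h3.congr_deriv ?_
    rw [derivative_hermite]
    unfold hermiteFun1
    have hpi : (0 : ℝ) < Real.pi ^ (1 / 4 : ℝ) := by positivity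
    have hs2 : (0 : ℝ) < √2 := by positivity
    cases n with
    | zero => simp [ladder_zero]; ring
    | succ n =>
      have hl' := ladder_succ_pos n
      have hf : (0 : ℝ) < √(n.factorial : ℝ) := by positivity
      have hsq := ladder_sq (n + 1)
      rw [sqrt_factorial_succ]
      simp only [Nat.add_sub_cancel, map_mul, map_natCast]
      field_simp
      rw [hsq]
      push_cast
      ring
  refine key.congr_deriv ?_
  rw [mul_hermiteFun1]
  ring

theorem continuous_hermiteFun1 (n : ℕ) : Continuous (hermiteFun1 n) :=
  continuous_iff_continuousAt.2 fun t => (hasDerivAt_hermiteFun1 n t).continuousAt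

theorem contDiff_hermiteFun1 (n : ℕ) : ContDiff ℝ ∞ (hermiteFun1 n) := by
  unfold hermiteFun1
  have : ContDiff ℝ ∞ fun t : ℝ => Polynomial.aeval (√2 * t) (Polynomial.hermite n) :=
    (Polynomial.contDiff_aeval _ _).comp (contDiff_const.mul contDiff_id)
  exact (this.mul (by fun_prop)).div_const _

theorem deriv_hermiteFun1 (n : ℕ) (t : ℝ) :
    deriv (hermiteFun1 n) t =
      ladder n * hermiteFun1 (n - 1) t - ladder (n + 1) * hermiteFun1 (n + 1) t :=
  (hasDerivAt_hermiteFun1 n t).deriv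

theorem deriv_deriv_hermiteFun1 (n : ℕ) (t : ℝ) :
    deriv (deriv (hermiteFun1 n)) t = (t ^ 2 - (2 * n + 1)) * hermiteFun1 n t := by
  have h : deriv (hermiteFun1 n) = fun t =>
      ladder n * hermiteFun1 (n - 1) t - ladder (n + 1) * hermiteFun1 (n + 1) t :=
    funext (deriv_hermiteFun1 n)
  rw [h, (((hasDerivAt_hermiteFun1 (n - 1) t).const_mul (ladder n)).fun_sub
    ((hasDerivAt_hermiteFun1 (n + 1) t).const_mul (ladder (n + 1)))).deriv]
  have e : (t ^ 2 - (2 * n + 1)) * hermiteFun1 n t =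
      t * (t * hermiteFun1 n t) - (2 * n + 1) * hermiteFun1 n t := by ring
  rw [e, mul_hermiteFun1 n t, mul_add, mul_left_comm, mul_left_comm t (ladder (n + 1)),
    mul_hermiteFun1 (n + 1) t, mul_hermiteFun1 (n - 1) t]
  have s1 := ladder_sq (n + 1)
  cases n with
  | zero =>
    simp only [ladder_zero, Nat.cast_zero] at s1 ⊢
    push_cast at s1
    linear_combination (-2 * hermiteFun1 0 t) * s1
  | succ n =>
    have s2 := ladder_sq (n + 1)
    simp only [Nat.add_sub_cancel] at s1 s2 ⊢
    push_cast at s1 s2 ⊢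
    linear_combination (-2 * hermiteFun1 (n + 1) t) * s1 + (-2 * hermiteFun1 (n + 1) t) * s2

/-- The recurrence trades one order for one power of `t`, so induction leaves only the Gaussian,
with all powers. The constants are not controlled in `n`; they serve for integrability and for the
cut-off argument. -/
theorem exists_bound_pow_mul_hermiteFun1 (n : ℕ) :
    ∀ k : ℕ, ∃ C : ℝ, ∀ t, |t ^ k * hermiteFun1 n t| ≤ C := by
  induction n using Nat.strong_induction_on with
  | _ n ih =>
    cases n with
    | zero =>
      intro k
      have hpi : (0 : ℝ) < Real.pi ^ (1 / 4 : ℝ) := by positivity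
      refine ⟨(1 + 2 ^ k * k.factorial) / Real.pi ^ (1 / 4 : ℝ), fun t => ?_⟩
      rw [hermiteFun1_zero, mul_div_assoc', abs_div, abs_of_pos hpi]
      gcongr
      rw [abs_mul, abs_of_pos (Real.exp_pos _), abs_pow]
      have h1 := Real.pow_div_factorial_le_exp (t ^ 2 / 2) (by positivity) k
      have hE := Real.exp_pos (t ^ 2 / 2)
      rw [neg_div, Real.exp_neg]
      rw [div_le_iff₀ (by positivity)] at h1
      rw [← div_eq_mul_inv, div_le_iff₀ hE]
      have h2 : |t| ^ k ≤ 1 + |t| ^ (2 * k) := by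
        rcases le_total |t| 1 with h | h
        · have := pow_le_one₀ (n := k) (abs_nonneg t) h
          have : 0 ≤ |t| ^ (2 * k) := by positivity
          linarith
        · have := pow_le_pow_right₀ h (show k ≤ 2 * k by omega)
          linarith
      have h3 : |t| ^ (2 * k) = 2 ^ k * (t ^ 2 / 2) ^ k := by
        rw [pow_mul, sq_abs, ← mul_pow]; congr 1; ring
      have h4 : 1 ≤ Real.exp (t ^ 2 / 2) := Real.one_le_exp (by positivity)
      have h5 : (0 : ℝ) < 2 ^ k := by positivity
      calc |t| ^ k ≤ 1 + 2 ^ k * (t ^ 2 / 2) ^ k := by rw [← h3]; exact h2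
        _ ≤ Real.exp (t ^ 2 / 2) + 2 ^ k * (Real.exp (t ^ 2 / 2) * k.factorial) := by gcongr
        _ = _ := by ring
    | succ n =>
      intro k
      obtain ⟨C1, h1⟩ := ih n (by omega) (k + 1)
      obtain ⟨C2, h2⟩ := ih (n - 1) (by omega) k
      have hl := ladder_succ_pos n
      refine ⟨(C1 + ladder n * C2) / ladder (n + 1), fun t => ?_⟩
      have e : t ^ k * hermiteFun1 (n + 1) t = (t ^ (k + 1) * hermiteFun1 n t -
          ladder n * (t ^ k * hermiteFun1 (n - 1) t)) / ladder (n + 1) := by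
        rw [pow_succ, mul_assoc, mul_hermiteFun1 n t]
        field_simp
        ring
      rw [e, abs_div, abs_of_pos hl]
      gcongr
      refine (abs_sub _ _).trans (add_le_add (h1 t) ?_)
      rw [abs_mul, abs_of_nonneg (ladder_nonneg n)]
      exact mul_le_mul_of_nonneg_left (h2 t) (ladder_nonneg n)

theorem exists_hermiteFun1_le_inv (n : ℕ) :
    ∃ C : ℝ, ∀ t, |hermiteFun1 n t| ≤ C * (1 + t ^ 2)⁻¹ := by
  obtain ⟨C1, h1⟩ := exists_bound_pow_mul_hermiteFun1 n 0
  obtain ⟨C2, h2⟩ := exists_bound_pow_mul_hermiteFun1 n 2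
  refine ⟨C1 + C2, fun t => ?_⟩
  rw [← div_eq_mul_inv, le_div_iff₀ (by positivity)]
  have := h1 t
  have := h2 t
  simp only [pow_zero, one_mul, abs_mul, abs_pow, sq_abs] at *
  linarith

theorem integrable_hermiteFun1_mul (m n : ℕ) :
    Integrable fun t => hermiteFun1 m t * hermiteFun1 n t := by
  obtain ⟨C1, h1⟩ := exists_hermiteFun1_le_inv m
  obtain ⟨C2, h2⟩ := exists_bound_pow_mul_hermiteFun1 n 0
  refine (integrable_inv_one_add_sq.const_mul (C1 * C2)).mono'
    ((continuous_hermiteFun1 m).mul (continuous_hermiteFun1 n)).aestronglyMeasurable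
    (Filter.Eventually.of_forall fun t => ?_)
  have h2 := h2 t
  simp only [pow_zero, one_mul] at h2
  rw [norm_mul, Real.norm_eq_abs, Real.norm_eq_abs]
  calc |hermiteFun1 m t| * |hermiteFun1 n t| ≤ (C1 * (1 + t ^ 2)⁻¹) * C2 :=
        mul_le_mul (h1 t) h2 (abs_nonneg _) ((abs_nonneg _).trans (h1 t))
    _ = _ := by ring

/-- Raising is adjoint to lowering: integration by parts gives one relation, symmetry of
multiplication by `t` another, and their combination isolates these two terms. -/
theorem integral_hermiteFun1_mul_succ (m n : ℕ) :
    ladder (n + 1) * ∫ t, hermiteFun1 m t * hermiteFun1 (n + 1) t =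
      ladder m * ∫ t, hermiteFun1 (m - 1) t * hermiteFun1 n t := by
  have hI := integrable_hermiteFun1_mul
  have ibp := integral_mul_deriv_eq_deriv_mul_of_integrable
    (u := hermiteFun1 m) (v := hermiteFun1 n)
    (u' := fun t => ladder m * hermiteFun1 (m - 1) t - ladder (m + 1) * hermiteFun1 (m + 1) t)
    (v' := fun t => ladder n * hermiteFun1 (n - 1) t - ladder (n + 1) * hermiteFun1 (n + 1) t)
    (fun t _ => hasDerivAt_hermiteFun1 m t) (fun t _ => hasDerivAt_hermiteFun1 n t)
    ((((hI m (n - 1)).const_mul (ladder n)).sub ((hI m (n + 1)).const_mul (ladder (n + 1)))).congr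
      (.of_forall fun t => by simp only [Pi.sub_apply, Pi.mul_apply]; ring))
    ((((hI (m - 1) n).const_mul (ladder m)).sub ((hI (m + 1) n).const_mul (ladder (m + 1)))).congr
      (.of_forall fun t => by simp only [Pi.sub_apply, Pi.mul_apply]; ring))
    (hI m n)
  have e1 : ∫ t, hermiteFun1 m t * (t * hermiteFun1 n t) =
      ∫ t, t * hermiteFun1 m t * hermiteFun1 n t := by
    congr 1; ext t; ring
  have a1 : ∫ t, hermiteFun1 m t * (ladder n * hermiteFun1 (n - 1) t -
      ladder (n + 1) * hermiteFun1 (n + 1) t) =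
      ladder n * (∫ t, hermiteFun1 m t * hermiteFun1 (n - 1) t) -
        ladder (n + 1) * ∫ t, hermiteFun1 m t * hermiteFun1 (n + 1) t := by
    rw [← integral_const_mul, ← integral_const_mul, ← integral_sub ((hI _ _).const_mul _)
      ((hI _ _).const_mul _)]
    congr 1; ext t; ring
  have a2 : ∫ t, (ladder m * hermiteFun1 (m - 1) t - ladder (m + 1) * hermiteFun1 (m + 1) t) *
      hermiteFun1 n t = ladder m * (∫ t, hermiteFun1 (m - 1) t * hermiteFun1 n t) -
        ladder (m + 1) * ∫ t, hermiteFun1 (m + 1) t * hermiteFun1 n t := by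
    rw [← integral_const_mul, ← integral_const_mul, ← integral_sub ((hI _ _).const_mul _)
      ((hI _ _).const_mul _)]
    congr 1; ext t; ring
  have a3 : ∫ t, hermiteFun1 m t * (t * hermiteFun1 n t) =
      ladder n * (∫ t, hermiteFun1 m t * hermiteFun1 (n - 1) t) +
        ladder (n + 1) * ∫ t, hermiteFun1 m t * hermiteFun1 (n + 1) t := by
    rw [← integral_const_mul, ← integral_const_mul, ← integral_add ((hI _ _).const_mul _)
      ((hI _ _).const_mul _)]
    congr 1; ext t; rw [mul_hermiteFun1]; ring
  have a4 : ∫ t, t * hermiteFun1 m t * hermiteFun1 n t =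
      ladder m * (∫ t, hermiteFun1 (m - 1) t * hermiteFun1 n t) +
        ladder (m + 1) * ∫ t, hermiteFun1 (m + 1) t * hermiteFun1 n t := by
    rw [← integral_const_mul, ← integral_const_mul, ← integral_add ((hI _ _).const_mul _)
      ((hI _ _).const_mul _)]
    congr 1; ext t; rw [mul_hermiteFun1]; ring
  rw [a1, a2] at ibp
  rw [a3, a4] at e1
  linarith

theorem integral_hermiteFun1_mul (m n : ℕ) :
    ∫ t, hermiteFun1 m t * hermiteFun1 n t = if m = n then 1 else 0 := by
  have zero_right : ∀ m, ∫ t, hermiteFun1 m t * hermiteFun1 0 t = if m = 0 then 1 else 0 := by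
    intro m
    cases m with
    | zero =>
      have e : (fun t => hermiteFun1 0 t * hermiteFun1 0 t) =
          fun t => (√Real.pi)⁻¹ * Real.exp (-1 * t ^ 2) := by
        ext t
        rw [hermiteFun1_zero, div_mul_div_comm, ← Real.exp_add, ← Real.rpow_add Real.pi_pos,
          Real.sqrt_eq_rpow, div_eq_inv_mul]
        congr 2
        · norm_num
        · ring
      rw [e, integral_const_mul, integral_gaussian]
      simp [Real.sqrt_ne_zero'.2 Real.pi_pos]
    | succ m =>
      have h := integral_hermiteFun1_mul_succ 0 m
      rw [ladder_zero, zero_mul] at h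
      have := (mul_eq_zero.1 h).resolve_left (ladder_succ_pos m).ne'
      simp only [Nat.succ_ne_zero, if_false]
      rw [← this]
      congr 1; ext t; ring
  induction n generalizing m with
  | zero => exact zero_right m
  | succ n ih =>
    have h := integral_hermiteFun1_mul_succ m n
    rw [ih (m - 1)] at h
    have hl := ladder_succ_pos n
    cases m with
    | zero =>
      rw [ladder_zero, zero_mul] at h
      simpa [hl.ne'] using h
    | succ m =>
      simp only [Nat.add_sub_cancel] at h
      by_cases hmn : m = n
      · subst hmn
        simp only [if_true, mul_one] at h ⊢
        exact (mul_eq_left₀ hl.ne').1 h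
      · simp only [hmn, if_false, mul_zero] at h
        simp only [add_left_inj, hmn, if_false]
        simpa [hl.ne'] using h

/-- A one-dimensional Sobolev bound: `u(t)² = ∫_{-∞}^t 2 u u' ≤ ∫ u² + ∫ u'²`, where the first
integral is `1` and the ladder formula bounds the second by `2n + 1`. -/
theorem hermiteFun1_sq_le (n : ℕ) (t : ℝ) : hermiteFun1 n t ^ 2 ≤ 2 * n + 2 := by
  have hI := integrable_hermiteFun1_mul
  set u := hermiteFun1 n
  set u' : ℝ → ℝ := fun t =>
    ladder n * hermiteFun1 (n - 1) t - ladder (n + 1) * hermiteFun1 (n + 1) t with hu'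
  have hu : ∀ t, HasDerivAt u (u' t) t := hasDerivAt_hermiteFun1 n
  have h2 : ∀ t, HasDerivAt (fun t => u t ^ 2) (2 * (u t * u' t)) t := by
    intro t
    refine ((hu t).pow 2).congr_deriv ?_
    simp; ring
  have hq : Integrable fun t => u' t ^ 2 := by
    have := (((hI (n - 1) (n - 1)).const_mul (ladder n ^ 2)).add
      ((hI (n + 1) (n + 1)).const_mul (ladder (n + 1) ^ 2))).sub
      ((hI (n - 1) (n + 1)).const_mul (2 * ladder n * ladder (n + 1)))
    refine this.congr (.of_forall fun t => ?_)
    simp only [Pi.add_apply, Pi.sub_apply, hu']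
    ring
  have hq' : ∫ t, u' t ^ 2 ≤ 2 * n + 1 := by
    have b : ∀ t, u' t ^ 2 ≤ 2 * ladder n ^ 2 * (hermiteFun1 (n - 1) t * hermiteFun1 (n - 1) t) +
        2 * ladder (n + 1) ^ 2 * (hermiteFun1 (n + 1) t * hermiteFun1 (n + 1) t) := by
      intro t
      simp only [hu']
      nlinarith [sq_nonneg (ladder n * hermiteFun1 (n - 1) t +
        ladder (n + 1) * hermiteFun1 (n + 1) t)]
    refine (integral_mono hq (((hI _ _).const_mul _).fun_add ((hI _ _).const_mul _)) b).trans ?_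
    rw [integral_add ((hI _ _).const_mul _) ((hI _ _).const_mul _), integral_const_mul,
      integral_const_mul, integral_hermiteFun1_mul, integral_hermiteFun1_mul, ladder_sq, ladder_sq]
    push_cast
    simp only [if_true]
    linarith
  have hp : Integrable fun t => u t ^ 2 := (hI n n).congr (.of_forall fun t => (sq _).symm)
  have hp' : ∫ t, u t ^ 2 = 1 := by
    have := integral_hermiteFun1_mul n n
    simp only [if_true] at this
    rw [← this]; congr 1; ext t; rw [sq]
  have hbnd : ∀ t, ‖2 * (u t * u' t)‖ ≤ u t ^ 2 + u' t ^ 2 := by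
    intro t
    rw [Real.norm_eq_abs, abs_le]
    constructor <;> nlinarith [sq_nonneg (u t + u' t), sq_nonneg (u t - u' t)]
  have hd : Integrable fun t => 2 * (u t * u' t) :=
    (hp.add hq).mono' (by
      refine (Continuous.aestronglyMeasurable ?_)
      have := continuous_hermiteFun1
      have h1 := this n
      have h2 := this (n - 1)
      have h3 := this (n + 1)
      fun_prop) (.of_forall hbnd)
  have hlim : Filter.Tendsto (fun t => u t ^ 2) Filter.atBot (nhds 0) :=
    tendsto_zero_of_hasDerivAt_of_integrableOn_Iic (a := 0) (fun t _ => h2 t)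
      hd.integrableOn hp.integrableOn
  have e := integral_Iic_of_hasDerivAt_of_tendsto' (a := t) (fun t _ => h2 t) hd.integrableOn hlim
  rw [sub_zero] at e
  rw [← e]
  calc ∫ t in Set.Iic t, 2 * (u t * u' t) ≤ ∫ t in Set.Iic t, (u t ^ 2 + u' t ^ 2) :=
        integral_mono hd.integrableOn (hp.fun_add hq).integrableOn
          fun t => (le_abs_self _).trans (hbnd t)
    _ ≤ ∫ t, (u t ^ 2 + u' t ^ 2) :=
        setIntegral_le_integral (hp.add hq) (.of_forall fun t => by positivity)
    _ = (∫ t, u t ^ 2) + ∫ t, u' t ^ 2 := integral_add hp hq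
    _ ≤ 2 * n + 2 := by rw [hp']; linarith

theorem abs_hermiteFun1_le (n : ℕ) (t : ℝ) : |hermiteFun1 n t| ≤ 2 * ((n : ℝ) + 1) := by
  apply abs_le_of_sq_le_sq _ (by positivity)
  have := hermiteFun1_sq_le n t
  have hn : (0 : ℝ) ≤ n := by positivity
  nlinarith

/-- In the recurrence the orders shift by one and the coefficients are at most `n + 1`, so each
factor `t` costs one power of `n + 1`. -/
theorem abs_mul_hermiteFun1_le {B : ℝ} {k : ℕ} {t : ℝ}
    {u : ℝ → ℝ} (h : ∀ n, |u t * hermiteFun1 n t| ≤ B * ((n : ℝ) + 1) ^ k) (n : ℕ) :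
    |t * u t * hermiteFun1 n t| ≤ 2 ^ (k + 1) * B * ((n : ℝ) + 1) ^ (k + 1) := by
  have hB : 0 ≤ B := by simpa using (abs_nonneg _).trans (h 0)
  have e : t * u t * hermiteFun1 n t = ladder n * (u t * hermiteFun1 (n - 1) t) +
      ladder (n + 1) * (u t * hermiteFun1 (n + 1) t) := by
    rw [mul_comm t, mul_assoc, mul_hermiteFun1]; ring
  have hn1 : ((n - 1 : ℕ) : ℝ) ≤ n := by exact_mod_cast Nat.sub_le n 1
  have hn : (0 : ℝ) ≤ n := by positivity
  have l1 : ladder n ≤ n + 1 := (ladder_le n).trans (by linarith)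
  have l2 : ladder (n + 1) ≤ n + 1 := by simpa using ladder_le (n + 1)
  have b1 : |u t * hermiteFun1 (n - 1) t| ≤ B * (2 * ((n : ℝ) + 1)) ^ k :=
    (h _).trans (by gcongr; linarith)
  have b2 : |u t * hermiteFun1 (n + 1) t| ≤ B * (2 * ((n : ℝ) + 1)) ^ k :=
    (h _).trans (by gcongr; push_cast; linarith)
  rw [e]
  refine (abs_add_le _ _).trans ?_
  rw [abs_mul (ladder n), abs_mul (ladder (n + 1)), abs_of_nonneg (ladder_nonneg _),
    abs_of_nonneg (ladder_nonneg _)]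
  calc _ ≤ ((n : ℝ) + 1) * (B * (2 * ((n : ℝ) + 1)) ^ k) +
        ((n : ℝ) + 1) * (B * (2 * ((n : ℝ) + 1)) ^ k) := by gcongr
    _ = _ := by rw [mul_pow]; ring

/-- The Hermite functions are bounded by the integrable weight `(1 + t²)⁻¹`, with a constant of
polynomial growth in the order. -/
theorem abs_hermiteFun1_le_inv (n : ℕ) (t : ℝ) :
    |hermiteFun1 n t| ≤ 100 * ((n : ℝ) + 1) ^ 3 * (1 + t ^ 2)⁻¹ := by
  have h0 : ∀ n, |(fun _ : ℝ => (1 : ℝ)) t * hermiteFun1 n t| ≤ 2 * ((n : ℝ) + 1) ^ 1 := by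
    intro n; simpa using abs_hermiteFun1_le n t
  -- Two factors `t` turn the constant `2` into `8` and then `64`; the total `2 (n + 1) + 64 (n +
  -- 1)^3` stays below `100 (n + 1)^3`.
  have h1 := abs_mul_hermiteFun1_le (u := fun _ => 1) h0
  have h2 := abs_mul_hermiteFun1_le (u := fun t => t * 1) h1 n
  rw [← div_eq_mul_inv, le_div_iff₀ (by positivity)]
  have h3 := abs_hermiteFun1_le n t
  have e : |hermiteFun1 n t| * (1 + t ^ 2) = |hermiteFun1 n t| +
      |t * (t * 1) * hermiteFun1 n t| := by
    rw [mul_one, abs_mul (t * t), abs_mul_self]; ring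
  rw [e]
  have hn : (0 : ℝ) ≤ n := by positivity
  have : (1 : ℝ) ≤ (n + 1) ^ 2 := one_le_pow₀ (by linarith)
  have : ((n : ℝ) + 1) ≤ (n + 1) ^ 3 := by nlinarith
  norm_num only at h2
  linarith

end Pilipovic
end

noncomputable section
namespace Pilipovic

variable {ι : Type*} [Fintype ι]

/-! ### The weight and the growth of Hermite functions -/

/-- An integrable weight bounding all Hermite functions. -/
def weight (x : EuclideanSpace ℝ ι) : ℝ := ∏ i, (1 + x i ^ 2)⁻¹

/-- Constants of polynomial growth with `|h_α| ≤ hermiteBound α * weight`. -/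
def hermiteBound (α : ι → ℕ) : ℝ := ∏ i, (100 * ((α i : ℝ) + 1) ^ 3)

theorem weight_pos (x : EuclideanSpace ℝ ι) : 0 < weight x :=
  Finset.prod_pos fun i _ => by positivity

theorem weight_le_one (x : EuclideanSpace ℝ ι) : weight x ≤ 1 :=
  Finset.prod_le_one (fun i _ => by positivity) fun i _ =>
    inv_le_one_of_one_le₀ (by nlinarith [sq_nonneg (x i)])

theorem continuous_weight : Continuous (weight : EuclideanSpace ℝ ι → ℝ) := by
  refine continuous_finsetProd _ fun i _ => Continuous.inv₀ (by fun_prop) fun x => ?_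
  positivity

theorem hermiteBound_pos (α : ι → ℕ) : 0 < hermiteBound α :=
  Finset.prod_pos fun i _ => by positivity

theorem hermiteBound_le (α : ι → ℕ) :
    hermiteBound α ≤ 100 ^ Fintype.card ι * (((∑ i, α i : ℕ) : ℝ) + 1) ^ (3 * Fintype.card ι) := by
  have : hermiteBound α ≤ ∏ _i : ι, (100 * (((∑ i, α i : ℕ) : ℝ) + 1) ^ 3) := by
    refine Finset.prod_le_prod (fun i _ => by positivity) fun i _ => ?_
    have : (α i : ℝ) ≤ ((∑ i, α i : ℕ) : ℝ) := by
      exact_mod_cast Finset.single_le_sum (fun j _ => Nat.zero_le (α j)) (Finset.mem_univ i)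
    gcongr
  refine this.trans_eq ?_
  rw [Finset.prod_const, mul_pow, ← pow_mul, Finset.card_univ]

theorem abs_hermiteFun_le (α : ι → ℕ) (x : EuclideanSpace ℝ ι) :
    |hermiteFun α x| ≤ hermiteBound α * weight x := by
  rw [hermiteFun, hermiteBound, weight, ← Finset.prod_mul_distrib, Finset.abs_prod]
  exact Finset.prod_le_prod (fun i _ => abs_nonneg _) fun i _ => abs_hermiteFun1_le_inv _ _

theorem abs_hermiteFun_le_hermiteBound (α : ι → ℕ) (x : EuclideanSpace ℝ ι) :
    |hermiteFun α x| ≤ hermiteBound α :=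
  (abs_hermiteFun_le α x).trans
    (mul_le_of_le_one_right (hermiteBound_pos α).le (weight_le_one x))

theorem continuous_hermiteFun (α : ι → ℕ) : Continuous (hermiteFun α) :=
  continuous_finsetProd _ fun i _ => (continuous_hermiteFun1 _).comp (by fun_prop)

theorem integrable_tensor {u : ι → ℝ → ℝ} (hu : ∀ i, Integrable (u i)) :
    Integrable fun x : EuclideanSpace ℝ ι => ∏ i, u i (x i) := by
  have h := Integrable.fintype_prod_dep (μ := fun _ : ι => (volume : Measure ℝ)) hu
  exact (PiLp.volume_preserving_ofLp ι).integrable_comp_of_integrable h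

theorem integral_tensor (u : ι → ℝ → ℝ) :
    ∫ x : EuclideanSpace ℝ ι, ∏ i, u i (x i) = ∏ i, ∫ t, u i t := by
  rw [← integral_fintype_prod_volume_eq_prod]
  exact (PiLp.volume_preserving_ofLp ι).integral_comp
    (MeasurableEquiv.toLp 2 (ι → ℝ)).symm.measurableEmbedding (fun x : ι → ℝ => ∏ i, u i (x i))

theorem integrable_weight : Integrable (weight : EuclideanSpace ℝ ι → ℝ) :=
  integrable_tensor fun _ => integrable_inv_one_add_sq

/-- Since `0 < weight ≤ 1`, finite powers with exponent at least `1` are dominated by the integrable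
`weight` itself, and boundedness covers `p = ∞`. -/
theorem memLp_weight {p : ℝ≥0∞} (hp : 1 ≤ p) : MemLp (weight : EuclideanSpace ℝ ι → ℝ) p := by
  have hm := (continuous_weight (ι := ι)).aestronglyMeasurable (μ := volume)
  by_cases htop : p = ⊤
  · subst htop
    exact memLp_top_of_bound hm 1 (.of_forall fun x => by
      rw [Real.norm_eq_abs, abs_of_pos (weight_pos x)]; exact weight_le_one x)
  · have hp0 : p ≠ 0 := (zero_lt_one.trans_le hp).ne'
    rw [← integrable_norm_rpow_iff hm hp0 htop]
    have hp1 : 1 ≤ p.toReal := by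
      rw [← ENNReal.toReal_one]; exact ENNReal.toReal_mono htop hp
    refine integrable_weight.mono'
      ((continuous_weight.norm.rpow_const
        fun x => Or.inr (by linarith)).aestronglyMeasurable)
      (.of_forall fun x => ?_)
    have h0 := weight_pos x
    rw [Real.norm_eq_abs, Real.norm_eq_abs, abs_of_pos h0, abs_of_pos (Real.rpow_pos_of_pos h0 _)]
    simpa using Real.rpow_le_rpow_of_exponent_ge h0 (weight_le_one x) hp1

theorem integral_hermiteFun_mul [DecidableEq ι] (α β : ι → ℕ) :
    ∫ x : EuclideanSpace ℝ ι, hermiteFun α x * hermiteFun β x = if α = β then 1 else 0 := by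
  have h := integral_tensor fun i t => hermiteFun1 (α i) t * hermiteFun1 (β i) t
  simp only [integral_hermiteFun1_mul] at h
  simp only [hermiteFun, ← Finset.prod_mul_distrib]
  rw [h]
  split_ifs with hαβ
  · subst hαβ; simp
  · obtain ⟨i, hi⟩ := Function.ne_iff.1 hαβ
    exact Finset.prod_eq_zero (Finset.mem_univ i) (if_neg hi)

/-- Functions in `L^p` are integrable against the weight, with a bound. -/
theorem exists_integral_norm_mul_weight_le {p : ℝ≥0∞} (hp : 1 ≤ p) :
    ∃ W : ℝ, 0 ≤ W ∧ ∀ (g : EuclideanSpace ℝ ι → ℂ), MemLp g p → ∀ B : ℝ, 0 ≤ B →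
      eLpNorm g p ≤ ENNReal.ofReal B →
      Integrable (fun x => ‖g x‖ * weight x) ∧ ∫ x, ‖g x‖ * weight x ≤ W * B := by
  -- Hölder's inequality with the conjugate exponent, endpoints included; `W` is the norm of
  -- `weight` in `L^q`.
  have hpq := ENNReal.HolderConjugate.conjExponent hp
  set q := ENNReal.conjExponent p
  have hq : 1 ≤ q := ENNReal.HolderConjugate.one_le q p
  have hw := memLp_weight (ι := ι) hq
  refine ⟨(eLpNorm (weight : EuclideanSpace ℝ ι → ℝ) q).toReal, ENNReal.toReal_nonneg,
    fun g hg B hB hgB => ?_⟩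
  have hI : Integrable (fun x => ‖g x‖ * weight x) := hg.norm.integrable_mul hw
  refine ⟨hI, ?_⟩
  have h1 := eLpNorm_smul_le_mul_eLpNorm (r := 1) (p := p) (q := q) hw.1 hg.norm.1
  rw [eLpNorm_norm] at h1
  have h2 : ENNReal.ofReal (∫ x, ‖g x‖ * weight x) ≤
      ENNReal.ofReal B * eLpNorm (weight : EuclideanSpace ℝ ι → ℝ) q := by
    refine le_trans ?_ (h1.trans (mul_le_mul_left hgB _))
    rw [eLpNorm_one_eq_lintegral_enorm, ofReal_integral_eq_lintegral_ofReal hI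
      (.of_forall fun x => mul_nonneg (norm_nonneg _) (weight_pos x).le)]
    refine lintegral_mono fun x => ?_
    rw [← ofReal_norm]
    exact ENNReal.ofReal_le_ofReal (le_abs_self _)
  rw [← ENNReal.ofReal_toReal hw.2.ne, ← ENNReal.ofReal_mul hB,
    ENNReal.ofReal_le_ofReal_iff (by positivity)] at h2
  rwa [mul_comm]

/-! ### Derivatives of tensor products -/

/-- The tensor product of functions of one variable. -/
def tensor (u : ι → ℝ → ℝ) (x : EuclideanSpace ℝ ι) : ℝ := ∏ i, u i (x i)

theorem hermiteFun_eq_tensor (α : ι → ℕ) :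
    hermiteFun α = tensor fun i => hermiteFun1 (α i) := rfl

theorem contDiff_tensor {n : WithTop ℕ∞} {u : ι → ℝ → ℝ} (hu : ∀ i, ContDiff ℝ n (u i)) :
    ContDiff ℝ n (tensor u) :=
  contDiff_prod fun i _ => (hu i).comp (by fun_prop)

theorem contDiff_hermiteFun (α : ι → ℕ) : ContDiff ℝ ∞ (hermiteFun α) :=
  contDiff_tensor fun _ => contDiff_hermiteFun1 _

variable [DecidableEq ι]

theorem hasFDerivAt_tensor {u : ι → ℝ → ℝ} (hu : ∀ i, Differentiable ℝ (u i))
    (x : EuclideanSpace ℝ ι) :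
    HasFDerivAt (tensor u) (∑ i, tensor (Function.update u i (deriv (u i))) x •
      (EuclideanSpace.proj i : EuclideanSpace ℝ ι →L[ℝ] ℝ)) x := by
  have h : ∀ i ∈ Finset.univ, HasFDerivAt (fun x : EuclideanSpace ℝ ι => u i (x i))
      (deriv (u i) (x i) • (EuclideanSpace.proj i : EuclideanSpace ℝ ι →L[ℝ] ℝ)) x := by
    intro i _
    exact ((hu i (x i)).hasDerivAt).comp_hasFDerivAt x
      (EuclideanSpace.proj i : EuclideanSpace ℝ ι →L[ℝ] ℝ).hasFDerivAt
  refine (HasFDerivAt.finsetProd h).congr_fderiv ?_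
  refine Finset.sum_congr rfl fun i _ => ?_
  rw [smul_smul]
  congr 1
  rw [tensor, ← Finset.prod_erase_mul _ _ (Finset.mem_univ i), Function.update_self]
  congr 1
  refine Finset.prod_congr rfl fun j hj => ?_
  rw [Function.update_of_ne (Finset.ne_of_mem_erase hj)]

theorem fderiv_tensor_single {u : ι → ℝ → ℝ} (hu : ∀ i, Differentiable ℝ (u i))
    (x : EuclideanSpace ℝ ι) (i : ι) :
    fderiv ℝ (tensor u) x (EuclideanSpace.single i 1) =
      tensor (Function.update u i (deriv (u i))) x := by
  rw [(hasFDerivAt_tensor hu x).fderiv]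
  simp

theorem laplacian_eq_sum_fderiv {F : Type*} [NormedAddCommGroup F] [NormedSpace ℝ F]
    {f : EuclideanSpace ℝ ι → F} (hf : ContDiff ℝ 2 f) (x : EuclideanSpace ℝ ι) :
    Laplacian.laplacian f x = ∑ i, fderiv ℝ
      (fun y => fderiv ℝ f y (EuclideanSpace.single i 1)) x (EuclideanSpace.single i 1) := by
  rw [InnerProductSpace.laplacian_eq_iteratedFDeriv_orthonormalBasis f
    (EuclideanSpace.basisFun ι ℝ)]
  refine Finset.sum_congr rfl fun i _ => ?_
  have hd : DifferentiableAt ℝ (fderiv ℝ f) x :=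
    ((hf.fderiv_right (m := 1) (by norm_num)).differentiable (by norm_num)) x
  rw [iteratedFDeriv_two_apply, fderiv_clm_apply hd (differentiableAt_const _)]
  simp

theorem laplacian_tensor {u : ι → ℝ → ℝ} (hu : ∀ i, ContDiff ℝ 2 (u i))
    (x : EuclideanSpace ℝ ι) :
    Laplacian.laplacian (tensor u) x =
      ∑ i, tensor (Function.update u i (deriv (deriv (u i)))) x := by
  rw [laplacian_eq_sum_fderiv (contDiff_tensor hu)]
  refine Finset.sum_congr rfl fun i _ => ?_
  have hd : ∀ i, Differentiable ℝ (u i) := fun i => (hu i).differentiable (by norm_num)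
  have hd' : ∀ j, Differentiable ℝ (Function.update u i (deriv (u i)) j) := by
    intro j
    rcases eq_or_ne j i with rfl | hj
    · rw [Function.update_self]
      exact (hu j).differentiable_deriv_two
    · rw [Function.update_of_ne hj]; exact hd j
  have e : (fun y => fderiv ℝ (tensor u) y (EuclideanSpace.single i 1)) =
      tensor (Function.update u i (deriv (u i))) :=
    funext fun y => fderiv_tensor_single hd y i
  rw [e, fderiv_tensor_single hd']
  simp

theorem tensor_update_mul (u : ι → ℝ → ℝ) (i : ι) (v : ℝ → ℝ) (x : EuclideanSpace ℝ ι) :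
    tensor (Function.update u i v) x = v (x i) * ∏ j ∈ Finset.univ.erase i, u j (x j) := by
  rw [tensor, ← Finset.mul_prod_erase _ _ (Finset.mem_univ i), Function.update_self]
  congr 1
  refine Finset.prod_congr rfl fun j hj => ?_
  rw [Function.update_of_ne (Finset.ne_of_mem_erase hj)]

theorem tensor_eq_mul (u : ι → ℝ → ℝ) (i : ι) (x : EuclideanSpace ℝ ι) :
    tensor u x = u i (x i) * ∏ j ∈ Finset.univ.erase i, u j (x j) := by
  rw [tensor, ← Finset.mul_prod_erase _ _ (Finset.mem_univ i)]

theorem hermiteFun_update (α : ι → ℕ) (i : ι) (n : ℕ) (x : EuclideanSpace ℝ ι) :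
    hermiteFun (Function.update α i n) x =
      hermiteFun1 n (x i) * ∏ j ∈ Finset.univ.erase i, hermiteFun1 (α j) (x j) := by
  rw [hermiteFun, ← Finset.mul_prod_erase _ _ (Finset.mem_univ i), Function.update_self]
  congr 1
  refine Finset.prod_congr rfl fun j hj => ?_
  rw [Function.update_of_ne (Finset.ne_of_mem_erase hj)]

theorem coord_mul_hermiteFun (α : ι → ℕ) (i : ι) (x : EuclideanSpace ℝ ι) :
    x i * hermiteFun α x =
      ladder (α i) * hermiteFun (Function.update α i (α i - 1)) x +
        ladder (α i + 1) * hermiteFun (Function.update α i (α i + 1)) x := by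
  rw [hermiteFun_update, hermiteFun_update, hermiteFun_eq_tensor, tensor_eq_mul _ i,
    ← mul_assoc, mul_hermiteFun1]
  ring

theorem fderiv_hermiteFun (α : ι → ℕ) :
    fderiv ℝ (hermiteFun α) = fun x => ∑ i,
      (ladder (α i) * hermiteFun (Function.update α i (α i - 1)) x -
        ladder (α i + 1) * hermiteFun (Function.update α i (α i + 1)) x) •
      (EuclideanSpace.proj i : EuclideanSpace ℝ ι →L[ℝ] ℝ) := by
  ext1 x
  rw [hermiteFun_eq_tensor, (hasFDerivAt_tensor (fun i =>
    (contDiff_hermiteFun1 (α i)).differentiable (by norm_num)) x).fderiv]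
  refine Finset.sum_congr rfl fun i _ => ?_
  congr 1
  rw [tensor_update_mul, hermiteFun_update, hermiteFun_update, deriv_hermiteFun1]
  ring

/-- The one-dimensional eigenvalue equations add up over the coordinates; the ground-state energy
`1` of each gives `Fintype.card ι`. -/
theorem laplacian_hermiteFun (α : ι → ℕ) (x : EuclideanSpace ℝ ι) :
    Laplacian.laplacian (hermiteFun α) x =
      (‖x‖ ^ 2 - (2 * (∑ i, α i : ℕ) + Fintype.card ι)) * hermiteFun α x := by
  rw [hermiteFun_eq_tensor,
    laplacian_tensor fun i => contDiff_infty.1 (contDiff_hermiteFun1 (α i)) 2]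
  have : ∀ i, tensor (Function.update (fun i => hermiteFun1 (α i)) i
      (deriv (deriv (hermiteFun1 (α i))))) x =
      (x i ^ 2 - (2 * (α i : ℝ) + 1)) * tensor (fun i => hermiteFun1 (α i)) x := by
    intro i
    rw [tensor_update_mul, tensor_eq_mul _ i, deriv_deriv_hermiteFun1]
    ring
  rw [Finset.sum_congr rfl fun i _ => this i, ← Finset.sum_mul, EuclideanSpace.norm_sq_eq]
  congr 1
  rw [Finset.sum_sub_distrib, Finset.sum_add_distrib, ← Finset.mul_sum]
  simp

end Pilipovic
end

noncomputable section
namespace Pilipovic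

variable {ι : Type*} [Fintype ι]

/-! ### Hermite series with rapidly decreasing coefficients -/

/-- The length `|α|` of a multi-index, as a real number. -/
abbrev len (α : ι → ℕ) : ℝ := ((∑ i, α i : ℕ) : ℝ)

/-- Coefficients which are summable against every power of `1 + |α|`. -/
def RapidDecay (c : (ι → ℕ) → ℂ) : Prop :=
  ∀ m : ℕ, Summable fun α => ‖c α‖ * (len α + 1) ^ m

/-- The sum of the Hermite series with coefficients `c`. -/
def hermiteSeries (c : (ι → ℕ) → ℂ) (x : EuclideanSpace ℝ ι) : ℂ :=
  ∑' α, c α * (hermiteFun α x : ℂ)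

theorem len_nonneg (α : ι → ℕ) : 0 ≤ len α := Nat.cast_nonneg _

theorem coord_le_len (α : ι → ℕ) (i : ι) : (α i : ℝ) ≤ len α := by
  exact_mod_cast Finset.single_le_sum (fun j _ => Nat.zero_le (α j)) (Finset.mem_univ i)

theorem len_update_le [DecidableEq ι] (α : ι → ℕ) (i : ι) {n : ℕ} (hn : n ≤ α i + 1) :
    len (Function.update α i n) ≤ len α + 1 := by
  have h : ∑ j, Function.update α i n j ≤ ∑ j, α j + 1 := by
    rw [Finset.sum_update_of_mem (Finset.mem_univ i),
      ← Finset.add_sum_erase _ α (Finset.mem_univ i), Finset.sdiff_singleton_eq_erase]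
    omega
  exact_mod_cast h

/-- A first derivative is a finite combination of neighbouring Hermite functions with coefficients
at most `|α| + 1`, so each derivative raises the polynomial degree in `|α|` by one. This is what
makes rapidly decreasing series smooth. -/
theorem exists_norm_iteratedFDeriv_hermiteFun_le (ι : Type*) [Fintype ι] (k : ℕ) :
    ∃ (C : ℝ) (m : ℕ), 0 ≤ C ∧ ∀ (α : ι → ℕ) (x : EuclideanSpace ℝ ι),
      ‖iteratedFDeriv ℝ k (hermiteFun α) x‖ ≤ C * (len α + 1) ^ m := by
  classical
  induction k with
  | zero =>
    refine ⟨100 ^ Fintype.card ι, 3 * Fintype.card ι, by positivity, fun α x => ?_⟩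
    rw [norm_iteratedFDeriv_zero]
    exact (abs_hermiteFun_le_hermiteBound α x).trans (hermiteBound_le α)
  | succ k ih =>
    obtain ⟨C, m, hC, h⟩ := ih
    let P : ι → EuclideanSpace ℝ ι →L[ℝ] ℝ := fun i => EuclideanSpace.proj i
    -- `L i a` sends `y` to `y • a • P i`. It expresses the derivative through compositions with
    -- fixed linear maps, whose iterated derivatives are bounded by the operator norm.
    let L : ι → ℝ → ℝ →L[ℝ] (EuclideanSpace ℝ ι →L[ℝ] ℝ) :=
      fun i a => ContinuousLinearMap.toSpanSingleton ℝ (a • P i)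
    refine ⟨(∑ i, ‖P i‖) * (2 * C * 2 ^ m), m + 1, by positivity, fun α x => ?_⟩
    have hsm : ∀ (i : ι) (a : ℝ) (β : ι → ℕ), ContDiff ℝ k (L i a ∘ hermiteFun β) :=
      fun i a β => (L i a).contDiff.comp (contDiff_infty.1 (contDiff_hermiteFun β) k)
    have e : fderiv ℝ (hermiteFun α) = fun x => ∑ i,
        ((L i (ladder (α i)) ∘ hermiteFun (Function.update α i (α i - 1))) +
          (L i (-ladder (α i + 1)) ∘ hermiteFun (Function.update α i (α i + 1)))) x := by
      rw [fderiv_hermiteFun]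
      ext1 x
      refine Finset.sum_congr rfl fun i _ => ?_
      simp only [L, P, Pi.add_apply, Function.comp_apply,
        ContinuousLinearMap.toSpanSingleton_apply, smul_smul, ← add_smul]
      congr 1
      ring
    have hadd : ∀ i ∈ Finset.univ, ContDiff ℝ k
        ((L i (ladder (α i)) ∘ hermiteFun (Function.update α i (α i - 1))) +
          (L i (-ladder (α i + 1)) ∘ hermiteFun (Function.update α i (α i + 1)))) :=
      fun i _ => (hsm _ _ _).add (hsm _ _ _)
    rw [← norm_iteratedFDeriv_fderiv, e, iteratedFDeriv_sum hadd, Finset.sum_apply]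
    refine (norm_sum_le _ _).trans ?_
    rw [Finset.sum_mul, Finset.sum_mul]
    refine Finset.sum_le_sum fun i _ => ?_
    rw [iteratedFDeriv_add_apply (hsm _ _ _).contDiffAt (hsm _ _ _).contDiffAt]
    have key : ∀ (a : ℝ) (n : ℕ), |a| ≤ len α + 1 → n ≤ α i + 1 →
        ‖iteratedFDeriv ℝ k (L i a ∘ hermiteFun (Function.update α i n)) x‖ ≤
          ‖P i‖ * (C * 2 ^ m) * (len α + 1) ^ (m + 1) := by
      intro a n ha hn
      have hl := len_nonneg α
      have hL : ‖L i a‖ ≤ (len α + 1) * ‖P i‖ := by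
        simp only [L]
        rw [ContinuousLinearMap.norm_toSpanSingleton, norm_smul]
        gcongr
        exact ha
      have h1 := (L i a).norm_iteratedFDeriv_comp_left
        (contDiff_infty.1 (contDiff_hermiteFun (Function.update α i n)) k).contDiffAt (le_refl _)
        (x := x)
      have h2 : len (Function.update α i n) + 1 ≤ 2 * (len α + 1) := by
        have := len_update_le α i hn
        linarith
      have h3 := len_nonneg (Function.update α i n)
      calc _ ≤ _ := h1
        _ ≤ ((len α + 1) * ‖P i‖) * (C * (2 * (len α + 1)) ^ m) := by
            gcongr
            exact (h _ _).trans (by gcongr)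
        _ = _ := by rw [mul_pow]; ring
    have hi := coord_le_len α i
    have l1 : |ladder (α i)| ≤ len α + 1 := by
      rw [abs_of_nonneg (ladder_nonneg _)]
      linarith [ladder_le (α i)]
    have l2 : |-ladder (α i + 1)| ≤ len α + 1 := by
      rw [abs_neg, abs_of_nonneg (ladder_nonneg _)]
      refine (ladder_le _).trans ?_
      rw [Nat.cast_add, Nat.cast_one]
      linarith
    refine (norm_add_le _ _).trans ?_
    refine (add_le_add (key _ _ l1 (by omega)) (key _ _ l2 le_rfl)).trans_eq ?_
    ring

variable {c : (ι → ℕ) → ℂ}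

theorem RapidDecay.summable_mul_hermiteBound (hc : RapidDecay c) :
    Summable fun α => ‖c α‖ * hermiteBound α := by
  refine Summable.of_nonneg_of_le (fun α => by have := hermiteBound_pos α; positivity) (fun α => ?_)
    ((hc (3 * Fintype.card ι)).mul_left (100 ^ Fintype.card ι))
  calc ‖c α‖ * hermiteBound α ≤ ‖c α‖ * (100 ^ Fintype.card ι *
        (len α + 1) ^ (3 * Fintype.card ι)) := by gcongr; exact hermiteBound_le α
    _ = _ := by ring

theorem norm_coeff_mul_hermiteFun_le (c : (ι → ℕ) → ℂ) (α : ι → ℕ) (x : EuclideanSpace ℝ ι) :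
    ‖c α * (hermiteFun α x : ℂ)‖ ≤ ‖c α‖ * hermiteBound α * weight x := by
  rw [norm_mul, Complex.norm_real, mul_assoc]
  exact mul_le_mul_of_nonneg_left (abs_hermiteFun_le α x) (norm_nonneg _)

theorem RapidDecay.summable (hc : RapidDecay c) (x : EuclideanSpace ℝ ι) :
    Summable fun α => c α * (hermiteFun α x : ℂ) :=
  Summable.of_norm_bounded (hc.summable_mul_hermiteBound.mul_right (weight x))
    fun α => norm_coeff_mul_hermiteFun_le c α x

theorem RapidDecay.isHermiteSeries (hc : RapidDecay c) : IsHermiteSeries c (hermiteSeries c) :=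
  fun x => (hc.summable x).hasSum

theorem RapidDecay.norm_hermiteSeries_le (hc : RapidDecay c) (x : EuclideanSpace ℝ ι) :
    ‖hermiteSeries c x‖ ≤ (∑' α, ‖c α‖ * hermiteBound α) * weight x := by
  rw [← tsum_mul_right]
  exact tsum_of_norm_bounded (hc.summable_mul_hermiteBound.mul_right _).hasSum
    fun α => norm_coeff_mul_hermiteFun_le c α x

theorem RapidDecay.contDiff_hermiteSeries (hc : RapidDecay c) : ContDiff ℝ ∞ (hermiteSeries c) := by
  choose C m hC h using exists_norm_iteratedFDeriv_hermiteFun_le ι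
  let L : ℂ → ℝ →L[ℝ] ℂ := fun z => ContinuousLinearMap.toSpanSingleton ℝ z
  have e : ∀ α, (fun x => c α * (hermiteFun α x : ℂ)) = L (c α) ∘ hermiteFun α := by
    intro α
    ext x
    simp [L, mul_comm]
  refine contDiff_tsum (v := fun k α => ‖c α‖ * (C k * (len α + 1) ^ m k)) (fun α => ?_)
    (fun k _ => ?_) (fun k α x _ => ?_)
  · rw [e]
    exact (L (c α)).contDiff.comp (contDiff_hermiteFun α)
  · refine ((hc (m k)).mul_left (C k)).congr fun α => ?_
    ring
  · rw [e]
    refine ((L (c α)).norm_iteratedFDeriv_comp_left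
      (contDiff_infty.1 (contDiff_hermiteFun α) k).contDiffAt le_rfl).trans ?_
    simp only [L]
    rw [ContinuousLinearMap.norm_toSpanSingleton]
    gcongr
    exact h k α x

theorem RapidDecay.continuous_hermiteSeries (hc : RapidDecay c) : Continuous (hermiteSeries c) :=
  hc.contDiff_hermiteSeries.continuous

/-- Functions of polynomial growth may be multiplied into rapidly decreasing coefficients. -/
theorem RapidDecay.mul_pow (hc : RapidDecay c) (N : ℕ) :
    RapidDecay fun α => ((2 * len α + Fintype.card ι) ^ N : ℝ) * c α := by
  intro m
  refine Summable.of_nonneg_of_le (fun α => by have := len_nonneg α; positivity) (fun α => ?_)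
    ((hc (N + m)).mul_left ((2 + Fintype.card ι : ℝ) ^ N))
  have hl := len_nonneg α
  rw [norm_mul, Complex.norm_real, Real.norm_eq_abs, abs_of_nonneg (by positivity)]
  calc (2 * len α + Fintype.card ι) ^ N * ‖c α‖ * (len α + 1) ^ m
      ≤ ((2 + Fintype.card ι) * (len α + 1)) ^ N * ‖c α‖ * (len α + 1) ^ m := by
        gcongr
        have : (0 : ℝ) ≤ Fintype.card ι := by positivity
        nlinarith
    _ = _ := by rw [_root_.mul_pow, pow_add]; ring

theorem RapidDecay.star (hc : RapidDecay c) : RapidDecay fun α => starRingEnd ℂ (c α) := by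
  intro m
  simpa using hc m

theorem star_hermiteSeries (c : (ι → ℕ) → ℂ) (x : EuclideanSpace ℝ ι) :
    starRingEnd ℂ (hermiteSeries c x) = hermiteSeries (fun α => starRingEnd ℂ (c α)) x := by
  rw [hermiteSeries, Complex.conj_tsum]
  simp [hermiteSeries]

/-! ### Integration against Hermite series -/

/-- Functions which are integrable against the weight. -/
def WeightIntegrable (g : EuclideanSpace ℝ ι → ℂ) : Prop :=
  AEStronglyMeasurable g ∧ Integrable fun x => ‖g x‖ * weight x

theorem WeightIntegrable.integrable_mul {g u : EuclideanSpace ℝ ι → ℂ} (hg : WeightIntegrable g)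
    (hu : AEStronglyMeasurable u) {C : ℝ} (hC : ∀ x, ‖u x‖ ≤ C * weight x) :
    Integrable fun x => g x * u x := by
  refine (hg.2.const_mul C).mono' (hg.1.mul hu) (.of_forall fun x => ?_)
  rw [norm_mul]
  calc ‖g x‖ * ‖u x‖ ≤ ‖g x‖ * (C * weight x) := by gcongr; exact hC x
    _ = _ := by ring

theorem aestronglyMeasurable_hermiteFun (α : ι → ℕ) :
    AEStronglyMeasurable (fun x => (hermiteFun α x : ℂ)) :=
  (Complex.continuous_ofReal.comp (continuous_hermiteFun α)).aestronglyMeasurable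

theorem norm_hermiteFun_le (α : ι → ℕ) (x : EuclideanSpace ℝ ι) :
    ‖(hermiteFun α x : ℂ)‖ ≤ hermiteBound α * weight x := by
  rw [Complex.norm_real]; exact abs_hermiteFun_le α x

theorem WeightIntegrable.integrable_mul_hermiteFun {g : EuclideanSpace ℝ ι → ℂ}
    (hg : WeightIntegrable g) (α : ι → ℕ) : Integrable fun x => g x * (hermiteFun α x : ℂ) :=
  hg.integrable_mul (aestronglyMeasurable_hermiteFun α) (norm_hermiteFun_le α)

theorem WeightIntegrable.norm_integral_mul_hermiteFun_le {g : EuclideanSpace ℝ ι → ℂ}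
    (hg : WeightIntegrable g) (α : ι → ℕ) :
    ‖∫ x, g x * (hermiteFun α x : ℂ)‖ ≤ hermiteBound α * ∫ x, ‖g x‖ * weight x := by
  rw [← integral_const_mul]
  refine norm_integral_le_of_norm_le (hg.2.const_mul _) (.of_forall fun x => ?_)
  rw [norm_mul]
  calc ‖g x‖ * ‖(hermiteFun α x : ℂ)‖ ≤ ‖g x‖ * (hermiteBound α * weight x) := by
        gcongr; exact norm_hermiteFun_le α x
    _ = _ := by ring

theorem WeightIntegrable.sub {f g : EuclideanSpace ℝ ι → ℂ} (hf : WeightIntegrable f)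
    (hg : WeightIntegrable g) : WeightIntegrable (f - g) := by
  refine ⟨hf.1.sub hg.1, (hf.2.add hg.2).mono' ?_ (.of_forall fun x => ?_)⟩
  · exact (hf.1.sub hg.1).norm.mul continuous_weight.aestronglyMeasurable
  · have := weight_pos x
    rw [Real.norm_eq_abs, abs_of_nonneg (by positivity), Pi.add_apply, ← add_mul]
    gcongr
    exact norm_sub_le _ _

theorem weightIntegrable_of_norm_le {g : EuclideanSpace ℝ ι → ℂ} (hg : AEStronglyMeasurable g)
    {C : ℝ} (hC : ∀ x, ‖g x‖ ≤ C) : WeightIntegrable g := by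
  refine ⟨hg, (integrable_weight.const_mul C).mono'
    (hg.norm.mul continuous_weight.aestronglyMeasurable) (.of_forall fun x => ?_)⟩
  have := weight_pos x
  rw [Real.norm_eq_abs, abs_of_nonneg (by positivity)]
  gcongr
  exact hC x

theorem RapidDecay.weightIntegrable (hc : RapidDecay c) : WeightIntegrable (hermiteSeries c) := by
  refine weightIntegrable_of_norm_le hc.continuous_hermiteSeries.aestronglyMeasurable
    (C := ∑' α, ‖c α‖ * hermiteBound α) fun x => ?_
  refine (hc.norm_hermiteSeries_le x).trans (mul_le_of_le_one_right ?_ (weight_le_one x))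
  exact tsum_nonneg fun α => mul_nonneg (norm_nonneg _) (hermiteBound_pos α).le

theorem RapidDecay.hasSum_integral_mul (hc : RapidDecay c) {g : EuclideanSpace ℝ ι → ℂ}
    (hg : WeightIntegrable g) :
    HasSum (fun α => c α * ∫ x, g x * (hermiteFun α x : ℂ)) (∫ x, g x * hermiteSeries c x) := by
  have hs := hc.summable_mul_hermiteBound
  have h := hasSum_integral_of_dominated_convergence
    (F := fun α x => g x * (c α * (hermiteFun α x : ℂ)))
    (f := fun x => g x * hermiteSeries c x) (μ := volume)
    (fun α x => ‖c α‖ * hermiteBound α * (‖g x‖ * weight x))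
    (fun α => hg.1.mul ((aestronglyMeasurable_hermiteFun α).const_mul _))
    (fun α => .of_forall fun x => ?_)
    (.of_forall fun x => hs.mul_right _)
    (by simp_rw [tsum_mul_right]; exact hg.2.const_mul _)
    (.of_forall fun x => (hc.isHermiteSeries x).mul_left _)
  · have e : (fun α => c α * ∫ x, g x * (hermiteFun α x : ℂ)) =
        fun α => ∫ x, g x * (c α * (hermiteFun α x : ℂ)) := by
      ext α
      rw [← integral_const_mul]
      congr 1
      ext x
      ring
    rw [e]
    exact h
  · rw [norm_mul]
    calc _ ≤ ‖g x‖ * (‖c α‖ * hermiteBound α * weight x) := by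
          gcongr; exact norm_coeff_mul_hermiteFun_le c α x
      _ = _ := by ring

theorem integral_hermiteFun_mul_complex [DecidableEq ι] (α β : ι → ℕ) :
    ∫ x : EuclideanSpace ℝ ι, (hermiteFun α x : ℂ) * (hermiteFun β x : ℂ) =
      if α = β then 1 else 0 := by
  have := integral_hermiteFun_mul α β
  simp only [← Complex.ofReal_mul]
  rw [integral_complex_ofReal, this]
  split_ifs <;> simp

theorem RapidDecay.integral_hermiteSeries_mul (hc : RapidDecay c) (β : ι → ℕ) :
    ∫ x, hermiteSeries c x * (hermiteFun β x : ℂ) = c β := by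
  classical
  have hg : WeightIntegrable fun x : EuclideanSpace ℝ ι => (hermiteFun β x : ℂ) :=
    weightIntegrable_of_norm_le (aestronglyMeasurable_hermiteFun β) (C := hermiteBound β)
      fun x => by rw [Complex.norm_real]; exact abs_hermiteFun_le_hermiteBound β x
  have h := hc.hasSum_integral_mul hg
  simp only [integral_hermiteFun_mul_complex] at h
  have h2 : HasSum (fun α => c α * if β = α then 1 else 0) (c β) := by
    convert hasSum_ite_eq β (c β) using 2 with α
    by_cases hα : α = β
    · subst hα; simp
    · simp [hα, Ne.symm hα]
  rw [← h.unique h2]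
  congr 1
  ext x
  ring

/-- Parseval's identity for rapidly decreasing coefficients. -/
theorem RapidDecay.hasSum_integral_mul_star {b : (ι → ℕ) → ℂ} (hc : RapidDecay c)
    (hb : RapidDecay b) :
    HasSum (fun α => c α * starRingEnd ℂ (b α))
      (∫ x, hermiteSeries c x * starRingEnd ℂ (hermiteSeries b x)) := by
  have h := hb.star.hasSum_integral_mul hc.weightIntegrable
  simp only [hc.integral_hermiteSeries_mul, ← star_hermiteSeries] at h
  simpa only [mul_comm] using h

theorem RapidDecay.memLp (hc : RapidDecay c) {p : ℝ≥0∞} (hp : 1 ≤ p) :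
    MemLp (hermiteSeries c) p :=
  (memLp_weight hp).of_le_mul hc.continuous_hermiteSeries.aestronglyMeasurable
    (c := ∑' α, ‖c α‖ * hermiteBound α) (.of_forall fun x => by
      rw [Real.norm_eq_abs, abs_of_pos (weight_pos x)]; exact hc.norm_hermiteSeries_le x)

theorem RapidDecay.eLpNorm_le (hc : RapidDecay c) {p : ℝ≥0∞} {B : ℝ}
    (hB : ∑' α, ‖c α‖ * hermiteBound α ≤ B) :
    eLpNorm (hermiteSeries c) p ≤
      ENNReal.ofReal B * eLpNorm (weight : EuclideanSpace ℝ ι → ℝ) p := by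
  refine eLpNorm_le_mul_eLpNorm_of_ae_le_mul (.of_forall fun x => ?_) p
  rw [Real.norm_eq_abs, abs_of_pos (weight_pos x)]
  exact (hc.norm_hermiteSeries_le x).trans (by have := weight_pos x; gcongr)

end Pilipovic
end

noncomputable section
namespace Pilipovic

variable {ι : Type*} [Fintype ι]

/-! ### The harmonic oscillator on test functions -/

theorem contDiff_fderiv_apply {φ : EuclideanSpace ℝ ι → ℂ} (hφ : ContDiff ℝ ∞ φ)
    (v : EuclideanSpace ℝ ι) : ContDiff ℝ ∞ fun x => fderiv ℝ φ x v :=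
  (hφ.fderiv_right (m := ∞) (by simp)).clm_apply contDiff_const

theorem contDiff_two_of_infty {F : Type*} [NormedAddCommGroup F] [NormedSpace ℝ F]
    {f : EuclideanSpace ℝ ι → F} (hf : ContDiff ℝ ∞ f) : ContDiff ℝ 2 f :=
  contDiff_infty.1 hf 2

theorem contDiff_laplacian {φ : EuclideanSpace ℝ ι → ℂ} (hφ : ContDiff ℝ ∞ φ) :
    ContDiff ℝ ∞ (Laplacian.laplacian φ) := by
  classical
  rw [funext fun x => laplacian_eq_sum_fderiv (contDiff_two_of_infty hφ) x]
  exact ContDiff.sum fun i _ => contDiff_fderiv_apply (contDiff_fderiv_apply hφ _) _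

theorem contDiff_harmOsc {φ : EuclideanSpace ℝ ι → ℂ} (hφ : ContDiff ℝ ∞ φ) :
    ContDiff ℝ ∞ (harmOsc φ) :=
  ((Complex.ofRealCLM.contDiff.comp (contDiff_norm_sq ℝ)).mul hφ).sub (contDiff_laplacian hφ)

theorem hasCompactSupport_laplacian {φ : EuclideanSpace ℝ ι → ℂ}
    (hc : HasCompactSupport φ) : HasCompactSupport (Laplacian.laplacian φ) := by
  classical
  refine hc.mono' fun x hx => ?_
  by_contra hxs
  refine hx ?_
  have h0 : φ =ᶠ[nhds x] fun _ => 0 := notMem_tsupport_iff_eventuallyEq.1 hxs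
  rw [(InnerProductSpace.laplacian_congr_nhds h0).eq_of_nhds]
  simp

theorem hasCompactSupport_harmOsc {φ : EuclideanSpace ℝ ι → ℂ}
    (hc : HasCompactSupport φ) : HasCompactSupport (harmOsc φ) :=
  HasCompactSupport.sub hc.mul_left (hasCompactSupport_laplacian hc)

theorem harmOsc_iterate {φ : EuclideanSpace ℝ ι → ℂ} (hφ : ContDiff ℝ ∞ φ)
    (hc : HasCompactSupport φ) (N : ℕ) :
    ContDiff ℝ ∞ (harmOsc^[N] φ) ∧ HasCompactSupport (harmOsc^[N] φ) := by
  induction N with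
  | zero => exact ⟨hφ, hc⟩
  | succ N ih =>
    rw [Function.iterate_succ_apply']
    exact ⟨contDiff_harmOsc ih.1, hasCompactSupport_harmOsc ih.2⟩

theorem integral_mul_fderiv_eq_neg {u φ : EuclideanSpace ℝ ι → ℂ} (hu : ContDiff ℝ ∞ u)
    (hφ : ContDiff ℝ ∞ φ) (hc : HasCompactSupport φ) (v : EuclideanSpace ℝ ι) :
    ∫ x, u x * fderiv ℝ φ x v = -∫ x, fderiv ℝ u x v * φ x := by
  refine integral_mul_fderiv_eq_neg_fderiv_mul_of_integrable ?_ ?_ ?_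
    (fun x _ => hu.differentiable (by norm_num) x) (fun x _ => hφ.differentiable (by norm_num) x)
  · exact ((contDiff_fderiv_apply hu v).continuous.mul
      hφ.continuous).integrable_of_hasCompactSupport hc.mul_left
  · exact (hu.continuous.mul
      (contDiff_fderiv_apply hφ v).continuous).integrable_of_hasCompactSupport
      (hc.fderiv_apply ℝ v).mul_left
  · exact (hu.continuous.mul hφ.continuous).integrable_of_hasCompactSupport hc.mul_left

theorem integral_mul_laplacian {u φ : EuclideanSpace ℝ ι → ℂ} (hu : ContDiff ℝ ∞ u)
    (hφ : ContDiff ℝ ∞ φ) (hc : HasCompactSupport φ) :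
    ∫ x, u x * Laplacian.laplacian φ x = ∫ x, Laplacian.laplacian u x * φ x := by
  classical
  simp only [laplacian_eq_sum_fderiv (contDiff_two_of_infty hu),
    laplacian_eq_sum_fderiv (contDiff_two_of_infty hφ), Finset.mul_sum, Finset.sum_mul]
  have d := fun (f : EuclideanSpace ℝ ι → ℂ) (hf : ContDiff ℝ ∞ f) (i : ι) =>
    contDiff_fderiv_apply hf (EuclideanSpace.single i 1)
  rw [integral_finsetSum, integral_finsetSum]
  · refine Finset.sum_congr rfl fun i _ => ?_
    rw [integral_mul_fderiv_eq_neg hu (d φ hφ i) (hc.fderiv_apply ℝ _),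
      integral_mul_fderiv_eq_neg (d u hu i) hφ hc, neg_neg]
  · intro i _
    exact ((d _ (d u hu i) i).continuous.mul hφ.continuous).integrable_of_hasCompactSupport
      hc.mul_left
  · intro i _
    exact (hu.continuous.mul (d _ (d φ hφ i) i).continuous).integrable_of_hasCompactSupport
      ((hc.fderiv_apply ℝ _).fderiv_apply ℝ _).mul_left

/-- Compact support of `φ` alone removes the boundary terms, so `u` may be a Hermite function. -/
theorem integral_mul_harmOsc {u φ : EuclideanSpace ℝ ι → ℂ} (hu : ContDiff ℝ ∞ u)
    (hφ : ContDiff ℝ ∞ φ) (hc : HasCompactSupport φ) :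
    ∫ x, u x * harmOsc φ x = ∫ x, harmOsc u x * φ x := by
  have hn : Continuous fun x : EuclideanSpace ℝ ι => ((‖x‖ ^ 2 : ℝ) : ℂ) := by fun_prop
  have e1 : ∀ x, u x * harmOsc φ x =
      u x * ((‖x‖ ^ 2 : ℝ) * φ x) - u x * Laplacian.laplacian φ x := fun x => by
    rw [harmOsc]; ring
  have e2 : ∀ x, harmOsc u x * φ x =
      u x * ((‖x‖ ^ 2 : ℝ) * φ x) - Laplacian.laplacian u x * φ x := fun x => by
    rw [harmOsc]; ring
  have i1 : Integrable fun x => u x * ((‖x‖ ^ 2 : ℝ) * φ x) :=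
    (hu.continuous.mul (hn.mul hφ.continuous)).integrable_of_hasCompactSupport
    (μ := volume) (hc.mul_left.mul_left)
  simp only [e1, e2]
  rw [integral_sub i1, integral_sub i1, integral_mul_laplacian hu hφ hc]
  · exact ((contDiff_laplacian hu).continuous.mul hφ.continuous).integrable_of_hasCompactSupport
      hc.mul_left
  · exact (hu.continuous.mul (contDiff_laplacian hφ).continuous).integrable_of_hasCompactSupport
      (hasCompactSupport_laplacian hc).mul_left

theorem harmOsc_ofReal {f : EuclideanSpace ℝ ι → ℝ} (hf : ContDiff ℝ ∞ f)
    (x : EuclideanSpace ℝ ι) :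
    harmOsc (fun y => (f y : ℂ)) x = ((‖x‖ ^ 2 * f x - Laplacian.laplacian f x : ℝ) : ℂ) := by
  have h := (contDiff_two_of_infty hf).contDiffAt.laplacian_CLM_comp_left
    (l := Complex.ofRealCLM) (x := x)
  have e : (Complex.ofRealCLM ∘ f) = fun y => (f y : ℂ) := rfl
  rw [e] at h
  rw [harmOsc, h]
  simp

theorem contDiff_hermiteFun_complex (α : ι → ℕ) :
    ContDiff ℝ ∞ fun x : EuclideanSpace ℝ ι => (hermiteFun α x : ℂ) :=
  Complex.ofRealCLM.contDiff.comp (contDiff_hermiteFun α)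

theorem harmOsc_hermiteFun (α : ι → ℕ) (x : EuclideanSpace ℝ ι) :
    harmOsc (fun y => (hermiteFun α y : ℂ)) x =
      ((2 * len α + Fintype.card ι : ℝ) : ℂ) * (hermiteFun α x : ℂ) := by
  classical
  rw [harmOsc_ofReal (contDiff_hermiteFun α), laplacian_hermiteFun, ← Complex.ofReal_mul]
  congr 1
  ring

theorem integral_hermiteFun_mul_harmOsc_iterate (α : ι → ℕ) {φ : EuclideanSpace ℝ ι → ℂ}
    (hφ : ContDiff ℝ ∞ φ) (hc : HasCompactSupport φ) (N : ℕ) :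
    ∫ x, (harmOsc^[N] φ) x * (hermiteFun α x : ℂ) =
      ((2 * len α + Fintype.card ι) ^ N : ℝ) * ∫ x, φ x * (hermiteFun α x : ℂ) := by
  induction N with
  | zero => simp
  | succ N ih =>
    obtain ⟨h1, h2⟩ := harmOsc_iterate hφ hc N
    have h := integral_mul_harmOsc (contDiff_hermiteFun_complex α) h1 h2
    simp only [harmOsc_hermiteFun] at h
    rw [Function.iterate_succ_apply']
    calc _ = ∫ x, (hermiteFun α x : ℂ) * harmOsc (harmOsc^[N] φ) x := by
          congr 1; ext x; ring
      _ = ((2 * len α + Fintype.card ι : ℝ) : ℂ) *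
            ∫ x, (harmOsc^[N] φ) x * (hermiteFun α x : ℂ) := by
          rw [h, ← integral_const_mul]
          congr 1; ext x; ring
      _ = _ := by rw [ih, pow_succ]; push_cast; ring

theorem weightIntegrable_of_hasCompactSupport {φ : EuclideanSpace ℝ ι → ℂ} (hφ : Continuous φ)
    (hc : HasCompactSupport φ) : WeightIntegrable φ := by
  obtain ⟨C, hC⟩ := hc.exists_bound_of_continuous hφ
  exact weightIntegrable_of_norm_le hφ.aestronglyMeasurable hC

/-- The powers of the harmonic oscillator act on Hermite series by multiplication of the
coefficients. -/
theorem RapidDecay.isHarmOscPow {c : (ι → ℕ) → ℂ} (hc : RapidDecay c) (N : ℕ) :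
    IsHarmOscPow N (hermiteSeries c)
      (hermiteSeries fun α => ((2 * len α + Fintype.card ι) ^ N : ℝ) * c α) := by
  intro φ hφ hs
  obtain ⟨h1, h2⟩ := harmOsc_iterate hφ hs N
  have a := hc.hasSum_integral_mul (weightIntegrable_of_hasCompactSupport h1.continuous h2)
  have b := (hc.mul_pow N).hasSum_integral_mul
    (weightIntegrable_of_hasCompactSupport hφ.continuous hs)
  simp only [fun α => integral_hermiteFun_mul_harmOsc_iterate α hφ hs N] at a
  simp only [mul_comm (hermiteSeries _ _)]
  refine b.unique (a.congr_fun fun α => ?_)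
  ring

/-! ### Weak eigenvalue equation for functions integrable against the weight -/

theorem abs_tensor_le {u : ι → ℝ → ℝ} {C : ℝ} (h : ∀ i t, |u i t| ≤ C * (1 + t ^ 2)⁻¹)
    (x : EuclideanSpace ℝ ι) : |tensor u x| ≤ C ^ Fintype.card ι * weight x := by
  rw [tensor, Finset.abs_prod, weight]
  refine (Finset.prod_le_prod (fun i _ => abs_nonneg _) fun i _ => h i (x i)).trans_eq ?_
  rw [Finset.prod_mul_distrib, Finset.prod_const, Finset.card_univ]

/-- A smooth cutoff function on the line. -/
def cutoff : ContDiffBump (0 : ℝ) := ⟨1, 2, by norm_num, by norm_num⟩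

/-- Hermite functions cut off at distance of order `R + 1`. -/
def cutHermite (n R : ℕ) (t : ℝ) : ℝ := cutoff (t * ((R : ℝ) + 1)⁻¹) * hermiteFun1 n t

theorem contDiff_cutHermite (n R : ℕ) : ContDiff ℝ ∞ (cutHermite n R) :=
  (cutoff.contDiff.comp (contDiff_id.mul contDiff_const)).mul (contDiff_hermiteFun1 n)

theorem cutHermite_eq_zero {n R : ℕ} {t : ℝ} (ht : 2 * ((R : ℝ) + 1) ≤ |t|) :
    cutHermite n R t = 0 := by
  have hR : (0 : ℝ) < R + 1 := by positivity
  rw [cutHermite, cutoff.zero_of_le_dist, zero_mul]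
  change (2 : ℝ) ≤ _
  rw [Real.dist_eq, sub_zero, abs_mul, abs_inv, abs_of_pos hR, ← div_eq_mul_inv, le_div_iff₀ hR]
  exact ht

theorem cutHermite_eventuallyEq (n : ℕ) {R : ℕ} {t : ℝ} (ht : |t| < (R : ℝ) + 1) :
    cutHermite n R =ᶠ[nhds t] hermiteFun1 n := by
  have hR : (0 : ℝ) < R + 1 := by positivity
  filter_upwards [(continuous_abs.tendsto t).eventually_lt_const ht] with y hy
  rw [cutHermite, cutoff.one_of_mem_closedBall, one_mul]
  rw [Metric.mem_closedBall, Real.dist_eq, sub_zero, abs_mul, abs_inv, abs_of_pos hR,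
    ← div_eq_mul_inv, div_le_iff₀ hR]
  change _ ≤ (1 : ℝ) * _
  linarith

/-- The constant is independent of `R`, as dominated convergence requires: derivatives of the
rescaled cut-off carry factors `(R + 1)⁻¹ ≤ 1`. -/
theorem exists_cutHermite_bounds (n : ℕ) : ∃ C : ℝ, ∀ R t,
    |cutHermite n R t| ≤ C * (1 + t ^ 2)⁻¹ ∧
    |t ^ 2 * cutHermite n R t - deriv (deriv (cutHermite n R)) t| ≤ C * (1 + t ^ 2)⁻¹ := by
  have hχ : ContDiff ℝ ∞ (cutoff : ℝ → ℝ) := cutoff.contDiff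
  have hχ1 : ContDiff ℝ ∞ (deriv (cutoff : ℝ → ℝ)) :=
    (contDiff_infty_iff_deriv.1 hχ).2
  have hχ2 : ContDiff ℝ ∞ (deriv (deriv (cutoff : ℝ → ℝ))) :=
    (contDiff_infty_iff_deriv.1 hχ1).2
  obtain ⟨D1, hD1⟩ := cutoff.hasCompactSupport.deriv.exists_bound_of_continuous hχ1.continuous
  obtain ⟨D2, hD2⟩ := cutoff.hasCompactSupport.deriv.deriv.exists_bound_of_continuous
    hχ2.continuous
  have hD1' : 0 ≤ D1 := (norm_nonneg _).trans (hD1 0)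
  have hD2' : 0 ≤ D2 := (norm_nonneg _).trans (hD2 0)
  obtain ⟨A, hA⟩ := exists_hermiteFun1_le_inv n
  obtain ⟨B, hB⟩ : ∃ B : ℝ, ∀ t, |deriv (hermiteFun1 n) t| ≤ B * (1 + t ^ 2)⁻¹ := by
    obtain ⟨B1, h1⟩ := exists_hermiteFun1_le_inv (n - 1)
    obtain ⟨B2, h2⟩ := exists_hermiteFun1_le_inv (n + 1)
    refine ⟨ladder n * B1 + ladder (n + 1) * B2, fun t => ?_⟩
    have l1 := ladder_nonneg n
    have l2 := ladder_nonneg (n + 1)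
    rw [deriv_hermiteFun1]
    refine (abs_sub _ _).trans ?_
    rw [abs_mul, abs_mul, abs_of_nonneg l1, abs_of_nonneg l2, add_mul, mul_assoc, mul_assoc]
    gcongr
    · exact h1 t
    · exact h2 t
  -- Leibniz rule: the eigenvalue term plus the commutator of the oscillator with the cut-off.
  have key : ∀ R t, t ^ 2 * cutHermite n R t - deriv (deriv (cutHermite n R)) t =
      cutoff (t * ((R : ℝ) + 1)⁻¹) * ((2 * n + 1) * hermiteFun1 n t) -
      2 * (deriv cutoff (t * ((R : ℝ) + 1)⁻¹) * ((R : ℝ) + 1)⁻¹) * deriv (hermiteFun1 n) t -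
      (deriv (deriv cutoff) (t * ((R : ℝ) + 1)⁻¹) * ((R : ℝ) + 1)⁻¹ * ((R : ℝ) + 1)⁻¹) *
        hermiteFun1 n t := by
    intro R t
    set ε := ((R : ℝ) + 1)⁻¹
    have s1 : ∀ (f : ℝ → ℝ), ContDiff ℝ ∞ f → ∀ t,
        HasDerivAt (fun t => f (t * ε)) (deriv f (t * ε) * ε) t := fun f hf t =>
      ((hf.differentiable (by norm_num) (t * ε)).hasDerivAt).comp t
        (by simpa using (hasDerivAt_id t).mul_const ε)
    have hd : ∀ t, HasDerivAt (hermiteFun1 n) (deriv (hermiteFun1 n) t) t := fun t =>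
      ((contDiff_hermiteFun1 n).differentiable (by norm_num) t).hasDerivAt
    have hd2 : ∀ t, HasDerivAt (deriv (hermiteFun1 n)) (deriv (deriv (hermiteFun1 n)) t) t :=
      fun t => (((contDiff_infty_iff_deriv.1 (contDiff_hermiteFun1 n)).2).differentiable
        (by norm_num) t).hasDerivAt
    have e1 : deriv (cutHermite n R) = fun t => deriv cutoff (t * ε) * ε * hermiteFun1 n t +
        cutoff (t * ε) * deriv (hermiteFun1 n) t :=
      funext fun t => ((s1 _ hχ t).fun_mul (hd t)).deriv
    rw [e1, ((((s1 _ hχ1 t).mul_const ε).fun_mul (hd t)).fun_add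
      ((s1 _ hχ t).fun_mul (hd2 t))).deriv, deriv_deriv_hermiteFun1]
    simp only [cutHermite]
    ring
  have hA0 : 0 ≤ A := by simpa using (abs_nonneg _).trans (hA 0)
  have hB0 : 0 ≤ B := by simpa using (abs_nonneg _).trans (hB 0)
  refine ⟨(2 * n + 1) * A + 2 * D1 * B + D2 * A, fun R t => ?_⟩
  have hw : 0 < (1 + t ^ 2)⁻¹ := by positivity
  set ε := ((R : ℝ) + 1)⁻¹ with hε
  have hε0 : 0 ≤ ε := by positivity
  have hε1 : ε ≤ 1 := inv_le_one_of_one_le₀ (by have : (0 : ℝ) ≤ R := by positivity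
                                                linarith)
  have hc : |cutoff (t * ε)| ≤ 1 := by
    rw [abs_of_nonneg cutoff.nonneg]; exact cutoff.le_one
  have hh := hA t
  have hh' := hB t
  have d1 := hD1 (t * ε)
  have d2 := hD2 (t * ε)
  rw [Real.norm_eq_abs] at d1 d2
  constructor
  · rw [cutHermite, abs_mul]
    calc _ ≤ 1 * (A * (1 + t ^ 2)⁻¹) := by gcongr
      _ ≤ _ := by
        rw [one_mul]
        gcongr
        have : 0 ≤ 2 * n * A + 2 * D1 * B + D2 * A := by positivity
        linarith
  · rw [key]
    have a1 : |cutoff (t * ε) * ((2 * n + 1) * hermiteFun1 n t)| ≤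
        1 * ((2 * n + 1) * (A * (1 + t ^ 2)⁻¹)) := by
      rw [abs_mul, abs_mul, abs_of_nonneg (by positivity : (0 : ℝ) ≤ 2 * n + 1)]
      gcongr
    have a2 : |2 * (deriv cutoff (t * ε) * ε) * deriv (hermiteFun1 n) t| ≤
        2 * (D1 * 1) * (B * (1 + t ^ 2)⁻¹) := by
      rw [abs_mul, abs_mul, abs_mul, abs_of_nonneg hε0, abs_of_pos (by norm_num : (0 : ℝ) < 2)]
      gcongr
    have a3 : |deriv (deriv cutoff) (t * ε) * ε * ε * hermiteFun1 n t| ≤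
        D2 * 1 * 1 * (A * (1 + t ^ 2)⁻¹) := by
      rw [abs_mul, abs_mul, abs_mul, abs_of_nonneg hε0]
      gcongr
    refine (abs_sub _ _).trans
      ((add_le_add ((abs_sub _ _).trans (add_le_add a1 a2)) a3).trans_eq ?_)
    ring

theorem hasCompactSupport_tensor_cutHermite (α : ι → ℕ) (R : ℕ) :
    HasCompactSupport (tensor fun i => cutHermite (α i) R) := by
  have hb : Bornology.IsBounded {x : EuclideanSpace ℝ ι | ∀ i, |x i| ≤ 2 * ((R : ℝ) + 1)} := by
    rw [isBounded_iff_forall_norm_le]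
    refine ⟨√(∑ _i : ι, (2 * ((R : ℝ) + 1)) ^ 2), fun x hx => ?_⟩
    rw [EuclideanSpace.norm_eq]
    refine Real.sqrt_le_sqrt (Finset.sum_le_sum fun i _ => ?_)
    gcongr
    exact hx i
  refine HasCompactSupport.of_support_subset_isCompact hb.isCompact_closure
    (fun x hx => subset_closure fun i => ?_)
  by_contra! h
  exact hx (Finset.prod_eq_zero (Finset.mem_univ i) (cutHermite_eq_zero h.le))

theorem harmOsc_tensor [DecidableEq ι] {u : ι → ℝ → ℝ} (hu : ∀ i, ContDiff ℝ ∞ (u i))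
    (x : EuclideanSpace ℝ ι) :
    harmOsc (fun y => (tensor u y : ℂ)) x = ((∑ i, tensor (Function.update u i
      fun t => t ^ 2 * u i t - deriv (deriv (u i)) t) x : ℝ) : ℂ) := by
  rw [harmOsc_ofReal (contDiff_tensor hu),
    laplacian_tensor fun i => contDiff_infty.1 (hu i) 2, EuclideanSpace.norm_sq_eq]
  congr 1
  rw [Finset.sum_mul, ← Finset.sum_sub_distrib]
  refine Finset.sum_congr rfl fun i _ => ?_
  rw [tensor_update_mul, tensor_update_mul, tensor_eq_mul u i, Real.norm_eq_abs, sq_abs]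
  ring

/-- If `g' = H g` in the sense of distributions, then the Hermite coefficients of `g'` are those of
`g` multiplied by the eigenvalues. -/
theorem integral_mul_hermiteFun_of_weak {g g' : EuclideanSpace ℝ ι → ℂ}
    (hg : WeightIntegrable g) (hg' : WeightIntegrable g')
    (h : ∀ φ : EuclideanSpace ℝ ι → ℂ, ContDiff ℝ ∞ φ → HasCompactSupport φ →
      ∫ x, g' x * φ x = ∫ x, g x * harmOsc φ x) (α : ι → ℕ) :
    ∫ x, g' x * (hermiteFun α x : ℂ) =
      ((2 * len α + Fintype.card ι : ℝ) : ℂ) * ∫ x, g x * (hermiteFun α x : ℂ) := by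
  classical
  choose C hC using exists_cutHermite_bounds
  have hC0 : ∀ n, 0 ≤ C n := fun n => by simpa using (abs_nonneg _).trans (hC n 0 0).1
  set D := ∑ i, C (α i)
  have hD : ∀ i, C (α i) ≤ D := fun i =>
    Finset.single_le_sum (fun j _ => hC0 (α j)) (Finset.mem_univ i)
  -- `h_α` is not an admissible test function; the products of cut-off factors are, and `R → ∞` is
  -- taken on both sides of the weak equation.
  let u : ℕ → ι → ℝ → ℝ := fun R i => cutHermite (α i) R
  let φ : ℕ → EuclideanSpace ℝ ι → ℂ := fun R x => (tensor (u R) x : ℂ)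
  have hu : ∀ R i, ContDiff ℝ ∞ (u R i) := fun R i => contDiff_cutHermite _ _
  have hφ : ∀ R, ContDiff ℝ ∞ (φ R) := fun R =>
    Complex.ofRealCLM.contDiff.comp (contDiff_tensor (hu R))
  have hφc : ∀ R, HasCompactSupport (φ R) := fun R =>
    (hasCompactSupport_tensor_cutHermite α R).comp_left (g := fun t : ℝ => (t : ℂ)) (by simp)
  have b1 : ∀ R i t, |u R i t| ≤ D * (1 + t ^ 2)⁻¹ := fun R i t =>
    (hC (α i) R t).1.trans (by gcongr; exact hD i)
  have b2 : ∀ R i t, |t ^ 2 * u R i t - deriv (deriv (u R i)) t| ≤ D * (1 + t ^ 2)⁻¹ :=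
    fun R i t => (hC (α i) R t).2.trans (by gcongr; exact hD i)
  have bφ : ∀ R x, ‖φ R x‖ ≤ D ^ Fintype.card ι * weight x := fun R x => by
    simp only [φ, Complex.norm_real]; exact abs_tensor_le (b1 R) x
  have bH : ∀ R x, ‖harmOsc (φ R) x‖ ≤ (Fintype.card ι * D ^ Fintype.card ι) * weight x := by
    intro R x
    rw [harmOsc_tensor (hu R), Complex.norm_real]
    refine (norm_sum_le _ _).trans ?_
    refine (Finset.sum_le_card_nsmul Finset.univ _ (D ^ Fintype.card ι * weight x)
      fun i _ => abs_tensor_le (fun j t => ?_) x).trans_eq ?_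
    · rcases eq_or_ne j i with rfl | hj
      · rw [Function.update_self]; exact b2 R j t
      · rw [Function.update_of_ne hj]; exact b1 R j t
    · rw [Finset.card_univ, nsmul_eq_mul, mul_assoc]
  -- Agreement on a whole neighbourhood, so that the Laplacians agree at `x` as well.
  have hev : ∀ x : EuclideanSpace ℝ ι, ∀ᶠ R : ℕ in Filter.atTop,
      φ R =ᶠ[nhds x] fun y => (hermiteFun α y : ℂ) := by
    intro x
    have hR : ∀ᶠ R : ℕ in Filter.atTop, ‖x‖ < (R : ℝ) :=
      tendsto_natCast_atTop_atTop.eventually_gt_atTop ‖x‖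
    filter_upwards [hR] with R hR
    have : ∀ i, ∀ᶠ y : EuclideanSpace ℝ ι in nhds x, u R i (y i) = hermiteFun1 (α i) (y i) := by
      intro i
      have hc : ContinuousAt (fun y : EuclideanSpace ℝ ι => y i) x := by fun_prop
      refine hc.eventually (cutHermite_eventuallyEq (α i) ?_)
      have := PiLp.norm_apply_le x i
      rw [Real.norm_eq_abs] at this
      linarith
    filter_upwards [Filter.eventually_all.2 this] with y hy
    simp only [φ, tensor, hermiteFun]
    congr 1
    exact Finset.prod_congr rfl fun i _ => hy i
  have l1 : Filter.Tendsto (fun R => ∫ x, g' x * φ R x) Filter.atTop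
      (nhds (∫ x, g' x * (hermiteFun α x : ℂ))) := by
    refine tendsto_integral_of_dominated_convergence
      (fun x => D ^ Fintype.card ι * (‖g' x‖ * weight x))
      (fun R => hg'.1.mul (hφ R).continuous.aestronglyMeasurable) (hg'.2.const_mul _)
      (fun R => .of_forall fun x => ?_) (.of_forall fun x => ?_)
    · rw [norm_mul]
      calc _ ≤ ‖g' x‖ * (D ^ Fintype.card ι * weight x) := by gcongr; exact bφ R x
        _ = _ := by ring
    · refine tendsto_const_nhds.congr' ?_
      filter_upwards [hev x] with R hR
      rw [hR.eq_of_nhds]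
  have l2 : Filter.Tendsto (fun R => ∫ x, g x * harmOsc (φ R) x) Filter.atTop
      (nhds (∫ x, g x * harmOsc (fun y => (hermiteFun α y : ℂ)) x)) := by
    refine tendsto_integral_of_dominated_convergence
      (fun x => (Fintype.card ι * D ^ Fintype.card ι) * (‖g x‖ * weight x))
      (fun R => hg.1.mul (contDiff_harmOsc (hφ R)).continuous.aestronglyMeasurable)
      (hg.2.const_mul _) (fun R => .of_forall fun x => ?_) (.of_forall fun x => ?_)
    · rw [norm_mul]
      calc _ ≤ ‖g x‖ * ((Fintype.card ι * D ^ Fintype.card ι) * weight x) := by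
            gcongr; exact bH R x
        _ = _ := by ring
    · refine tendsto_const_nhds.congr' ?_
      filter_upwards [hev x] with R hR
      rw [harmOsc, harmOsc, hR.eq_of_nhds,
        (InnerProductSpace.laplacian_congr_nhds hR).eq_of_nhds]
  have l3 : ∫ x, g' x * (hermiteFun α x : ℂ) =
      ∫ x, g x * harmOsc (fun y => (hermiteFun α y : ℂ)) x := by
    refine tendsto_nhds_unique l1 (l2.congr fun R => ?_)
    exact (h (φ R) (hφ R) (hφc R)).symm
  rw [l3, ← integral_const_mul]
  congr 1
  ext x
  rw [harmOsc_hermiteFun]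
  ring

end Pilipovic
end

noncomputable section
namespace Pilipovic

variable {ι : Type*} [Fintype ι]

/-! ### Completeness of the Hermite functions -/

open scoped FourierTransform in
-- Every test function is the Fourier transform of a Schwartz function `Φ`, and the transform can be
-- moved from `Φ` onto `G` under the integral.
theorem ae_eq_zero_of_fourier_eq_zero {V : Type*} [NormedAddCommGroup V] [InnerProductSpace ℝ V]
    [FiniteDimensional ℝ V] [MeasurableSpace V] [BorelSpace V] {G : V → ℂ} (hG : Integrable G)
    (h : ∀ ξ, 𝓕 G ξ = 0) : G =ᵐ[volume] 0 := by
  refine ae_eq_zero_of_integral_contDiff_smul_eq_zero hG.locallyIntegrable fun ψ hψ hc => ?_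
  have hc' : HasCompactSupport (Complex.ofRealCLM ∘ ψ) := hc.comp_left rfl
  have hψ' : ContDiff ℝ ∞ (Complex.ofRealCLM ∘ ψ) := by fun_prop
  set Ψ : SchwartzMap V ℂ := hc'.toSchwartzMap hψ'
  set Φ : SchwartzMap V ℂ := 𝓕⁻ Ψ with hΦ
  have hΨ : ∀ x, Ψ x = (ψ x : ℂ) := fun x => rfl
  have h1 : ∀ x, (ψ x : ℂ) = 𝓕 ⇑Φ x := by
    intro x
    rw [← SchwartzMap.fourier_coe, hΦ, FourierTransform.fourier_fourierInv_eq, hΨ]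
  have hflip : ∫ x, 𝓕 ⇑Φ x * G x = ∫ x, Φ x * 𝓕 G x := by
    simpa using! (VectorFourier.integral_fourierIntegral_smul_eq_flip (L := innerₗ V)
      (μ := volume) (ν := volume) (e := Real.fourierChar) (f := ⇑Φ) (g := G)
      Real.continuous_fourierChar continuous_inner Φ.integrable hG)
  calc ∫ x, ψ x • G x = ∫ x, 𝓕 ⇑Φ x * G x := by
        congr 1; ext x; rw [← h1, Complex.real_smul]
    _ = 0 := by rw [hflip]; simp [h]

/-- The span of the Hermite functions. -/
def hermiteSpan (ι : Type*) [Fintype ι] : Submodule ℂ (EuclideanSpace ℝ ι → ℂ) :=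
  Submodule.span ℂ (Set.range fun (α : ι → ℕ) x => (hermiteFun α x : ℂ))

theorem hermiteFun_mem_hermiteSpan (α : ι → ℕ) :
    (fun x => (hermiteFun α x : ℂ)) ∈ hermiteSpan ι :=
  Submodule.subset_span ⟨α, rfl⟩

theorem coord_mul_mem_hermiteSpan {u : EuclideanSpace ℝ ι → ℂ} (hu : u ∈ hermiteSpan ι) (i : ι) :
    (fun x => (x i : ℂ) * u x) ∈ hermiteSpan ι := by
  classical
  induction hu using Submodule.span_induction with
  | mem u hu =>
    obtain ⟨α, rfl⟩ := hu
    have e : (fun x : EuclideanSpace ℝ ι => (x i : ℂ) * (hermiteFun α x : ℂ)) =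
        (ladder (α i) : ℂ) • (fun x => (hermiteFun (Function.update α i (α i - 1)) x : ℂ)) +
        (ladder (α i + 1) : ℂ) • (fun x => (hermiteFun (Function.update α i (α i + 1)) x : ℂ)) := by
      ext x
      simp only [Pi.add_apply, Pi.smul_apply, smul_eq_mul]
      exact_mod_cast coord_mul_hermiteFun α i x
    rw [e]
    exact add_mem (Submodule.smul_mem _ _ (hermiteFun_mem_hermiteSpan _))
      (Submodule.smul_mem _ _ (hermiteFun_mem_hermiteSpan _))
  | zero =>
    convert (hermiteSpan ι).zero_mem using 1
    ext x
    simp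
  | add u v _ _ hu hv =>
    convert add_mem hu hv using 1
    ext x
    simp only [Pi.add_apply]
    ring
  | smul a u _ hu =>
    convert Submodule.smul_mem _ a hu using 1
    ext x
    simp only [Pi.smul_apply, smul_eq_mul]
    ring

/-- The recurrence makes the span stable under coordinate multiplication. These are, up to scalars,
the terms of the exponential series times the Gaussian. -/
theorem inner_pow_mul_mem_hermiteSpan (ξ : EuclideanSpace ℝ ι) (k : ℕ) :
    (fun x => ((inner ℝ x ξ : ℝ) : ℂ) ^ k * (hermiteFun (0 : ι → ℕ) x : ℂ)) ∈ hermiteSpan ι := by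
  induction k with
  | zero => simpa using hermiteFun_mem_hermiteSpan (0 : ι → ℕ)
  | succ k ih =>
    have e : (fun x => ((inner ℝ x ξ : ℝ) : ℂ) ^ (k + 1) * (hermiteFun (0 : ι → ℕ) x : ℂ)) =
        ∑ i, (ξ i : ℂ) • (fun x : EuclideanSpace ℝ ι => (x i : ℂ) *
          (((inner ℝ x ξ : ℝ) : ℂ) ^ k * (hermiteFun (0 : ι → ℕ) x : ℂ))) := by
      ext x
      have hin : ((inner ℝ x ξ : ℝ) : ℂ) = ∑ i, (ξ i : ℂ) * (x i : ℂ) := by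
        rw [PiLp.inner_apply]
        push_cast
        refine Finset.sum_congr rfl fun i _ => ?_
        simp
      rw [Finset.sum_apply]
      simp only [Pi.smul_apply, smul_eq_mul]
      rw [pow_succ', mul_assoc]
      nth_rewrite 1 [hin]
      rw [Finset.sum_mul]
      exact Finset.sum_congr rfl fun i _ => by ring
    rw [e]
    exact Submodule.sum_mem _ fun i _ => Submodule.smul_mem _ _ (coord_mul_mem_hermiteSpan ih i)

/-- By `|a t| ≤ a² + t²/4` half of the Gaussian exponent survives, and `exp(-t²/4)` is still below a
multiple of `(1 + t²)⁻¹`. -/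
theorem exp_abs_mul_gaussian_le (a t : ℝ) :
    Real.exp |a * t| * hermiteFun1 0 t ≤ 4 * Real.exp (a ^ 2) * (1 + t ^ 2)⁻¹ := by
  have hpi : (1 : ℝ) ≤ Real.pi ^ (1 / 4 : ℝ) :=
    Real.one_le_rpow (by linarith [Real.pi_gt_three]) (by norm_num)
  have h1 : hermiteFun1 0 t ≤ Real.exp (-t ^ 2 / 2) := by
    rw [hermiteFun1_zero]
    exact div_le_self (Real.exp_pos _).le hpi
  rw [← div_eq_mul_inv, le_div_iff₀ (by positivity)]
  have h2 : 1 + t ^ 2 ≤ 4 * Real.exp (t ^ 2 / 4) := by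
    have := Real.add_one_le_exp (t ^ 2 / 4)
    linarith
  have h3 : |a * t| ≤ a ^ 2 + t ^ 2 / 4 := by
    rw [abs_le]
    constructor <;> nlinarith [sq_nonneg (a - t / 2), sq_nonneg (a + t / 2)]
  have h0 : 0 ≤ hermiteFun1 0 t := by rw [hermiteFun1_zero]; positivity
  calc Real.exp |a * t| * hermiteFun1 0 t * (1 + t ^ 2)
      ≤ Real.exp (a ^ 2 + t ^ 2 / 4) * Real.exp (-t ^ 2 / 2) * (4 * Real.exp (t ^ 2 / 4)) := by
        gcongr
    _ = 4 * Real.exp (a ^ 2 + t ^ 2 / 4 + -t ^ 2 / 2 + t ^ 2 / 4) := by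
        simp only [Real.exp_add]; ring
    _ = _ := by congr 2; ring

theorem exists_exp_inner_mul_hermiteFun_zero_le (ξ : EuclideanSpace ℝ ι) :
    ∃ C : ℝ, ∀ x, Real.exp |inner ℝ x ξ| * |hermiteFun (0 : ι → ℕ) x| ≤ C * weight x := by
  refine ⟨∏ i, (4 * Real.exp (ξ i ^ 2)), fun x => ?_⟩
  have h0 : ∀ t, 0 ≤ hermiteFun1 0 t := fun t => by rw [hermiteFun1_zero]; positivity
  have h1 : |inner ℝ x ξ| ≤ ∑ i, |ξ i * x i| := by
    rw [PiLp.inner_apply]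
    refine (Finset.abs_sum_le_sum_abs _ _).trans (Finset.sum_le_sum fun i _ => ?_)
    simp
  rw [weight, ← Finset.prod_mul_distrib]
  calc _ ≤ Real.exp (∑ i, |ξ i * x i|) * |hermiteFun (0 : ι → ℕ) x| := by gcongr
    _ = ∏ i, (Real.exp |ξ i * x i| * hermiteFun1 0 (x i)) := by
        rw [Real.exp_sum, Finset.prod_mul_distrib, hermiteFun, Finset.abs_prod]
        congr 1
        exact Finset.prod_congr rfl fun i _ => abs_of_nonneg (h0 _)
    _ ≤ _ := Finset.prod_le_prod (fun i _ => mul_nonneg (Real.exp_pos _).le (h0 _))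
        fun i _ => exp_abs_mul_gaussian_le _ _

theorem integral_mul_eq_zero_of_mem_hermiteSpan {g : EuclideanSpace ℝ ι → ℂ}
    (hg : WeightIntegrable g) (h : ∀ α : ι → ℕ, ∫ x, g x * (hermiteFun α x : ℂ) = 0)
    {u : EuclideanSpace ℝ ι → ℂ} (hu : u ∈ hermiteSpan ι) :
    Integrable (fun x => g x * u x) ∧ ∫ x, g x * u x = 0 := by
  induction hu using Submodule.span_induction with
  | mem u hu =>
    obtain ⟨α, rfl⟩ := hu
    exact ⟨hg.integrable_mul_hermiteFun α, h α⟩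
  | zero => simp
  | add u v _ _ hu hv =>
    simp only [Pi.add_apply, mul_add]
    exact ⟨hu.1.add hv.1, by rw [integral_add hu.1 hv.1, hu.2, hv.2, add_zero]⟩
  | smul a u _ hu =>
    simp only [Pi.smul_apply, smul_eq_mul, mul_left_comm _ a]
    exact ⟨hu.1.const_mul a, by rw [integral_const_mul, hu.2, mul_zero]⟩

/-- The exponential series is integrated term by term, each term vanishing by membership in the
span; the majorant is `exp |⟨x, ξ⟩| h_0`, controlled by `weight`. -/
theorem integral_mul_exp_eq_zero {g : EuclideanSpace ℝ ι → ℂ}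
    (hg : WeightIntegrable g) (h : ∀ α : ι → ℕ, ∫ x, g x * (hermiteFun α x : ℂ) = 0)
    (ξ : EuclideanSpace ℝ ι) :
    ∫ x, Complex.exp (((inner ℝ x ξ : ℝ) : ℂ) * Complex.I) *
      (g x * (hermiteFun (0 : ι → ℕ) x : ℂ)) = 0 := by
  obtain ⟨C, hC⟩ := exists_exp_inner_mul_hermiteFun_zero_le ξ
  have hexp : ∀ r : ℝ, HasSum (fun k : ℕ => r ^ k / k.factorial) (Real.exp r) := fun r => by
    rw [Real.exp_eq_exp_ℝ]; exact NormedSpace.expSeries_div_hasSum_exp r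
  have hcexp : ∀ z : ℂ, HasSum (fun k : ℕ => z ^ k / k.factorial) (Complex.exp z) := fun z => by
    rw [Complex.exp_eq_exp_ℂ]; exact NormedSpace.expSeries_div_hasSum_exp z
  have hin : Continuous fun x : EuclideanSpace ℝ ι => (inner ℝ x ξ : ℝ) := by fun_prop
  have hs := hasSum_integral_of_dominated_convergence (μ := volume)
    (F := fun (k : ℕ) x => (((inner ℝ x ξ : ℝ) : ℂ) * Complex.I) ^ k / k.factorial *
      (g x * (hermiteFun (0 : ι → ℕ) x : ℂ)))
    (f := fun x => Complex.exp (((inner ℝ x ξ : ℝ) : ℂ) * Complex.I) *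
      (g x * (hermiteFun (0 : ι → ℕ) x : ℂ)))
    (fun k x => |inner ℝ x ξ| ^ k / k.factorial * (‖g x‖ * |hermiteFun (0 : ι → ℕ) x|))
    (fun k => ?_) (fun k => .of_forall fun x => ?_)
    (.of_forall fun x => (hexp _).summable.mul_right _) ?_
    (.of_forall fun x => (hcexp _).mul_right _)
  · refine hs.unique ?_
    convert hasSum_zero with k
    have h2 := (integral_mul_eq_zero_of_mem_hermiteSpan hg h
      (inner_pow_mul_mem_hermiteSpan ξ k)).2
    calc _ = ∫ x, (Complex.I ^ k / k.factorial) * (g x * (((inner ℝ x ξ : ℝ) : ℂ) ^ k *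
          (hermiteFun (0 : ι → ℕ) x : ℂ))) := by
          congr 1; ext x; rw [mul_pow]; ring
      _ = 0 := by rw [integral_const_mul, h2, mul_zero]
  · refine AEStronglyMeasurable.mul ?_ (hg.1.mul (aestronglyMeasurable_hermiteFun _))
    exact Continuous.aestronglyMeasurable (by fun_prop)
  · simp
  · simp_rw [tsum_mul_right, (hexp _).tsum_eq]
    refine (hg.2.const_mul C).mono' ?_ (.of_forall fun x => ?_)
    · refine AEStronglyMeasurable.mul ?_ (hg.1.norm.mul
        (continuous_hermiteFun _).abs.aestronglyMeasurable)
      exact Continuous.aestronglyMeasurable (by fun_prop)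
    · rw [Real.norm_eq_abs, abs_of_nonneg (by positivity)]
      calc _ = ‖g x‖ * (Real.exp |inner ℝ x ξ| * |hermiteFun (0 : ι → ℕ) x|) := by ring
        _ ≤ ‖g x‖ * (C * weight x) :=
            mul_le_mul_of_nonneg_left (hC x) (norm_nonneg _)
        _ = _ := by ring

/-- A function integrable against the weight vanishes if its Hermite coefficients do. -/
theorem ae_eq_zero_of_integral_mul_hermiteFun_eq_zero {g : EuclideanSpace ℝ ι → ℂ}
    (hg : WeightIntegrable g) (h : ∀ α : ι → ℕ, ∫ x, g x * (hermiteFun α x : ℂ) = 0) :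
    g =ᵐ[volume] 0 := by
  -- The Fourier transform of `g h_0` vanishes, the factor `-2π` matching the normalization of the
  -- transform; afterwards the positive Gaussian `h_0` is divided out.
  have hz := ae_eq_zero_of_fourier_eq_zero (hg.integrable_mul_hermiteFun 0) fun ξ => by
    rw [Real.fourier_eq', ← integral_mul_exp_eq_zero hg h ((-2 * Real.pi) • ξ)]
    congr 1
    ext x
    rw [inner_smul_right]
    rfl
  filter_upwards [hz] with x hx
  have hpos : hermiteFun (0 : ι → ℕ) x ≠ 0 :=
    (Finset.prod_pos fun i _ => by
      simp only [Pi.zero_apply]; rw [hermiteFun1_zero]; positivity).ne'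
  simpa [hpos] using hx

/-- A function integrable against the weight with rapidly decreasing Hermite coefficients is the
sum of its Hermite series. -/
theorem ae_eq_hermiteSeries {g : EuclideanSpace ℝ ι → ℂ} (hg : WeightIntegrable g)
    (hc : RapidDecay fun α : ι → ℕ => ∫ x, g x * (hermiteFun α x : ℂ)) :
    g =ᵐ[volume] hermiteSeries fun α : ι → ℕ => ∫ x, g x * (hermiteFun α x : ℂ) := by
  have h := ae_eq_zero_of_integral_mul_hermiteFun_eq_zero (hg.sub hc.weightIntegrable) fun α => by
    simp only [Pi.sub_apply, sub_mul]
    rw [integral_sub (hg.integrable_mul_hermiteFun α)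
      (hc.weightIntegrable.integrable_mul_hermiteFun α), hc.integral_hermiteSeries_mul, sub_self]
  filter_upwards [h] with x hx
  exact sub_eq_zero.1 hx

end Pilipovic
end

noncomputable section
namespace Pilipovic

variable {ι : Type*} [Fintype ι]

/-! ### Elementary estimates for stretched exponentials -/

theorem exists_pow_mul_exp_neg_rpow_le {r a : ℝ} (hr : 0 < r) (ha : 0 < a) (k : ℕ) :
    ∃ C : ℝ, ∀ x : ℝ, 0 ≤ x → (x + 1) ^ k * Real.exp (-r * x ^ a) ≤ C := by
  -- With `n a ≥ k`, `x^k ≤ (x^a)^n` for `x ≥ 1`, and one term of the exponential series suffices.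
  obtain ⟨n, hn⟩ := exists_nat_ge ((k : ℝ) / a)
  refine ⟨2 ^ k * (1 + n.factorial / r ^ n), fun x hx => ?_⟩
  have he : Real.exp (-r * x ^ a) ≤ 1 := by
    rw [Real.exp_le_one_iff]
    have := Real.rpow_nonneg hx a
    nlinarith
  rcases le_total x 1 with h1 | h1
  · calc (x + 1) ^ k * Real.exp (-r * x ^ a) ≤ (1 + 1) ^ k * 1 := by gcongr
      _ ≤ _ := by
        norm_num
        positivity
  · set y := x ^ a with hy
    have hy0 : 0 ≤ y := Real.rpow_nonneg hx a
    have hxk : x ^ k ≤ y ^ n := by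
      rw [hy, ← Real.rpow_natCast, ← Real.rpow_natCast, ← Real.rpow_mul hx]
      refine Real.rpow_le_rpow_of_exponent_le h1 ?_
      rw [div_le_iff₀ ha] at hn
      linarith
    have h2 := Real.pow_div_factorial_le_exp (r * y) (by positivity) n
    rw [div_le_iff₀ (by positivity), mul_pow] at h2
    have h3 : y ^ n * Real.exp (-r * y) ≤ n.factorial / r ^ n := by
      rw [le_div_iff₀ (by positivity), neg_mul, Real.exp_neg, ← div_eq_mul_inv,
        div_mul_eq_mul_div, div_le_iff₀ (Real.exp_pos _)]
      linarith
    calc (x + 1) ^ k * Real.exp (-r * y) ≤ (2 * x) ^ k * Real.exp (-r * y) := by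
          gcongr; linarith
      _ = 2 ^ k * (x ^ k * Real.exp (-r * y)) := by rw [mul_pow]; ring
      _ ≤ 2 ^ k * (y ^ n * Real.exp (-r * y)) := by gcongr
      _ ≤ 2 ^ k * (1 + n.factorial / r ^ n) := by gcongr; linarith

theorem summable_inv_succ_sq : Summable fun n : ℕ => (((n : ℝ) + 1) ^ 2)⁻¹ := by
  have := (summable_nat_add_iff 1).2 (Real.summable_nat_pow_inv (p := 2)|>.2 (by norm_num))
  simpa using this

/-- Any finite set of multi-indices lies in a box, over which the sum factors into one-dimensional
sums. -/
theorem summable_prod_inv_succ_sq (ι : Type*) [Fintype ι] :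
    Summable fun α : ι → ℕ => ∏ i, (((α i : ℝ) + 1) ^ 2)⁻¹ := by
  classical
  refine summable_of_sum_le (c := (∑' n : ℕ, (((n : ℝ) + 1) ^ 2)⁻¹) ^ Fintype.card ι)
    (fun α => Finset.prod_nonneg fun i _ => by positivity) fun S => ?_
  set N := S.sup fun α => ∑ i, α i
  have hS : S ⊆ Fintype.piFinset fun _ : ι => Finset.range (N + 1) := by
    intro α hα
    rw [Fintype.mem_piFinset]
    intro i
    have h1 : ∑ i, α i ≤ N := Finset.le_sup (f := fun α : ι → ℕ => ∑ i, α i) hα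
    have h2 := Finset.single_le_sum (fun j _ => Nat.zero_le (α j)) (Finset.mem_univ i)
    rw [Finset.mem_range]
    omega
  refine (Finset.sum_le_sum_of_subset_of_nonneg hS fun α _ _ =>
    Finset.prod_nonneg fun i _ => by positivity).trans ?_
  rw [← Finset.prod_univ_sum (fun _ : ι => Finset.range (N + 1))
    (fun _ n => (((n : ℝ) + 1) ^ 2)⁻¹), Finset.prod_const, Finset.card_univ]
  gcongr
  exact summable_inv_succ_sq.sum_le_tsum _ fun n _ => by positivity

theorem summable_pow_mul_exp_neg_len {r a : ℝ} (hr : 0 < r) (ha : 0 < a) (m : ℕ) :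
    Summable fun α : ι → ℕ => (len α + 1) ^ m * Real.exp (-r * len α ^ a) := by
  obtain ⟨C, hC⟩ := exists_pow_mul_exp_neg_rpow_le hr ha (m + 2 * Fintype.card ι)
  refine Summable.of_nonneg_of_le (fun α => by have := len_nonneg α; positivity) (fun α => ?_)
    ((summable_prod_inv_succ_sq ι).mul_left C)
  have h0 := len_nonneg α
  have h := hC (len α) h0
  have hp : ∏ i, ((α i : ℝ) + 1) ^ 2 ≤ (len α + 1) ^ (2 * Fintype.card ι) := by
    calc _ ≤ ∏ _i : ι, (len α + 1) ^ 2 :=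
          Finset.prod_le_prod (fun i _ => by positivity) fun i _ => by
            have := coord_le_len α i
            gcongr
      _ = _ := by rw [Finset.prod_const, Finset.card_univ, ← pow_mul]
  have hpos : 0 < ∏ i, ((α i : ℝ) + 1) ^ 2 := Finset.prod_pos fun i _ => by positivity
  rw [Finset.prod_inv_distrib, ← div_eq_mul_inv, le_div_iff₀ hpos]
  calc _ ≤ (len α + 1) ^ m * Real.exp (-r * len α ^ a) *
        (len α + 1) ^ (2 * Fintype.card ι) := by gcongr
    _ = (len α + 1) ^ (m + 2 * Fintype.card ι) * Real.exp (-r * len α ^ a) := by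
        rw [pow_add]; ring
    _ ≤ C := h

theorem summable_exp_neg_succ_rpow {r a : ℝ} (hr : 0 < r) (ha : 0 < a) :
    Summable fun j : ℕ => Real.exp (-r * ((j : ℝ) + 1) ^ a) := by
  obtain ⟨C, hC⟩ := exists_pow_mul_exp_neg_rpow_le hr ha 2
  refine Summable.of_nonneg_of_le (fun j => (Real.exp_pos _).le) (fun j => ?_)
    (summable_inv_succ_sq.mul_left C)
  rw [← div_eq_mul_inv, le_div_iff₀ (by positivity)]
  refine le_trans ?_ (hC ((j : ℝ) + 1) (by positivity))
  rw [mul_comm]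
  gcongr
  linarith

theorem rpow_add_le_mul {x y a : ℝ} (hx : 0 ≤ x) (hy : 0 ≤ y) (ha : 0 < a) :
    (x + y) ^ a ≤ 2 ^ a * (x ^ a + y ^ a) := by
  have hxa := Real.rpow_nonneg hx a
  have hya := Real.rpow_nonneg hy a
  have h2 : (0 : ℝ) < 2 ^ a := by positivity
  rcases le_total x y with h | h
  · calc (x + y) ^ a ≤ (2 * y) ^ a := Real.rpow_le_rpow (by positivity) (by linarith) ha.le
      _ = 2 ^ a * y ^ a := Real.mul_rpow (by norm_num) hy
      _ ≤ _ := by gcongr; linarith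
  · calc (x + y) ^ a ≤ (2 * x) ^ a := Real.rpow_le_rpow (by positivity) (by linarith) ha.le
      _ = 2 ^ a * x ^ a := Real.mul_rpow (by norm_num) hx
      _ ≤ _ := by gcongr; linarith

theorem rpow_add_rpow_le {x y a : ℝ} (hx : 0 ≤ x) (hy : 0 ≤ y) (ha : 0 < a) :
    x ^ a + y ^ a ≤ 2 * (x + y) ^ a := by
  have h1 : x ^ a ≤ (x + y) ^ a := Real.rpow_le_rpow hx (by linarith) ha.le
  have h2 : y ^ a ≤ (x + y) ^ a := Real.rpow_le_rpow hy (by linarith) ha.le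
  linarith

/-- Powers against stretched exponentials are of factorial growth. -/
theorem pow_mul_exp_neg_le_factorial {s r b h x : ℝ} (hs : 0 < s) (hr : 0 < r) (hb : 0 ≤ b)
    (hh : 2 * b * (2 * s / r) ^ (2 * s) ≤ h) (hx : 0 ≤ x) (N : ℕ) :
    (b * (x + 1)) ^ N * Real.exp (-r * x ^ (1 / (2 * s))) ≤
      (1 + Real.exp r) * (h ^ N * (N.factorial : ℝ) ^ (2 * s)) := by
  set q := (2 * s / r) ^ (2 * s) with hq
  have hq0 : 0 < q := by positivity
  have hs2 : 0 < 2 * s := by positivity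
  have hqN : q ^ N = ((2 * s / r) ^ N) ^ (2 * s) := by
    rw [hq, ← Real.rpow_natCast, ← Real.rpow_natCast, ← Real.rpow_mul (by positivity),
      ← Real.rpow_mul (by positivity), mul_comm (N : ℝ)]
  set y := x ^ (1 / (2 * s)) with hy
  have hy0 : 0 ≤ y := Real.rpow_nonneg hx _
  have hxy : x = y ^ (2 * s) := by
    rw [hy, ← Real.rpow_mul hx, one_div, inv_mul_cancel₀ hs2.ne', Real.rpow_one]
  have hxN : x ^ N = (y ^ N) ^ (2 * s) := by
    rw [hxy, ← Real.rpow_natCast, ← Real.rpow_natCast, ← Real.rpow_mul hy0,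
      ← Real.rpow_mul hy0, mul_comm]
  -- The `N`-th term of the exponential series at `r y / (2s)`, raised to the power `2s`.
  have key : ∀ y : ℝ, 0 ≤ y → (y ^ N) ^ (2 * s) ≤
      q ^ N * (N.factorial : ℝ) ^ (2 * s) * Real.exp (r * y) := by
    intro y hy0
    have h1 := Real.pow_div_factorial_le_exp (r * y / (2 * s)) (by positivity) N
    rw [div_le_iff₀ (by positivity)] at h1
    have h2 : y ^ N ≤ (2 * s / r) ^ N * N.factorial * Real.exp (r * y / (2 * s)) := by
      have e : y ^ N = (2 * s / r) ^ N * (r * y / (2 * s)) ^ N := by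
        rw [← mul_pow]; congr 1; field_simp
      rw [e, mul_assoc]
      gcongr
      linarith
    refine (Real.rpow_le_rpow (by positivity) h2 hs2.le).trans_eq ?_
    rw [Real.mul_rpow (by positivity) (by positivity), Real.mul_rpow (by positivity) (by positivity),
      hqN, ← Real.exp_mul]
    congr 2
    field_simp
  have k1 := key y hy0
  -- The case `y = 1` gives `1 ≤ q^N (N!)^(2s) e^r`, which absorbs the constant term in the bound
  -- `hx1` for `(x + 1)^N`.
  have k2 := key 1 zero_le_one
  rw [one_pow, Real.one_rpow, mul_one] at k2
  rw [← hxN] at k1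
  have hx1 : (x + 1) ^ N ≤ 2 ^ N * (x ^ N + 1) := by
    rcases le_total x 1 with h1 | h1
    · calc (x + 1) ^ N ≤ 2 ^ N := by gcongr; linarith
        _ ≤ _ := by
          have : 0 ≤ x ^ N := by positivity
          have : (0 : ℝ) < 2 ^ N := by positivity
          nlinarith
    · calc (x + 1) ^ N ≤ (2 * x) ^ N := by gcongr; linarith
        _ = 2 ^ N * x ^ N := mul_pow _ _ _
        _ ≤ _ := by gcongr; linarith
  have he : Real.exp (-r * y) ≤ 1 := by
    rw [Real.exp_le_one_iff]; nlinarith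
  have hee : Real.exp (r * y) * Real.exp (-r * y) = 1 := by
    rw [← Real.exp_add]; simp
  set F := (N.factorial : ℝ) ^ (2 * s)
  have hF : 0 < F := by positivity
  calc (b * (x + 1)) ^ N * Real.exp (-r * y)
      ≤ b ^ N * (2 ^ N * (x ^ N + 1)) * Real.exp (-r * y) := by rw [mul_pow]; gcongr
    _ = b ^ N * 2 ^ N * (x ^ N * Real.exp (-r * y) + 1 * Real.exp (-r * y)) := by ring
    _ ≤ b ^ N * 2 ^ N * (q ^ N * F * Real.exp (r * y) * Real.exp (-r * y) +
          (q ^ N * F * Real.exp r) * 1) := by gcongr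
    _ = (1 + Real.exp r) * ((2 * b * q) ^ N * F) := by
        rw [mul_assoc (q ^ N * F), hee, mul_pow, mul_pow]; ring
    _ ≤ _ := by gcongr

/-- A quantity with factorial bounds on all its moments is exponentially small. -/
theorem le_exp_neg_of_forall_mul_pow_le {s h X A q : ℝ} (hs : 0 < s) (hh : 0 < h) (hX : 0 ≤ X)
    (hA : 0 ≤ A) (hq : 0 ≤ q)
    (H : ∀ N : ℕ, q * X ^ N ≤ A * (h ^ N * (N.factorial : ℝ) ^ (2 * s))) :
    q ≤ A * 2 ^ (2 * s) * Real.exp (-(s * (X / h) ^ (1 / (2 * s)))) := by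
  have hs2 : 0 < 2 * s := by positivity
  rcases hA.eq_or_lt with rfl | hA
  · have := H 0
    simp at this
    simpa using this
  set y := (X / h) ^ (1 / (2 * s)) with hy
  have hXh : 0 ≤ X / h := by positivity
  have hy0 : 0 ≤ y := Real.rpow_nonneg hXh _
  have hyX : X / h = y ^ (2 * s) := by
    rw [hy, ← Real.rpow_mul hXh, one_div, inv_mul_cancel₀ hs2.ne', Real.rpow_one]
  set p := (q / A) ^ (1 / (2 * s)) with hp
  have hqA : 0 ≤ q / A := by positivity
  have hp0 : 0 ≤ p := Real.rpow_nonneg hqA _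
  have hpq : q / A = p ^ (2 * s) := by
    rw [hp, ← Real.rpow_mul hqA, one_div, inv_mul_cancel₀ hs2.ne', Real.rpow_one]
  -- The `2s`-th root of the hypothesis is `p y^N ≤ N!`. Halving `y` makes the right side geometric,
  -- and summation over `N` gives `p exp(y/2) ≤ 2`.
  have h1 : ∀ N : ℕ, p * (y / 2) ^ N / N.factorial ≤ (1 / 2) ^ N := by
    intro N
    have h2 : p * y ^ N ≤ N.factorial := by
      rw [← Real.rpow_le_rpow_iff (by positivity) (by positivity) hs2,
        Real.mul_rpow hp0 (by positivity), ← hpq]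
      have e : (y ^ N) ^ (2 * s) = (X / h) ^ N := by
        rw [hyX, ← Real.rpow_natCast, ← Real.rpow_natCast, ← Real.rpow_mul hy0,
          ← Real.rpow_mul hy0, mul_comm]
      rw [e, div_pow, div_mul_div_comm, div_le_iff₀ (by positivity)]
      linarith [H N]
    rw [div_le_iff₀ (by positivity), div_pow, div_pow, one_pow]
    have h2N : (0 : ℝ) < 2 ^ N := by positivity
    rw [mul_div_assoc', div_mul_eq_mul_div, div_le_div_iff_of_pos_right h2N, one_mul]
    exact h2
  have hexp : HasSum (fun k : ℕ => (y / 2) ^ k / k.factorial) (Real.exp (y / 2)) := by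
    rw [Real.exp_eq_exp_ℝ]; exact NormedSpace.expSeries_div_hasSum_exp _
  have h3 : p * Real.exp (y / 2) ≤ 2 := by
    refine hasSum_le (fun N => ?_) (hexp.mul_left p) hasSum_geometric_two
    rw [← mul_div_assoc]; exact h1 N
  have h4 : p ≤ 2 * Real.exp (-(y / 2)) := by
    rw [Real.exp_neg, ← div_eq_mul_inv, le_div_iff₀ (Real.exp_pos _)]; exact h3
  have h5 : q / A ≤ 2 ^ (2 * s) * Real.exp (-(s * y)) := by
    rw [hpq]
    refine (Real.rpow_le_rpow hp0 h4 hs2.le).trans_eq ?_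
    rw [Real.mul_rpow (by norm_num) (Real.exp_pos _).le, ← Real.exp_mul]
    congr 2
    ring
  rw [div_le_iff₀ hA] at h5
  linarith

theorem hermiteBound_mul_exp_le (ι : Type*) [Fintype ι] {r a : ℝ} (hr : 0 < r) (ha : 0 < a) :
    ∃ C : ℝ, 0 ≤ C ∧ ∀ α : ι → ℕ, hermiteBound α * Real.exp (-r * len α ^ a) ≤ C := by
  obtain ⟨C, hC⟩ := exists_pow_mul_exp_neg_rpow_le hr ha (3 * Fintype.card ι)
  have h : ∀ α : ι → ℕ, hermiteBound α * Real.exp (-r * len α ^ a) ≤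
      100 ^ Fintype.card ι * C := by
    intro α
    calc _ ≤ (100 ^ Fintype.card ι * (len α + 1) ^ (3 * Fintype.card ι)) *
          Real.exp (-r * len α ^ a) := by gcongr; exact hermiteBound_le α
      _ = 100 ^ Fintype.card ι * ((len α + 1) ^ (3 * Fintype.card ι) *
          Real.exp (-r * len α ^ a)) := by ring
      _ ≤ _ := by gcongr; exact hC _ (len_nonneg α)
  refine ⟨_, ?_, h⟩
  exact (mul_nonneg (hermiteBound_pos _).le (Real.exp_pos _).le).trans (h 0)

theorem rapidDecay_of_coeffBound {s r : ℝ} (hs : 0 < s) (hr : 0 < r) {c : (ι → ℕ) → ℂ}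
    (hc : CoeffBound s r c) : RapidDecay c := by
  obtain ⟨C, hC⟩ := hc
  intro m
  refine Summable.of_nonneg_of_le (fun α => by have := len_nonneg α; positivity) (fun α => ?_)
    ((summable_pow_mul_exp_neg_len (ι := ι) hr (a := 1 / (2 * s)) (by positivity) m).mul_left C)
  have := len_nonneg α
  calc ‖c α‖ * (len α + 1) ^ m ≤
      (C * Real.exp (-r * len α ^ (1 / (2 * s)))) * (len α + 1) ^ m := by gcongr; exact hC α
    _ = _ := by ring

end Pilipovic
end

noncomputable section
namespace Pilipovic

variable {ι : Type*} [Fintype ι]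

/-! ### Estimates of functions and of their Hermite coefficients -/

/-- A bound for the Hermite coefficients of a sequence of functions. -/
def SeqCoeffBound (d : ℕ) (s r ρ : ℝ) (a : ℕ → (ι → ℕ) → ℂ) : Prop :=
  ∃ C : ℝ, ∀ j α, ‖a j α‖ ≤ C * Real.exp (-ρ * len α ^ (1 / (2 * s))) / expWeight d s r j

theorem expWeight_pos (d : ℕ) (s r : ℝ) (j : ℕ) : 0 < expWeight d s r j := Real.exp_pos _

theorem one_le_expWeight (d : ℕ) (s : ℝ) {r : ℝ} (hr : 0 ≤ r) (j : ℕ) : 1 ≤ expWeight d s r j :=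
  Real.one_le_exp (mul_nonneg hr (Real.rpow_nonneg (by positivity) _))

theorem expWeight_mono (d : ℕ) (s : ℝ) {r r' : ℝ} (hr : r ≤ r') (j : ℕ) :
    expWeight d s r j ≤ expWeight d s r' j := by
  unfold expWeight
  gcongr

theorem summable_inv_expWeight {d : ℕ} {s r : ℝ} (hd : 0 < d) (hs : 0 < s) (hr : 0 < r) :
    Summable fun j => (expWeight d s r j)⁻¹ := by
  have hd' : (0 : ℝ) < d := by exact_mod_cast hd
  refine (summable_exp_neg_succ_rpow hr (a := 1 / (2 * d * s)) (by positivity)).congr fun j => ?_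
  rw [expWeight, neg_mul, Real.exp_neg]

variable {d : ℕ} {s r ρ h : ℝ} {p : ℝ≥0∞} {a : ℕ → (ι → ℕ) → ℂ}
  {f : ℕ → EuclideanSpace ℝ ι → ℂ}

theorem SeqCoeffBound.exists_nonneg (ha : SeqCoeffBound d s r ρ a) :
    ∃ C : ℝ, 0 ≤ C ∧
      ∀ j α, ‖a j α‖ ≤ C * Real.exp (-ρ * len α ^ (1 / (2 * s))) / expWeight d s r j := by
  obtain ⟨C, hC⟩ := ha
  refine ⟨|C|, abs_nonneg C, fun j α => (hC j α).trans ?_⟩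
  have := expWeight_pos d s r j
  gcongr
  exact le_abs_self C

theorem SeqCoeffBound.coeffBound (ha : SeqCoeffBound d s r ρ a) (j : ℕ) :
    CoeffBound s ρ (a j) := by
  obtain ⟨C, hC⟩ := ha
  exact ⟨C / expWeight d s r j, fun α => (hC j α).trans_eq (by ring)⟩

theorem SeqCoeffBound.rapidDecay (ha : SeqCoeffBound d s r ρ a) (hs : 0 < s) (hρ : 0 < ρ) (j : ℕ) :
    RapidDecay (a j) :=
  rapidDecay_of_coeffBound hs hρ (ha.coeffBound j)

theorem summable_exp_mul_hermiteBound (hs : 0 < s) (hρ : 0 < ρ) :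
    Summable fun α : ι → ℕ => Real.exp (-ρ * len α ^ (1 / (2 * s))) * hermiteBound α := by
  refine Summable.of_nonneg_of_le (fun α => mul_nonneg (Real.exp_pos _).le (hermiteBound_pos α).le)
    (fun α => ?_) ((summable_pow_mul_exp_neg_len (ι := ι) hρ (a := 1 / (2 * s)) (by positivity)
      (3 * Fintype.card ι)).mul_left (100 ^ Fintype.card ι))
  calc _ ≤ Real.exp (-ρ * len α ^ (1 / (2 * s))) *
        (100 ^ Fintype.card ι * (len α + 1) ^ (3 * Fintype.card ι)) := by
        gcongr; exact hermiteBound_le α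
    _ = _ := by ring

/-- The decay is split into halves: one turns the `N`-th power of the eigenvalue into `h^N
(N!)^(2s)`, which dictates the lower bound on `h`; the other pays for summing `hermiteBound`. -/
theorem SeqCoeffBound.functionEstimate (ha : SeqCoeffBound d s r ρ a) (hp : 1 ≤ p) (hs : 0 < s)
    (hρ : 0 < ρ) (hh : 2 * (2 + Fintype.card ι) * (2 * s / (ρ / 2)) ^ (2 * s) ≤ h) :
    FunctionEstimate p d s r h fun j => hermiteSeries (a j) := by
  obtain ⟨C, hC0, hC⟩ := ha.exists_nonneg
  have hrd := ha.rapidDecay hs hρ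
  have hρ2 : 0 < ρ / 2 := by positivity
  set S := ∑' α : ι → ℕ, Real.exp (-(ρ / 2) * len α ^ (1 / (2 * s))) * hermiteBound α with hS
  have hsum := summable_exp_mul_hermiteBound (ι := ι) hs hρ2
  have hw := memLp_weight (ι := ι) hp
  have hh0 : 0 ≤ h := le_trans (by positivity) hh
  refine ⟨C * (1 + Real.exp (ρ / 2)) * S * (eLpNorm (weight : EuclideanSpace ℝ ι → ℝ) p).toReal,
    fun j N => ⟨_, ((hrd j).mul_pow N).memLp hp, (hrd j).isHarmOscPow N, ?_⟩⟩
  have hE := expWeight_pos d s r j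
  set A := C * (1 + Real.exp (ρ / 2)) * (h ^ N * (N.factorial : ℝ) ^ (2 * s)) / expWeight d s r j
    with hA
  have hA0 : 0 ≤ A := by positivity
  have hb : ∑' α : ι → ℕ, ‖((2 * len α + Fintype.card ι) ^ N : ℝ) * a j α‖ * hermiteBound α ≤
      A * S := by
    rw [hS, ← tsum_mul_left]
    refine ((hrd j).mul_pow N).summable_mul_hermiteBound.tsum_le_tsum (fun α => ?_)
      (hsum.mul_left A)
    have hl := len_nonneg α
    have hbd := hermiteBound_pos α
    have hpow := pow_mul_exp_neg_le_factorial (b := 2 + Fintype.card ι) hs hρ2 (by positivity)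
      hh hl N
    have hle : (2 * len α + Fintype.card ι) ^ N ≤ ((2 + Fintype.card ι) * (len α + 1)) ^ N := by
      have : (0 : ℝ) ≤ Fintype.card ι := by positivity
      gcongr
      nlinarith
    have hexp : Real.exp (-ρ * len α ^ (1 / (2 * s))) =
        Real.exp (-(ρ / 2) * len α ^ (1 / (2 * s))) *
          Real.exp (-(ρ / 2) * len α ^ (1 / (2 * s))) := by
      rw [← Real.exp_add]; congr 1; ring
    rw [norm_mul, Complex.norm_real, Real.norm_eq_abs, abs_of_nonneg (by positivity)]
    calc (2 * len α + Fintype.card ι) ^ N * ‖a j α‖ * hermiteBound α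
        ≤ ((2 + Fintype.card ι) * (len α + 1)) ^ N *
          (C * Real.exp (-ρ * len α ^ (1 / (2 * s))) / expWeight d s r j) * hermiteBound α := by
          gcongr
          exact hC j α
      _ = C / expWeight d s r j * (((2 + Fintype.card ι) * (len α + 1)) ^ N *
          Real.exp (-(ρ / 2) * len α ^ (1 / (2 * s)))) *
          (Real.exp (-(ρ / 2) * len α ^ (1 / (2 * s))) * hermiteBound α) := by
          rw [hexp]; ring
      _ ≤ C / expWeight d s r j * ((1 + Real.exp (ρ / 2)) *
            (h ^ N * (N.factorial : ℝ) ^ (2 * s))) *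
          (Real.exp (-(ρ / 2) * len α ^ (1 / (2 * s))) * hermiteBound α) := by gcongr
      _ = _ := by rw [hA]; ring
  refine (((hrd j).mul_pow N).eLpNorm_le hb).trans ?_
  rw [← ENNReal.ofReal_toReal hw.2.ne, ← ENNReal.ofReal_mul (by
    have : 0 ≤ S := tsum_nonneg fun α => mul_nonneg (Real.exp_pos _).le (hermiteBound_pos α).le
    positivity)]
  refine ENNReal.ofReal_le_ofReal (le_of_eq ?_)
  rw [ENNReal.toReal_ofReal ENNReal.toReal_nonneg, hA]
  ring

theorem FunctionEstimate.exists_nonneg (hf : FunctionEstimate p d s r h f) (hh : 0 < h) :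
    ∃ C : ℝ, 0 ≤ C ∧ ∀ j N : ℕ, HarmOscPowNormLE p N (f j)
      (C * (h ^ N * (N.factorial : ℝ) ^ (2 * s)) / expWeight d s r j) := by
  obtain ⟨C, hC⟩ := hf
  refine ⟨|C|, abs_nonneg C, fun j N => ?_⟩
  obtain ⟨g, h1, h2, h3⟩ := hC j N
  refine ⟨g, h1, h2, h3.trans (ENNReal.ofReal_le_ofReal ?_)⟩
  have := expWeight_pos d s r j
  gcongr
  exact le_abs_self C

theorem IsHarmOscPow.succ {u g g' : EuclideanSpace ℝ ι → ℂ} {N : ℕ} (hg : IsHarmOscPow N u g)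
    (hg' : IsHarmOscPow (N + 1) u g') (φ : EuclideanSpace ℝ ι → ℂ) (hφ : ContDiff ℝ ∞ φ)
    (hc : HasCompactSupport φ) : ∫ x, g' x * φ x = ∫ x, g x * harmOsc φ x := by
  rw [hg' φ hφ hc, hg (harmOsc φ) (contDiff_harmOsc hφ) (hasCompactSupport_harmOsc hc),
    Function.iterate_succ_apply]

/-- The case `N = 0` of the estimates speaks of some `g` equal to `u` as a distribution; local
integrability turns this into equality almost everywhere. -/
theorem IsHarmOscPow.ae_eq {u g : EuclideanSpace ℝ ι → ℂ} (hg : IsHarmOscPow 0 u g)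
    (hu : LocallyIntegrable u) (hgl : LocallyIntegrable g) : u =ᵐ[volume] g := by
  refine ae_eq_of_integral_contDiff_smul_eq hu hgl fun ψ hψ hc => ?_
  have := hg (fun x => (ψ x : ℂ)) (Complex.ofRealCLM.contDiff.comp hψ)
    (hc.comp_left (g := fun t : ℝ => (t : ℂ)) (by simp))
  simp only [Function.iterate_zero, id_eq] at this
  simp only [Complex.real_smul, mul_comm ((ψ _ : ℝ) : ℂ)]
  exact this.symm

/-- Estimates for the powers of the harmonic oscillator bound the Hermite coefficients. -/
theorem FunctionEstimate.seqCoeffBound (hf : FunctionEstimate p d s r h f) (hp : 1 ≤ p)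
    (hs : 0 < s) (hh : 0 < h) (hloc : ∀ j, LocallyIntegrable (f j)) :
    SeqCoeffBound d s r (s * (h⁻¹) ^ (1 / (2 * s)) / 2)
      (fun j (α : ι → ℕ) => ∫ x, f j x * (hermiteFun α x : ℂ)) ∧
      ∀ j, WeightIntegrable (f j) := by
  obtain ⟨C, hC0, hC⟩ := hf.exists_nonneg hh
  choose g hgp hgH hgB using hC
  obtain ⟨W, hW0, hW⟩ := exists_integral_norm_mul_weight_le (ι := ι) hp
  have hB0 : ∀ j N, 0 ≤ C * (h ^ N * (N.factorial : ℝ) ^ (2 * s)) / expWeight d s r j := by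
    intro j N
    have := expWeight_pos d s r j
    positivity
  have hgw : ∀ j N, WeightIntegrable (g j N) := fun j N =>
    ⟨(hgp j N).1, (hW _ (hgp j N) _ (hB0 j N) (hgB j N)).1⟩
  have hgI := fun j N => (hW _ (hgp j N) _ (hB0 j N) (hgB j N)).2
  have hae : ∀ j, f j =ᵐ[volume] g j 0 := fun j =>
    (hgH j 0).ae_eq (hloc j) ((hgp j 0).locallyIntegrable hp)
  -- The coefficients of `H^N f_j` are those of `f_j` times the `N`-th power of the eigenvalue, so
  -- the estimates bound all moments of a single coefficient.
  have hmom : ∀ j (α : ι → ℕ) N, ∫ x, g j N x * (hermiteFun α x : ℂ) =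
      ((2 * len α + Fintype.card ι : ℝ) : ℂ) ^ N * ∫ x, f j x * (hermiteFun α x : ℂ) := by
    intro j α N
    induction N with
    | zero =>
      rw [pow_zero, one_mul]
      refine integral_congr_ae ?_
      filter_upwards [hae j] with x hx
      rw [hx]
    | succ N ih =>
      rw [integral_mul_hermiteFun_of_weak (hgw j N) (hgw j (N + 1))
        ((hgH j N).succ (hgH j (N + 1))), ih, pow_succ]
      ring
  set a : ℝ := 1 / (2 * s) with ha
  have ha0 : 0 < a := by positivity
  -- The moment bound yields the rate `s h^(-a)`; half of it is given up to absorb the polynomial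
  -- factor `hermiteBound α`.
  set ρ := s * (h⁻¹) ^ a / 2 with hρ
  have hρ0 : 0 < ρ := by positivity
  obtain ⟨D, hD0, hD⟩ := hermiteBound_mul_exp_le ι hρ0 ha0
  refine ⟨⟨W * C * 2 ^ (2 * s) * D, fun j α => ?_⟩, fun j => ⟨(hgw j 0).1.congr (hae j).symm, ?_⟩⟩
  · have hE := expWeight_pos d s r j
    have hl := len_nonneg α
    have hb := hermiteBound_pos α
    have hX : 0 ≤ 2 * len α + Fintype.card ι := by positivity
    have h1 := le_exp_neg_of_forall_mul_pow_le (q := ‖∫ x, f j x * (hermiteFun α x : ℂ)‖)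
      (A := hermiteBound α * (W * C / expWeight d s r j)) hs hh hX (by positivity)
      (norm_nonneg _) (fun N => by
        have h2 := (hgw j N).norm_integral_mul_hermiteFun_le α
        rw [hmom, norm_mul, norm_pow, Complex.norm_real, Real.norm_eq_abs, abs_of_nonneg hX] at h2
        calc _ ≤ hermiteBound α * ∫ x, ‖g j N x‖ * weight x := by linarith
          _ ≤ hermiteBound α * (W * (C * (h ^ N * (N.factorial : ℝ) ^ (2 * s)) /
              expWeight d s r j)) := by gcongr; exact hgI j N
          _ = _ := by ring)
    have h3 : 2 * ρ * len α ^ a ≤ s * ((2 * len α + Fintype.card ι) / h) ^ a := by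
      have h4 : (len α / h) ^ a ≤ ((2 * len α + Fintype.card ι) / h) ^ a := by
        refine Real.rpow_le_rpow (by positivity) ?_ ha0.le
        gcongr
        have : (0 : ℝ) ≤ Fintype.card ι := by positivity
        linarith
      rw [div_eq_mul_inv, Real.mul_rpow hl (by positivity)] at h4
      calc 2 * ρ * len α ^ a = s * (len α ^ a * (h⁻¹) ^ a) := by rw [hρ]; ring
        _ ≤ _ := by gcongr
    refine h1.trans ?_
    calc _ ≤ hermiteBound α * (W * C / expWeight d s r j) * 2 ^ (2 * s) *
          Real.exp (-(2 * ρ * len α ^ a)) := by gcongr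
      _ = (W * C / expWeight d s r j) * 2 ^ (2 * s) * (hermiteBound α *
          Real.exp (-ρ * len α ^ a)) * Real.exp (-ρ * len α ^ a) := by
          have : Real.exp (-(2 * ρ * len α ^ a)) =
              Real.exp (-ρ * len α ^ a) * Real.exp (-ρ * len α ^ a) := by
            rw [← Real.exp_add]; congr 1; ring
          rw [this]; ring
      _ ≤ (W * C / expWeight d s r j) * 2 ^ (2 * s) * D * Real.exp (-ρ * len α ^ a) := by
          gcongr; exact hD α
      _ = _ := by ring
  · refine (hgw j 0).2.congr ?_
    filter_upwards [hae j] with x hx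
    rw [hx]

/-! ### Products of Hermite series -/

variable {κ : Type*} [Fintype κ] {b : ℕ → (κ → ℕ) → ℂ} {l : ℕ → ℝ}

/-- One inverse weight in `j` is enough for summability. The second is bounded by `1`, and `l`
enters only through its upper bound. -/
theorem norm_mul_coeff_le (hl0 : ∀ j, 0 ≤ l j) {L : ℝ} (hL : ∀ j, l j ≤ L) (hr : 0 ≤ r)
    (ha : SeqCoeffBound d s r ρ a) (hb : SeqCoeffBound d s r ρ b) :
    ∃ C : ℝ, 0 ≤ C ∧ ∀ j α β, ‖(l j : ℂ) * (a j α * b j β)‖ ≤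
      C * (Real.exp (-ρ * len α ^ (1 / (2 * s))) * Real.exp (-ρ * len β ^ (1 / (2 * s)))) *
        (expWeight d s r j)⁻¹ := by
  obtain ⟨A, hA0, hA⟩ := ha.exists_nonneg
  obtain ⟨B, hB0, hB⟩ := hb.exists_nonneg
  have hL0 : 0 ≤ L := (hl0 0).trans (hL 0)
  refine ⟨L * (A * B), by positivity, fun j α β => ?_⟩
  have hE := expWeight_pos d s r j
  have hE1 := one_le_expWeight d s hr j
  rw [norm_mul, norm_mul, Complex.norm_real, Real.norm_eq_abs, abs_of_nonneg (hl0 j)]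
  calc l j * (‖a j α‖ * ‖b j β‖) ≤ L * ((A * Real.exp (-ρ * len α ^ (1 / (2 * s))) /
        expWeight d s r j) * (B * Real.exp (-ρ * len β ^ (1 / (2 * s))) / 1)) := by
        gcongr
        · exact hL j
        · exact hA j α
        · refine (hB j β).trans ?_
          gcongr
    _ = _ := by ring

theorem hasSum_mul_complex {A B : Type*} {u : A → ℂ} {v : B → ℂ} {x y : ℂ} (hu : HasSum u x)
    (hv : HasSum v y) : HasSum (fun q : A × B => u q.1 * v q.2) (x * y) := by
  have h := summable_mul_of_summable_norm (R := ℂ) hu.summable.norm hv.summable.norm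
  have h2 := tsum_mul_tsum_of_summable_norm (R := ℂ) hu.summable.norm hv.summable.norm
  rw [hu.tsum_eq, hv.tsum_eq] at h2
  rw [h2]
  exact h.hasSum

/-- Rearrangement of a sum of products of Hermite series. -/
theorem exists_hasSum_mul_hermiteSeries (hd : 0 < d) (hs : 0 < s) (hr : 0 < r) (hρ : 0 < ρ)
    (hl0 : ∀ j, 0 ≤ l j) {L : ℝ} (hL : ∀ j, l j ≤ L)
    (ha : SeqCoeffBound d s r ρ a) (hb : SeqCoeffBound d s r ρ b)
    (x : EuclideanSpace ℝ ι) (y : EuclideanSpace ℝ κ) :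
    ∃ S : ℂ, HasSum (fun j => (l j : ℂ) * (hermiteSeries (a j) x * hermiteSeries (b j) y)) S ∧
      HasSum (fun q : (κ → ℕ) × (ι → ℕ) => (∑' j, (l j : ℂ) * (a j q.2 * b j q.1)) *
        ((hermiteFun q.1 y : ℂ) * (hermiteFun q.2 x : ℂ))) S := by
  obtain ⟨C, hC0, hC⟩ := norm_mul_coeff_le hl0 hL hr.le ha hb
  have hsj := summable_inv_expWeight hd hs hr
  have h1 := summable_exp_mul_hermiteBound (ι := ι) hs hρ
  have h2 := summable_exp_mul_hermiteBound (ι := κ) hs hρ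
  have h12 := h2.mul_of_nonneg h1
    (fun α => mul_nonneg (Real.exp_pos _).le (hermiteBound_pos α).le)
    (fun α => mul_nonneg (Real.exp_pos _).le (hermiteBound_pos α).le)
  have h3 := (hsj.mul_of_nonneg h12 (fun j => (inv_pos.2 (expWeight_pos d s r j)).le)
    (fun q => mul_nonneg (mul_nonneg (Real.exp_pos _).le (hermiteBound_pos _).le)
      (mul_nonneg (Real.exp_pos _).le (hermiteBound_pos _).le))).mul_left C
  -- The absolutely summable triple family; the two assertions are its sums with `j` outermost and
  -- with `j` innermost.
  let T : ℕ × ((κ → ℕ) × (ι → ℕ)) → ℂ := fun t => ((l t.1 : ℂ) * (a t.1 t.2.2 * b t.1 t.2.1)) *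
    ((hermiteFun t.2.1 y : ℂ) * (hermiteFun t.2.2 x : ℂ))
  have hT : Summable T := by
    refine Summable.of_norm_bounded h3 fun t => ?_
    have e1 := abs_hermiteFun_le_hermiteBound t.2.1 y
    have e2 := abs_hermiteFun_le_hermiteBound t.2.2 x
    have hE := expWeight_pos d s r t.1
    have hb1 := hermiteBound_pos t.2.1
    simp only [T]
    rw [norm_mul, norm_mul ((hermiteFun t.2.1 y : ℝ) : ℂ), Complex.norm_real, Complex.norm_real,
      Real.norm_eq_abs, Real.norm_eq_abs]
    calc _ ≤ (C * (Real.exp (-ρ * len t.2.2 ^ (1 / (2 * s))) *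
          Real.exp (-ρ * len t.2.1 ^ (1 / (2 * s)))) * (expWeight d s r t.1)⁻¹) *
          (hermiteBound t.2.1 * hermiteBound t.2.2) := by
          gcongr
          exact hC _ _ _
      _ = _ := by ring
  refine ⟨∑' t, T t, hT.hasSum.prod_fiberwise fun j => ?_, ?_⟩
  · have s1 := (ha.rapidDecay hs hρ j).isHermiteSeries x
    have s2 := (hb.rapidDecay hs hρ j).isHermiteSeries y
    have s3 := hasSum_mul_complex s2 s1
    rw [mul_comm (hermiteSeries (a j) x)]
    refine (s3.mul_left (l j : ℂ)).congr_fun fun q => ?_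
    simp only [T]
    ring
  · have hT' := (Equiv.prodComm ℕ ((κ → ℕ) × (ι → ℕ))).symm.hasSum_iff.2 hT.hasSum
    refine hT'.prod_fiberwise fun q => ?_
    have sj : Summable fun j => (l j : ℂ) * (a j q.2 * b j q.1) :=
      Summable.of_norm_bounded (hsj.mul_left _) fun j => hC j q.2 q.1
    have sj' := sj.hasSum.mul_right ((hermiteFun q.1 y : ℂ) * (hermiteFun q.2 x : ℂ))
    exact sj'.congr_fun fun j => rfl

end Pilipovic
end

noncomputable section
namespace Pilipovic

variable {ι κ : Type*}

/-! ### Hermite series on a product -/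

/-- The point of the sum with given components. -/
def joinSum (x : EuclideanSpace ℝ κ) (y : EuclideanSpace ℝ ι) : EuclideanSpace ℝ (κ ⊕ ι) :=
  WithLp.toLp 2 (Sum.elim x y)

theorem continuous_joinSum :
    Continuous fun z : EuclideanSpace ℝ κ × EuclideanSpace ℝ ι => joinSum z.1 z.2 := by
  refine (PiLp.continuous_toLp 2 _).comp (continuous_pi fun i => ?_)
  rcases i with i | i
  · exact (by fun_prop : Continuous fun z : EuclideanSpace ℝ κ × EuclideanSpace ℝ ι => z.1 i)
  · exact (by fun_prop : Continuous fun z : EuclideanSpace ℝ κ × EuclideanSpace ℝ ι => z.2 i)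

theorem joinSum_components (z : EuclideanSpace ℝ (κ ⊕ ι)) :
    joinSum (WithLp.toLp 2 fun i => z (Sum.inl i)) (WithLp.toLp 2 fun i => z (Sum.inr i)) = z := by
  ext i
  rcases i with i | i <;> rfl

variable [Fintype ι] [Fintype κ]

theorem onSum_joinSum {m n : ℕ} (K : EuclideanSpace ℝ (Fin m) × EuclideanSpace ℝ (Fin n) → ℂ)
    (x : EuclideanSpace ℝ (Fin m)) (y : EuclideanSpace ℝ (Fin n)) :
    onSum K (joinSum x y) = K (x, y) := rfl

theorem hermiteFun_joinSum (γ : κ ⊕ ι → ℕ) (x : EuclideanSpace ℝ κ) (y : EuclideanSpace ℝ ι) :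
    hermiteFun γ (joinSum x y) =
      hermiteFun (fun i => γ (Sum.inl i)) x * hermiteFun (fun i => γ (Sum.inr i)) y := by
  rw [hermiteFun, Fintype.prod_sum_type]
  rfl

theorem len_sum (γ : κ ⊕ ι → ℕ) :
    len γ = len (fun i => γ (Sum.inl i)) + len (fun i => γ (Sum.inr i)) := by
  rw [len, Fintype.sum_sum_type, Nat.cast_add]

theorem hasSum_hermiteFun_joinSum_iff {c : (κ ⊕ ι → ℕ) → ℂ} {x : EuclideanSpace ℝ κ}
    {y : EuclideanSpace ℝ ι} {S : ℂ} :
    HasSum (fun γ => c γ * (hermiteFun γ (joinSum x y) : ℂ)) S ↔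
      HasSum (fun q : (κ → ℕ) × (ι → ℕ) => c (Sum.elim q.1 q.2) *
        ((hermiteFun q.1 x : ℂ) * (hermiteFun q.2 y : ℂ))) S := by
  rw [← (Equiv.sumArrowEquivProdArrow κ ι ℕ).symm.hasSum_iff]
  refine iff_of_eq (congrArg (fun F => HasSum F S) (funext fun q => ?_))
  simp only [Function.comp_apply, hermiteFun_joinSum, Complex.ofReal_mul]
  rfl

/-- The coefficients of `∑_j l_j F_j ⊗ G_j`, in terms of those of `F_j` and `G_j`. -/
def productCoeff (l : ℕ → ℝ) (a : ℕ → (ι → ℕ) → ℂ) (b : ℕ → (κ → ℕ) → ℂ) (γ : κ ⊕ ι → ℕ) : ℂ :=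
  ∑' j, (l j : ℂ) * (a j (fun i => γ (Sum.inr i)) * b j (fun i => γ (Sum.inl i)))

variable {d : ℕ} {s r ρ h : ℝ} {p : ℝ≥0∞} {a : ℕ → (ι → ℕ) → ℂ} {b : ℕ → (κ → ℕ) → ℂ} {l : ℕ → ℝ}

/-- With `a = 1/(2s)`, the loss of `2^a` in the rate comes from `(|β| + |α|)^a ≤ 2^a (|β|^a +
|α|^a)`, which is valid for every `a > 0`. -/
theorem coeffBound_productCoeff (hd : 0 < d) (hs : 0 < s) (hr : 0 < r) (hρ : 0 < ρ)
    (hl0 : ∀ j, 0 ≤ l j) {L : ℝ} (hL : ∀ j, l j ≤ L)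
    (ha : SeqCoeffBound d s r ρ a) (hb : SeqCoeffBound d s r ρ b) :
    CoeffBound s (ρ / 2 ^ (1 / (2 * s))) (productCoeff l a b) := by
  obtain ⟨C, hC0, hC⟩ := norm_mul_coeff_le hl0 hL hr.le ha hb
  have hsj := summable_inv_expWeight hd hs hr
  refine ⟨C * ∑' j, (expWeight d s r j)⁻¹, fun γ => ?_⟩
  set α : ι → ℕ := fun i => γ (Sum.inr i)
  set β : κ → ℕ := fun i => γ (Sum.inl i)
  have h1 : ‖productCoeff l a b γ‖ ≤
      C * (Real.exp (-ρ * len α ^ (1 / (2 * s))) * Real.exp (-ρ * len β ^ (1 / (2 * s)))) *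
        ∑' j, (expWeight d s r j)⁻¹ := by
    rw [← tsum_mul_left]
    exact tsum_of_norm_bounded (hsj.mul_left _).hasSum fun j => hC j α β
  refine h1.trans ?_
  have hT : 0 ≤ ∑' j, (expWeight d s r j)⁻¹ :=
    tsum_nonneg fun j => (inv_pos.2 (expWeight_pos d s r j)).le
  rw [mul_right_comm, ← Real.exp_add]
  gcongr
  have h2 := rpow_add_le_mul (len_nonneg β) (len_nonneg α) (a := 1 / (2 * s)) (by positivity)
  change _ ≤ -(ρ / 2 ^ (1 / (2 * s))) * len γ ^ (1 / (2 * s))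
  rw [len_sum]
  have h3 : ρ / 2 ^ (1 / (2 * s)) * (len β + len α) ^ (1 / (2 * s)) ≤
      ρ * (len β ^ (1 / (2 * s)) + len α ^ (1 / (2 * s))) := by
    rw [div_mul_eq_mul_div, div_le_iff₀ (by positivity)]
    calc _ ≤ ρ * (2 ^ (1 / (2 * s)) * (len β ^ (1 / (2 * s)) + len α ^ (1 / (2 * s)))) := by
          gcongr
      _ = _ := by ring
  linarith

/-! ### From expansions to Hermite series -/

variable {d₁ d₂ : ℕ} {K : EuclideanSpace ℝ (Fin d₂) × EuclideanSpace ℝ (Fin d₁) → ℂ}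
  {f₁ : ℕ → EuclideanSpace ℝ (Fin d₁) → ℂ} {f₂ : ℕ → EuclideanSpace ℝ (Fin d₂) → ℂ}

/-- The Hermite coefficients of a sequence of functions. -/
def hermiteCoeff (f : ℕ → EuclideanSpace ℝ ι → ℂ) (j : ℕ) (α : ι → ℕ) : ℂ :=
  ∫ x, f j x * (hermiteFun α x : ℂ)

theorem ScalarEstimate.exists_bound (hl : ScalarEstimate d s r l) (hl0 : ∀ j, 0 ≤ l j)
    (hr : 0 ≤ r) : ∃ L, ∀ j, l j ≤ L := by
  obtain ⟨C, hC⟩ := hl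
  exact ⟨C, fun j => (le_mul_of_one_le_left (hl0 j) (one_le_expWeight d s hr j)).trans (hC j)⟩

theorem coeffBound_of_expansionEstimates (hd₁ : 1 ≤ d₁) (hd₂ : 1 ≤ d₂) (hp : 1 ≤ p) (hs : 0 < s)
    (hr : 0 < r) (hh : 0 < h) (hl0 : ∀ j, 0 ≤ l j)
    (hf₁ : ∀ j, LocallyIntegrable (f₁ j)) (hf₂ : ∀ j, LocallyIntegrable (f₂ j))
    (H : ExpansionEstimates p s r h l f₁ f₂) :
    CoeffBound s (s * (h⁻¹) ^ (1 / (2 * s)) / 2 / 2 ^ (1 / (2 * s)))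
      (productCoeff l (hermiteCoeff f₁) (hermiteCoeff f₂)) := by
  obtain ⟨L, hL⟩ := H.1.exists_bound hl0 hr.le
  exact coeffBound_productCoeff (lt_min hd₁ hd₂) hs hr (by positivity) hl0 hL
    (H.2.1.seqCoeffBound hp hs hh hf₁).1 (H.2.2.seqCoeffBound hp hs hh hf₂).1

theorem isHermiteSeries_of_expansionEstimates (hK : Continuous K) (hd₁ : 1 ≤ d₁) (hd₂ : 1 ≤ d₂)
    (hp : 1 ≤ p) (hs : 0 < s) (hr : 0 < r) (hh : 0 < h) (hl0 : ∀ j, 0 ≤ l j)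
    (hf₁ : ∀ j, LocallyIntegrable (f₁ j)) (hf₂ : ∀ j, LocallyIntegrable (f₂ j))
    (hexp : ∀ᵐ z, ExpansionAt K l f₁ f₂ z) (H : ExpansionEstimates p s r h l f₁ f₂) :
    IsHermiteSeries (productCoeff l (hermiteCoeff f₁) (hermiteCoeff f₂)) (onSum K) := by
  have hcb := coeffBound_of_expansionEstimates hd₁ hd₂ hp hs hr hh hl0 hf₁ hf₂ H
  have hrd := rapidDecay_of_coeffBound hs (by positivity) hcb
  obtain ⟨L, hL⟩ := H.1.exists_bound hl0 hr.le
  obtain ⟨b₁, w₁⟩ := H.2.1.seqCoeffBound hp hs hh hf₁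
  obtain ⟨b₂, w₂⟩ := H.2.2.seqCoeffBound hp hs hh hf₂
  have hρ : 0 < s * (h⁻¹) ^ (1 / (2 * s)) / 2 := by positivity
  have e₁ : ∀ᵐ x, ∀ j, f₁ j x = hermiteSeries (hermiteCoeff f₁ j) x :=
    ae_all_iff.2 fun j => ae_eq_hermiteSeries (w₁ j) (b₁.rapidDecay hs hρ j)
  have e₂ : ∀ᵐ x, ∀ j, f₂ j x = hermiteSeries (hermiteCoeff f₂ j) x :=
    ae_all_iff.2 fun j => ae_eq_hermiteSeries (w₂ j) (b₂.rapidDecay hs hρ j)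
  have e₁' : ∀ᵐ z : EuclideanSpace ℝ (Fin d₂) × EuclideanSpace ℝ (Fin d₁),
      ∀ j, f₁ j z.2 = hermiteSeries (hermiteCoeff f₁ j) z.2 :=
    (Measure.quasiMeasurePreserving_snd (μ := volume) (ν := volume)).ae e₁
  have e₂' : ∀ᵐ z : EuclideanSpace ℝ (Fin d₂) × EuclideanSpace ℝ (Fin d₁),
      ∀ j, f₂ j z.1 = hermiteSeries (hermiteCoeff f₂ j) z.1 :=
    (Measure.quasiMeasurePreserving_fst (μ := volume) (ν := volume)).ae e₂
  have hae : K =ᵐ[volume] fun z =>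
      hermiteSeries (productCoeff l (hermiteCoeff f₁) (hermiteCoeff f₂)) (joinSum z.1 z.2) := by
    filter_upwards [hexp, e₁', e₂'] with z h0 h1 h2
    obtain ⟨S, hS1, hS2⟩ := exists_hasSum_mul_hermiteSeries (lt_min hd₁ hd₂) hs hr hρ hl0 hL
      b₁ b₂ z.2 z.1
    have h3 : K z = S := by
      refine HasSum.unique h0 (hS1.congr_fun fun j => ?_)
      rw [h1, h2]
      rfl
    have h4 := hrd.isHermiteSeries (joinSum z.1 z.2)
    rw [hasSum_hermiteFun_joinSum_iff] at h4
    rw [h3]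
    exact hS2.unique h4
  -- Both sides are continuous, so the almost everywhere identity holds at every point.
  have heq := (Continuous.ae_eq_iff_eq volume hK
    (hrd.continuous_hermiteSeries.comp continuous_joinSum)).1 hae
  intro z
  have h5 := hrd.isHermiteSeries z
  have h6 : onSum K z =
      hermiteSeries (productCoeff l (hermiteCoeff f₁) (hermiteCoeff f₂)) z := by
    have := congrFun heq
      (WithLp.toLp 2 fun i => z (Sum.inl i), WithLp.toLp 2 fun i => z (Sum.inr i))
    simp only [Function.comp_apply, joinSum_components] at this
    exact this
  rw [h6]
  exact h5

theorem onSum_mem_roumieuSpace (hK : Continuous K) (hd₁ : 1 ≤ d₁) (hd₂ : 1 ≤ d₂)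
    (hp : 1 ≤ p) (hs : 0 < s)
    (H : HasExpansion K fun l f₁ f₂ => ∃ r > 0, ∃ h > 0, ExpansionEstimates p s r h l f₁ f₂) :
    onSum K ∈ roumieuSpace (Fin d₂ ⊕ Fin d₁) s := by
  obtain ⟨l, f₁, f₂, hl0, hf₁, hf₂, hexp, r, hr, h, hh, H⟩ := H
  exact ⟨_, ⟨_, by positivity, coeffBound_of_expansionEstimates hd₁ hd₂ hp hs hr hh hl0 hf₁ hf₂ H⟩,
    isHermiteSeries_of_expansionEstimates hK hd₁ hd₂ hp hs hr hh hl0 hf₁ hf₂ hexp H⟩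

theorem onSum_mem_beurlingSpace (hK : Continuous K) (hd₁ : 1 ≤ d₁) (hd₂ : 1 ≤ d₂)
    (hp : 1 ≤ p) (hs : 0 < s)
    (H : HasExpansion K fun l f₁ f₂ => ∀ r > 0, ∀ h > 0, ExpansionEstimates p s r h l f₁ f₂) :
    onSum K ∈ beurlingSpace (Fin d₂ ⊕ Fin d₁) s := by
  obtain ⟨l, f₁, f₂, hl0, hf₁, hf₂, hexp, H⟩ := H
  refine ⟨_, fun R hR => ?_, isHermiteSeries_of_expansionEstimates hK hd₁ hd₂ hp hs one_pos one_pos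
    hl0 hf₁ hf₂ hexp (H 1 one_pos 1 one_pos)⟩
  -- The coefficients do not depend on `r` and `h`, so any rate `R` is reached by the choice of `h`;
  -- `h = Q^(-2s)` produces exactly `R`.
  set Q : ℝ := 2 * 2 ^ (1 / (2 * s)) * R / s with hQ
  have hQ0 : 0 < Q := by positivity
  have h1 := coeffBound_of_expansionEstimates (h := (Q ^ (2 * s))⁻¹) hd₁ hd₂ hp hs one_pos
    (by positivity) hl0 hf₁ hf₂ (H 1 one_pos _ (by positivity))
  have e : s * ((Q ^ (2 * s))⁻¹)⁻¹ ^ (1 / (2 * s)) / 2 / 2 ^ (1 / (2 * s)) = R := by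
    rw [inv_inv, ← Real.rpow_mul hQ0.le, mul_one_div_cancel (by positivity), Real.rpow_one, hQ]
    field_simp
  rwa [e] at h1

end Pilipovic
end

noncomputable section
namespace Pilipovic

/-! ### Singular value decomposition of compact operators -/

section SingularValues

open scoped InnerProductSpace InnerProduct

theorem norm_sq_sum_smul {J G : Type*} [Fintype J] [NormedAddCommGroup G] [InnerProductSpace ℂ G]
    {w : J → G} (hw : Orthonormal ℂ w) (b : J → ℂ) : ‖∑ i, b i • w i‖ ^ 2 = ∑ i, ‖b i‖ ^ 2 := by
  have h := hw.inner_sum b b Finset.univ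
  rw [inner_self_eq_norm_sq_to_K] at h
  have h' : ((‖∑ i, b i • w i‖ ^ 2 : ℝ) : ℂ) = ((∑ i, ‖b i‖ ^ 2 : ℝ) : ℂ) := by
    push_cast
    refine Eq.trans h (Finset.sum_congr rfl fun i _ => ?_)
    rw [Complex.conj_mul']
  exact_mod_cast h'

/-- A bound for the number of singular values exceeding `ε`, when `T` is `ε`-small on the common
kernel of finitely many functionals. -/
theorem card_le_of_norm_le {I A E F : Type*} [NormedAddCommGroup E] [InnerProductSpace ℂ E]
    [NormedAddCommGroup F] [InnerProductSpace ℂ F] {T : E →L[ℂ] F} {σ : I → ℝ} {v : I → E}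
    {u : I → F} (hv : Orthonormal ℂ v) (hu : Orthonormal ℂ u) (hTv : ∀ i, T (v i) = (σ i : ℂ) • u i)
    (φ : A → E →L[ℂ] ℂ) (s : Finset A) {ε : ℝ} (hε : 0 ≤ ε)
    (hT : ∀ x, (∀ a ∈ s, φ a x = 0) → ‖T x‖ ≤ ε * ‖x‖) (J : Finset I) (hJ : ∀ i ∈ J, ε < σ i) :
    J.card ≤ s.card := by
  by_contra! hlt
  -- With more singular vectors than functionals, some nonzero combination is annihilated by all of
  -- them, yet `T` stretches it by more than `ε`.
  let f : (J → ℂ) →ₗ[ℂ] (s → ℂ) :=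
    LinearMap.pi fun a => (φ a).toLinearMap ∘ₗ Fintype.linearCombination ℂ fun i : J => v i
  have hker : LinearMap.ker f ≠ ⊥ := LinearMap.ker_ne_bot_of_finrank_lt (by simpa using hlt)
  obtain ⟨c, hc, hc0⟩ := Submodule.exists_mem_ne_zero_of_ne_bot hker
  set x := Fintype.linearCombination ℂ (fun i : J => v i) c with hx
  have hxs : x = ∑ i, c i • v i := Fintype.linearCombination_apply ..
  have h1 : ‖T x‖ ≤ ε * ‖x‖ := hT x fun a ha => by
    simpa [f] using congrFun (LinearMap.mem_ker.1 hc) ⟨a, ha⟩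
  have hv' := hv.comp ((↑) : J → I) Subtype.val_injective
  have hu' := hu.comp ((↑) : J → I) Subtype.val_injective
  have hTx : T x = ∑ i, (c i * σ i) • u i := by
    rw [hxs, map_sum]
    refine Finset.sum_congr rfl fun i _ => ?_
    rw [map_smul, hTv, smul_smul]
  have h2 : ‖x‖ ^ 2 = ∑ i, ‖c i‖ ^ 2 := by rw [hxs]; exact norm_sq_sum_smul hv' c
  have h3 : ‖T x‖ ^ 2 = ∑ i, ‖c i * σ i‖ ^ 2 := by rw [hTx]; exact norm_sq_sum_smul hu' _
  have h4 : ‖T x‖ ^ 2 ≤ ε ^ 2 * ‖x‖ ^ 2 := by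
    rw [← mul_pow]
    exact pow_le_pow_left₀ (norm_nonneg _) h1 2
  rw [h2, h3, Finset.mul_sum] at h4
  refine absurd h4 (not_le.2 (Finset.sum_lt_sum (fun i _ => ?_) ?_))
  · have := hJ i i.2
    rw [norm_mul, mul_pow, mul_comm, Complex.norm_real, Real.norm_eq_abs, sq_abs]
    gcongr
  · obtain ⟨i, hi⟩ := Function.ne_iff.1 hc0
    have := hJ i i.2
    refine ⟨i, Finset.mem_univ _, ?_⟩
    rw [norm_mul, mul_pow, mul_comm, Complex.norm_real, Real.norm_eq_abs, sq_abs]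
    have : 0 < ‖c i‖ := norm_pos_iff.2 hi
    gcongr

universe u
variable {E : Type u} {F : Type*} [NormedAddCommGroup E] [InnerProductSpace ℂ E] [CompleteSpace E]
  [NormedAddCommGroup F] [InnerProductSpace ℂ F] [CompleteSpace F]

/-- Hilbert bases of all the eigenspaces are put together; they are mutually orthogonal, and the
spectral theorem makes their span dense. Values `μ` that are not eigenvalues contribute nothing. -/
theorem exists_hilbertBasis_eigenvectors {S : E →L[ℂ] E} (hS : IsCompactOperator S)
    (hsym : S.toLinearMap.IsSymmetric) :
    ∃ (I : Type u) (B : HilbertBasis I ℂ E) (μ : I → ℂ), ∀ i, S (B i) = μ i • B i := by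
  have hfam := hsym.orthogonalFamily_eigenspaces
  have hc (μ : ℂ) : CompleteSpace (Module.End.eigenspace S.toLinearMap μ) := by
    have : IsClosed (Module.End.eigenspace S.toLinearMap μ : Set E) := by
      have h : (Module.End.eigenspace S.toLinearMap μ : Set E) = {x | S x = μ • x} := by
        ext x
        simp
      rw [h]
      exact isClosed_eq S.continuous (continuous_const_smul μ)
    exact this.completeSpace_coe
  choose w b hb using fun μ : ℂ => exists_hilbertBasis ℂ (Module.End.eigenspace S.toLinearMap μ)
  let v : (Σ μ : ℂ, w μ) → E := fun p => (b p.1 p.2 : E)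
  have hv : Orthonormal ℂ v :=
    hfam.orthonormal_sigma_orthonormal (v_family := fun μ i => b μ i) fun μ => (b μ).orthonormal
  have hsp : (Submodule.span ℂ (Set.range v))ᗮ = ⊥ := by
    rw [eq_bot_iff, ← ContinuousLinearMap.orthogonalComplement_iSup_eigenspaces_eq_bot hS hsym]
    intro x hx
    rw [Submodule.mem_orthogonal] at hx ⊢
    intro y hy
    rw [← Submodule.mem_orthogonal_singleton_iff_inner_left] at *
    revert y
    change (⨆ μ, Module.End.eigenspace S.toLinearMap μ) ≤ (Submodule.span ℂ {x})ᗮ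
    refine iSup_le fun μ y hy => ?_
    rw [Submodule.mem_orthogonal_singleton_iff_inner_left]
    have h1 := (b μ).hasSum_repr ⟨y, hy⟩
    have h2 := (h1.mapL (Submodule.subtypeL _)).mapL (innerSL ℂ x)
    have h3 : (innerSL ℂ x) y = 0 := by
      refine h2.unique ?_
      convert hasSum_zero with i
      have : inner ℂ x (v ⟨μ, i⟩) = 0 := by
        rw [← inner_conj_symm, hx _ (Submodule.subset_span ⟨_, rfl⟩), map_zero]
      simp only [v] at this
      simp [this]
    rw [innerSL_apply_apply] at h3
    rw [← inner_conj_symm, h3, map_zero]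
  refine ⟨_, HilbertBasis.mkOfOrthogonalEqBot hv hsp, fun p => p.1, fun p => ?_⟩
  rw [HilbertBasis.coe_mkOfOrthogonalEqBot]
  exact Module.End.mem_eigenspace_iff.1 (b p.1 p.2).2

/-- An eigenbasis of `T* T` has orthogonal images under `T`. Their norms are the singular values,
and the basis vectors in the kernel of `T` are dropped. -/
theorem exists_singularValue_decomposition {T : E →L[ℂ] F} (hT : IsCompactOperator T) :
    ∃ (I : Type u) (σ : I → ℝ) (v : I → E) (u : I → F), (∀ i, 0 < σ i) ∧ Orthonormal ℂ v ∧
      Orthonormal ℂ u ∧ (∀ i, T (v i) = (σ i : ℂ) • u i) ∧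
      (∀ i, (ContinuousLinearMap.adjoint T) (u i) = (σ i : ℂ) • v i) ∧
      ∀ x y, HasSum (fun i => (σ i : ℂ) * (⟪v i, x⟫_ℂ * ⟪y, u i⟫_ℂ)) ⟪y, T x⟫_ℂ := by
  set A := ContinuousLinearMap.adjoint T
  have hS : IsCompactOperator (A ∘L T) := hT.clm_comp A
  have hsym : (A ∘L T).toLinearMap.IsSymmetric := fun x y => by
    simp [A, ContinuousLinearMap.adjoint_inner_left, ContinuousLinearMap.adjoint_inner_right]
  obtain ⟨I, B, μ, hB⟩ := exists_hilbertBasis_eigenvectors hS hsym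
  have hB' (i : I) : A (T (B i)) = μ i • B i := hB i
  have hin (i j : I) : ⟪T (B i), T (B j)⟫_ℂ = μ j * ⟪B i, B j⟫_ℂ := by
    rw [← ContinuousLinearMap.adjoint_inner_right, hB', inner_smul_right]
  have hμ (i : I) : μ i = ((‖T (B i)‖ ^ 2 : ℝ) : ℂ) := by
    have := hin i i
    rw [inner_self_eq_norm_sq_to_K, inner_self_eq_norm_sq_to_K, B.orthonormal.1 i] at this
    simpa using this.symm
  let J := {i : I // T (B i) ≠ 0}
  have hpos (i : J) : 0 < ‖T (B i)‖ := norm_pos_iff.2 i.2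
  have hne (i : J) : (‖T (B i)‖ : ℂ) ≠ 0 := by exact_mod_cast (hpos i).ne'
  refine ⟨J, fun i => ‖T (B i)‖, fun i => B i, fun i => (‖T (B i)‖ : ℂ)⁻¹ • T (B i), hpos,
    B.orthonormal.comp _ Subtype.val_injective, ?_, fun i => ?_, fun i => ?_, fun x y => ?_⟩
  · refine ⟨fun i => ?_, fun i j hij => ?_⟩
    · rw [norm_smul, norm_inv, Complex.norm_real, norm_norm, inv_mul_cancel₀ (hpos i).ne']
    · beta_reduce
      rw [inner_smul_left, inner_smul_right, hin,
        B.orthonormal.2 fun h => hij (Subtype.ext h)]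
      simp
  · rw [smul_inv_smul₀ (hne i)]
  · rw [map_smul, hB', hμ, smul_smul]
    congr 1
    push_cast
    field_simp
  · have h1 := ((B.hasSum_repr x).mapL T).mapL (innerSL ℂ y)
    have h2 : HasSum (fun i => ⟪B i, x⟫_ℂ * ⟪y, T (B i)⟫_ℂ) ⟪y, T x⟫_ℂ := by
      refine h1.congr_fun fun i => ?_
      simp [B.repr_apply_apply]
    have h3 := (hasSum_subtype_iff_of_support_subset (s := {i | T (B i) ≠ 0}) fun i hi => by
      simp only [Function.mem_support, Set.mem_ofPred_eq] at hi ⊢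
      intro h
      simp [h] at hi).2 h2
    refine h3.congr_fun fun i => ?_
    have := hne i
    simp only [Function.comp, inner_smul_right]
    field_simp

/-- Order `J` by decreasing `g`, ties broken by an injection into `ℕ`. Each element has finitely
many predecessors, their number determines the element, and the infinite set of these numbers is
order isomorphic to `ℕ`. -/
theorem exists_antitone_enumeration {J : Type*} [Countable J] [Infinite J] (g : J → ℝ)
    (hg : ∀ i, {j | g i ≤ g j}.Finite) : ∃ e : ℕ ≃ J, Antitone (g ∘ e) := by
  obtain ⟨enc, henc⟩ := exists_injective_nat J
  let P : J → Set J := fun i => {j | g i < g j ∨ (g i = g j ∧ enc j < enc i)}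
  have hP (i : J) : (P i).Finite := (hg i).subset fun j hj => by
    rcases hj with h | h
    · exact h.le
    · exact h.1.le
  have hlt {i j : J} (h : j ∈ P i) : (P j).ncard < (P i).ncard := by
    refine Set.ncard_lt_ncard ⟨fun k hk => ?_, fun hsub => ?_⟩ (hP i)
    · rcases h with h | h <;> rcases hk with hk | hk
      · exact Or.inl (h.trans hk)
      · exact Or.inl (h.trans_eq hk.1)
      · exact Or.inl (h.1.trans_lt hk)
      · exact Or.inr ⟨h.1.trans hk.1, hk.2.trans h.2⟩
    · rcases hsub h with h | h
      · exact lt_irrefl _ h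
      · exact lt_irrefl _ h.2
  have hinj : Function.Injective fun i => (P i).ncard := fun i j hij => by
    by_contra hne
    rcases lt_trichotomy (g i) (g j) with h | h | h
    · exact (hlt (Or.inl h : j ∈ P i)).ne' hij
    · rcases lt_or_gt_of_ne (henc.ne hne) with h' | h'
      · exact (hlt (Or.inr ⟨h.symm, h'⟩ : i ∈ P j)).ne hij
      · exact (hlt (Or.inr ⟨h, h'⟩ : j ∈ P i)).ne' hij
    · exact (hlt (Or.inl h : i ∈ P j)).ne hij
  have hinf : Infinite (Set.range fun i => (P i).ncard) :=
    (Set.infinite_range_of_injective hinj).to_subtype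
  classical
  let o := Nat.Subtype.orderIsoOfNat (Set.range fun i => (P i).ncard)
  let f := Equiv.ofInjective _ hinj
  refine ⟨o.toEquiv.trans f.symm, fun m n hmn => ?_⟩
  have hval (k : ℕ) : (P (f.symm (o k))).ncard = (o k : ℕ) :=
    congrArg Subtype.val (f.apply_symm_apply (o k))
  by_contra! h
  have h1 := hlt (Or.inl h : f.symm (o n) ∈ P (f.symm (o m)))
  rw [hval, hval] at h1
  exact absurd (o.monotone hmn) (not_le.2 h1)

variable {A B : Type*}

/-- Dimension count: the span of `G.card + 1` unit vectors contains a nonzero solution of `G.card`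
linear equations. -/
theorem exists_finitelySupported_orthogonal [Infinite A]
    (G : Finset (lp (fun _ : A => ℂ) 2)) :
    ∃ x : lp (fun _ : A => ℂ) 2, (∃ t : Finset A, ∀ a ∉ t, x a = 0) ∧ ‖x‖ = 1 ∧
      ∀ g ∈ G, ⟪g, x⟫_ℂ = 0 := by
  classical
  obtain ⟨t, ht⟩ := Infinite.exists_subset_card_eq A (G.card + 1)
  let L : (t → ℂ) →ₗ[ℂ] lp (fun _ : A => ℂ) 2 :=
    Fintype.linearCombination ℂ fun a : t => lp.single 2 (a : A) (1 : ℂ)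
  have hL (c : t → ℂ) (a : A) : L c a = if h : a ∈ t then c ⟨a, h⟩ else 0 := by
    rw [Fintype.linearCombination_apply, lp.coeFn_sum, Finset.sum_apply]
    split_ifs with h
    · rw [Finset.sum_eq_single ⟨a, h⟩]
      · simp [lp.single_apply]
      · intro b _ hb
        have : a ≠ b := fun hab => hb (Subtype.ext hab.symm)
        simp [lp.single_apply, this]
      · simp
    · refine Finset.sum_eq_zero fun b _ => ?_
      have : a ≠ b := fun hab => h (hab ▸ b.2)
      simp [lp.single_apply, this]
  let f : (t → ℂ) →ₗ[ℂ] (G → ℂ) :=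
    LinearMap.pi fun g => (innerSL ℂ (g : lp (fun _ : A => ℂ) 2)).toLinearMap ∘ₗ L
  have hker : LinearMap.ker f ≠ ⊥ := LinearMap.ker_ne_bot_of_finrank_lt (by simp [ht])
  obtain ⟨c, hc, hc0⟩ := Submodule.exists_mem_ne_zero_of_ne_bot hker
  have hx0 : L c ≠ 0 := fun h => by
    obtain ⟨a, ha⟩ := Function.ne_iff.1 hc0
    have := hL c a
    rw [h] at this
    simp at this
    exact ha this.symm
  refine ⟨(‖L c‖ : ℂ)⁻¹ • L c, ⟨t, fun a ha => ?_⟩, norm_smul_inv_norm hx0, fun g hg => ?_⟩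
  · rw [lp.coeFn_smul, Pi.smul_apply, hL, dif_neg ha, smul_zero]
  · have := congrFun (LinearMap.mem_ker.1 hc) ⟨g, hg⟩
    simp only [f, LinearMap.pi_apply, LinearMap.comp_apply, ContinuousLinearMap.coe_coe,
      innerSL_apply_apply, Pi.zero_apply] at this
    rw [inner_smul_right, this, mul_zero]

/-- A finite orthonormal family in `ℓ²` extends by finitely supported vectors to an infinite one. -/
theorem exists_orthonormal_extension [Infinite A] {I : Type*} [Finite I]
    {v : I → lp (fun _ : A => ℂ) 2} (hv : Orthonormal ℂ v) :
    ∃ w : ℕ → lp (fun _ : A => ℂ) 2, (∀ n, ∃ t : Finset A, ∀ a ∉ t, w n a = 0) ∧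
      Orthonormal ℂ (Sum.elim v w) := by
  classical
  have hfin := Set.finite_range v
  obtain ⟨w, hw, hww⟩ := exists_seq_of_forall_finset_exists
    (fun y : lp (fun _ : A => ℂ) 2 => (∃ t : Finset A, ∀ a ∉ t, y a = 0) ∧ ‖y‖ = 1 ∧
      ∀ i, ⟪v i, y⟫_ℂ = 0) (fun x y => ⟪x, y⟫_ℂ = 0) fun S _ => by
    obtain ⟨y, h1, h2, h3⟩ := exists_finitelySupported_orthogonal (hfin.toFinset ∪ S)
    exact ⟨y, ⟨h1, h2, fun i => h3 _ (by simp)⟩, fun x hx => h3 _ (by simp [hx])⟩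
  refine ⟨w, fun n => (hw n).1, ?_, ?_⟩
  · rintro (i | n)
    · exact hv.1 i
    · exact (hw n).2.1
  · rintro (i | n) (j | m) hij
    · exact hv.2 fun h => hij (h ▸ rfl)
    · exact (hw m).2.2 i
    · exact inner_eq_zero_symm.1 ((hw n).2.2 j)
    · rcases lt_or_gt_of_ne fun h => hij (congrArg Sum.inr h) with h | h
      · exact hww _ _ h
      · exact inner_eq_zero_symm.1 (hww _ _ h)

set_option maxHeartbeats 1000000 in
-- By the tail hypothesis only finitely many singular values exceed a given positive number, so they
-- can be listed in decreasing order. In the finite rank case the list is continued by zeros with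
-- finitely supported vectors, which will later tolerate any decay requirement.
theorem exists_singularValue_sequence [Infinite A] [Infinite B]
    {T : lp (fun _ : A => ℂ) 2 →L[ℂ] lp (fun _ : B => ℂ) 2} (hT : IsCompactOperator T)
    (htail : ∀ ε > 0, ∃ s : Finset A, ∀ x : lp (fun _ : A => ℂ) 2, (∀ a ∈ s, x a = 0) →
      ‖T x‖ ≤ ε * ‖x‖) :
    ∃ (σ : ℕ → ℝ) (v : ℕ → lp (fun _ : A => ℂ) 2) (u : ℕ → lp (fun _ : B => ℂ) 2),
      Antitone σ ∧ (∀ j, 0 ≤ σ j) ∧ Orthonormal ℂ v ∧ Orthonormal ℂ u ∧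
      (∀ j, T (v j) = (σ j : ℂ) • u j) ∧
      (∀ j, (ContinuousLinearMap.adjoint T) (u j) = (σ j : ℂ) • v j) ∧
      (∀ j, σ j = 0 → (∃ t : Finset A, ∀ a ∉ t, v j a = 0) ∧ ∃ t : Finset B, ∀ b ∉ t, u j b = 0) ∧
      ∀ x y, HasSum (fun j => (σ j : ℂ) * (⟪v j, x⟫_ℂ * ⟪y, u j⟫_ℂ)) ⟪y, T x⟫_ℂ := by
  classical
  obtain ⟨I, σ, v, u, hσ, hv, hu, hTv, hTu, hsum⟩ := exists_singularValue_decomposition hT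
  have hlevel (ε : ℝ) (hε : 0 < ε) : {i | ε ≤ σ i}.Finite := by
    obtain ⟨s, hs⟩ := htail (ε / 2) (half_pos hε)
    by_contra hinf
    obtain ⟨J, hJ, hJc⟩ := Set.Infinite.exists_subset_card_eq hinf (s.card + 1)
    have := card_le_of_norm_le hv hu hTv (fun a => innerSL ℂ (lp.single 2 a (1 : ℂ))) s
      (half_pos hε).le (fun x hx => hs x fun a ha => by
        have := hx a ha
        rw [innerSL_apply_apply, lp.inner_single_left] at this
        simpa using this) J fun i hi => (half_lt_self hε).trans_le (hJ hi)
    lia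
  have hcount : Countable I := by
    have : (Set.univ : Set I) = ⋃ n : ℕ, {i | 1 / ((n : ℝ) + 1) ≤ σ i} := by
      ext i
      obtain ⟨n, hn⟩ := exists_nat_one_div_lt (hσ i)
      simpa using ⟨n, by simpa using hn.le⟩
    rw [← Set.countable_univ_iff, this]
    exact Set.countable_iUnion fun n => (hlevel _ (by positivity)).countable
  -- The singular value is the positive part of `g`. Padding indices get the values `-n`, so that
  -- superlevel sets remain finite and the padding comes after the genuine singular values.
  suffices h : ∃ (J : Type _) (_ : Countable J) (_ : Infinite J) (g : J → ℝ)
      (v : J → lp (fun _ : A => ℂ) 2) (u : J → lp (fun _ : B => ℂ) 2),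
      (∀ i, {j | g i ≤ g j}.Finite) ∧ Orthonormal ℂ v ∧ Orthonormal ℂ u ∧
      (∀ j, T (v j) = ((max (g j) 0 : ℝ) : ℂ) • u j) ∧
      (∀ j, (ContinuousLinearMap.adjoint T) (u j) = ((max (g j) 0 : ℝ) : ℂ) • v j) ∧
      (∀ j, g j ≤ 0 → (∃ t : Finset A, ∀ a ∉ t, v j a = 0) ∧ ∃ t : Finset B, ∀ b ∉ t, u j b = 0) ∧
      ∀ x y, HasSum (fun j => ((max (g j) 0 : ℝ) : ℂ) * (⟪v j, x⟫_ℂ * ⟪y, u j⟫_ℂ)) ⟪y, T x⟫_ℂ by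
    obtain ⟨J, _, _, g, v, u, hg, hv, hu, hTv, hTu, hsupp, hsum⟩ := h
    obtain ⟨e, he⟩ := exists_antitone_enumeration g hg
    refine ⟨fun j => max (g (e j)) 0, v ∘ e, u ∘ e, fun m n hmn => max_le_max_right _ (he hmn),
      fun j => le_max_right _ _, hv.comp _ e.injective, hu.comp _ e.injective, fun j => hTv _,
      fun j => hTu _, fun j hj => hsupp _ (by simpa using hj), fun x y => ?_⟩
    exact (e.hasSum_iff).2 (hsum x y)
  have hmax (i : I) : max (σ i) 0 = σ i := max_eq_left (hσ i).le
  rcases finite_or_infinite I with hI | hI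
  · obtain ⟨v', hv's, hv'⟩ := exists_orthonormal_extension hv
    obtain ⟨u', hu's, hu'⟩ := exists_orthonormal_extension hu
    have hTv' (n : ℕ) : T (v' n) = 0 := by
      rw [← inner_self_eq_zero (𝕜 := ℂ)]
      refine (hsum (v' n) (T (v' n))).unique ?_
      refine hasSum_zero.congr_fun fun i => ?_
      have : ⟪v i, v' n⟫_ℂ = 0 := hv'.2 (i := Sum.inl i) (j := Sum.inr n) (by simp)
      rw [this, zero_mul, mul_zero]
    have hTu' (n : ℕ) : (ContinuousLinearMap.adjoint T) (u' n) = 0 := by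
      rw [← inner_self_eq_zero (𝕜 := ℂ), ContinuousLinearMap.adjoint_inner_left]
      refine (hsum _ (u' n)).unique ?_
      refine hasSum_zero.congr_fun fun i => ?_
      have : ⟪u' n, u i⟫_ℂ = 0 := hu'.2 (i := Sum.inr n) (j := Sum.inl i) (by simp)
      rw [this, mul_zero, mul_zero]
    have hneg (n : ℕ) : max (-(n : ℝ)) 0 = 0 := max_eq_right (by simp)
    refine ⟨I ⊕ ℕ, inferInstance, inferInstance, Sum.elim σ fun n => -(n : ℝ), Sum.elim v v',
      Sum.elim u u', fun i => ?_, hv', hu', ?_, ?_, ?_, fun x y => ?_⟩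
    · obtain ⟨N, hN⟩ := exists_nat_gt (-Sum.elim σ (fun n : ℕ => -(n : ℝ)) i)
      refine ((Set.finite_range (Sum.inl : I → I ⊕ ℕ)).union
        ((Set.finite_Iio N).image Sum.inr)).subset ?_
      rintro (j | n) hj
      · exact Or.inl ⟨j, rfl⟩
      · refine Or.inr ⟨n, ?_, rfl⟩
        simp only [Set.mem_ofPred_eq, Sum.elim_inr] at hj
        have : (n : ℝ) < N := by linarith
        exact_mod_cast this
    · rintro (i | n)
      · simpa [hmax] using hTv i
      · simp [hTv']
    · rintro (i | n)
      · simpa [hmax] using hTu i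
      · simp [hTu']
    · rintro (i | n) h
      · exact absurd h (not_le.2 (hσ i))
      · exact ⟨hv's n, hu's n⟩
    · refine (Function.Injective.hasSum_iff (Sum.inl_injective (α := I) (β := ℕ)) ?_).1
        ((hsum x y).congr_fun fun i => by simp [hmax])
      rintro (i | n) h
      · exact absurd ⟨i, rfl⟩ h
      · simp
  · refine ⟨I, hcount, hI, σ, v, u, fun i => hlevel _ (hσ i), hv, hu, ?_, ?_,
      fun i h => absurd h (not_le.2 (hσ i)), ?_⟩
    · simpa [hmax] using hTv
    · simpa [hmax] using hTu
    · simpa [hmax] using hsum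

end SingularValues

end Pilipovic
end

noncomputable section
namespace Pilipovic

/-! ### Operators on `ℓ²` with absolutely summable matrices -/

section MatrixOperator

open scoped InnerProductSpace InnerProduct

variable {A B : Type*}

/-- The `a`-th unit vector of `ℓ²`. -/
def unitVec (a : A) : lp (fun _ : A => ℂ) 2 :=
  haveI := Classical.decEq A
  lp.single 2 a (1 : ℂ)

theorem inner_unitVec_left (a : A) (x : lp (fun _ : A => ℂ) 2) : ⟪unitVec a, x⟫_ℂ = x a := by
  classical
  rw [unitVec, lp.inner_single_left]
  simp

theorem inner_unitVec_right (a : A) (x : lp (fun _ : A => ℂ) 2) :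
    ⟪x, unitVec a⟫_ℂ = starRingEnd ℂ (x a) := by
  rw [← inner_conj_symm, inner_unitVec_left]

theorem unitVec_apply_self (a : A) : (unitVec a : lp (fun _ : A => ℂ) 2) a = 1 := by
  classical exact lp.single_apply_self ..

theorem unitVec_apply_ne {a b : A} (h : b ≠ a) : (unitVec a : lp (fun _ : A => ℂ) 2) b = 0 := by
  classical exact lp.single_apply_ne _ _ _ h

theorem norm_unitVec (a : A) : ‖(unitVec a : lp (fun _ : A => ℂ) 2)‖ = 1 := by
  classical exact (lp.norm_single two_pos _ _).trans norm_one

/-- The operator on `ℓ²` with a matrix of absolutely summable entries. -/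
def matrixOp (c : B × A → ℂ) : lp (fun _ : A => ℂ) 2 →L[ℂ] lp (fun _ : B => ℂ) 2 :=
  ∑' q, c q • InnerProductSpace.rankOne ℂ (unitVec q.1) (unitVec q.2)

variable {c : B × A → ℂ}

theorem hasSum_matrixOp (hc : Summable fun q => ‖c q‖) :
    HasSum (fun q => c q • InnerProductSpace.rankOne ℂ
      (unitVec q.1 : lp (fun _ : B => ℂ) 2) (unitVec q.2 : lp (fun _ : A => ℂ) 2))
      (matrixOp c) := by
  refine (Summable.of_norm_bounded hc fun q => ?_).hasSum
  rw [norm_smul, InnerProductSpace.norm_rankOne, norm_unitVec, norm_unitVec]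
  simp

theorem hasSum_matrixOp_apply (hc : Summable fun q => ‖c q‖) (x : lp (fun _ : A => ℂ) 2) :
    HasSum (fun q => (c q * x q.2) • (unitVec q.1 : lp (fun _ : B => ℂ) 2)) (matrixOp c x) := by
  refine ((hasSum_matrixOp hc).mapL (ContinuousLinearMap.apply ℂ _ x)).congr_fun fun q => ?_
  simp [inner_unitVec_left, smul_smul]

/-- The defining series converges in operator norm, so the operator is a limit of finite rank
operators. -/
theorem isCompactOperator_matrixOp (hc : Summable fun q => ‖c q‖) :
    IsCompactOperator (matrixOp c) := by
  refine isCompactOperator_of_tendsto (hasSum_matrixOp hc) (Filter.Eventually.of_forall fun s => ?_)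
  have hmem : ∑ q ∈ s, c q • InnerProductSpace.rankOne ℂ (unitVec q.1 : lp (fun _ : B => ℂ) 2)
      (unitVec q.2 : lp (fun _ : A => ℂ) 2) ∈ compactOperator (RingHom.id ℂ)
        (lp (fun _ : A => ℂ) 2) (lp (fun _ : B => ℂ) 2) := by
    refine Submodule.sum_mem _ fun q _ => Submodule.smul_mem _ _ ?_
    have h := isCompactOperator_of_locallyCompactSpace_dom
      (innerSL ℂ (unitVec q.2 : lp (fun _ : A => ℂ) 2))
    exact h.clm_comp (ContinuousLinearMap.toSpanSingleton ℂ (unitVec q.1 : lp (fun _ : B => ℂ) 2))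
  exact hmem

theorem inner_matrixOp (hc : Summable fun q => ‖c q‖) (a : A) (b : B) :
    ⟪unitVec b, matrixOp c (unitVec a)⟫_ℂ = c (b, a) := by
  have h := (hasSum_matrixOp_apply hc (unitVec a)).mapL (innerSL ℂ (unitVec b))
  rw [innerSL_apply_apply] at h
  refine h.unique ?_
  convert hasSum_single (b, a) fun q hq => ?_
  · simp [unitVec_apply_self, norm_unitVec]
  · rw [innerSL_apply_apply, inner_smul_right, inner_unitVec_left]
    by_cases h2 : q.2 = a
    · have h1 : b ≠ q.1 := fun h1 => hq (Prod.ext h1.symm h2)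
      rw [unitVec_apply_ne h1, mul_zero]
    · rw [unitVec_apply_ne h2, mul_zero, zero_mul]

/-- The adjoint is again of this form, so each estimate below also holds with the two index sets
interchanged. -/
theorem adjoint_matrixOp (hc : Summable fun q => ‖c q‖) :
    ContinuousLinearMap.adjoint (matrixOp c) =
      matrixOp fun q : A × B => starRingEnd ℂ (c q.swap) := by
  have h1 := (hasSum_matrixOp hc).map
    (ContinuousLinearMap.adjoint (𝕜 := ℂ) (E := lp (fun _ : A => ℂ) 2) (F := lp (fun _ : B => ℂ) 2))
    (ContinuousLinearMap.adjoint).continuous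
  have hc' : Summable fun q : A × B => ‖starRingEnd ℂ (c q.swap)‖ := by
    simpa [Function.comp_def] using (Equiv.prodComm A B).summable_iff.2 hc
  refine h1.unique ((Equiv.prodComm A B).hasSum_iff.1 ((hasSum_matrixOp hc').congr_fun fun q => ?_))
  simp [map_smulₛₗ]

theorem norm_matrixOp_apply_le {w₁ : A → ℝ} {w₂ : B → ℝ} {C : ℝ} (hw₁ : Summable w₁)
    (hw₂ : Summable w₂) (h₁ : ∀ a, 0 ≤ w₁ a) (h₂ : ∀ b, 0 ≤ w₂ b)
    (hcw : ∀ q, ‖c q‖ ≤ C * (w₂ q.1 * w₁ q.2)) (x : lp (fun _ : A => ℂ) 2) :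
    ‖matrixOp c x‖ ≤ C * (∑' b, w₂ b) * ∑' a, w₁ a * ‖x a‖ := by
  have hc : Summable fun q => ‖c q‖ := Summable.of_nonneg_of_le (fun _ => norm_nonneg _) hcw
    ((hw₂.mul_of_nonneg hw₁ h₂ h₁).mul_left C)
  have hx : Summable fun a => w₁ a * ‖x a‖ := Summable.of_nonneg_of_le
    (fun a => mul_nonneg (h₁ a) (norm_nonneg _))
    (fun a => mul_le_mul_of_nonneg_left (lp.norm_apply_le_norm two_ne_zero x a) (h₁ a))
    (hw₁.mul_right _)
  have hx0 (a : A) : 0 ≤ w₁ a * ‖x a‖ := mul_nonneg (h₁ a) (norm_nonneg _)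
  have hS := (hw₂.hasSum.mul hx.hasSum (hw₂.mul_of_nonneg hx h₂ hx0)).mul_left C
  rw [mul_assoc]
  refine tsum_of_norm_bounded (f := fun q => (c q * x q.2) • (unitVec q.1 : lp (fun _ : B => ℂ) 2))
    hS (fun q => ?_) |>.trans_eq' ?_
  · rw [norm_smul, norm_unitVec, mul_one, norm_mul]
    refine (mul_le_mul_of_nonneg_right (hcw q) (norm_nonneg _)).trans_eq ?_
    ring
  · rw [(hasSum_matrixOp_apply hc x).tsum_eq]

end MatrixOperator

end Pilipovic
end

noncomputable section
namespace Pilipovic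

/-! ### Decay of singular values and singular vectors -/

section Decay

variable {ι κ : Type*} [Fintype ι] [Fintype κ] {s ρ : ℝ}

theorem summable_exp_neg_len (hs : 0 < s) (hρ : 0 < ρ) :
    Summable fun α : ι → ℕ => Real.exp (-ρ * len α ^ (1 / (2 * s))) := by
  simpa using summable_pow_mul_exp_neg_len (ι := ι) hρ (show 0 < 1 / (2 * s) by positivity) 0

/-- Outside the box some coordinate, hence `|α|`, is at least `n`: half of the exponent gives the
small factor, the other half the summability. -/
theorem tsum_exp_mul_norm_le (hs : 0 < s) (hρ : 0 < ρ) (n : ℕ)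
    (x : lp (fun _ : ι → ℕ => ℂ) 2)
    (hx : ∀ α : ι → ℕ, (∀ i, α i < n) → x α = 0) :
    ∑' α : ι → ℕ, Real.exp (-ρ * len α ^ (1 / (2 * s))) * ‖x α‖ ≤
      Real.exp (-(ρ / 2) * (n : ℝ) ^ (1 / (2 * s))) *
        (∑' α : ι → ℕ, Real.exp (-(ρ / 2) * len α ^ (1 / (2 * s)))) * ‖x‖ := by
  have hS := ((summable_exp_neg_len (ι := ι) hs (half_pos hρ)).mul_left
    (Real.exp (-(ρ / 2) * (n : ℝ) ^ (1 / (2 * s))))).mul_right ‖x‖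
  rw [← tsum_mul_left, ← tsum_mul_right]
  have hle (α : ι → ℕ) : Real.exp (-ρ * len α ^ (1 / (2 * s))) * ‖x α‖ ≤
      Real.exp (-(ρ / 2) * (n : ℝ) ^ (1 / (2 * s))) *
        Real.exp (-(ρ / 2) * len α ^ (1 / (2 * s))) * ‖x‖ := by
    by_cases h : ∀ i, α i < n
    · rw [hx α h, norm_zero, mul_zero]
      positivity
    · push Not at h
      obtain ⟨i, hi⟩ := h
      have h1 : (n : ℝ) ^ (1 / (2 * s)) ≤ len α ^ (1 / (2 * s)) := by
        refine Real.rpow_le_rpow (by positivity) ?_ (by positivity)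
        exact (Nat.cast_le.2 hi).trans (coord_le_len α i)
      rw [← Real.exp_add]
      gcongr
      · nlinarith
      · exact lp.norm_apply_le_norm two_ne_zero x α
  exact Summable.tsum_le_tsum hle (Summable.of_nonneg_of_le (fun α => by positivity) hle hS) hS

theorem exists_pow_le_lt (d : ℕ) (hd : 0 < d) (j : ℕ) : ∃ n : ℕ, n ^ d ≤ j ∧ j < (n + 1) ^ d := by
  have hex : ∃ n : ℕ, j < (n + 1) ^ d :=
    ⟨j, (Nat.lt_succ_self j).trans_le (Nat.le_self_pow hd.ne' _)⟩
  classical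
  refine ⟨Nat.find hex, ?_, Nat.find_spec hex⟩
  rcases h : Nat.find hex with _ | m
  · simp [hd.ne']
  · exact not_lt.1 (Nat.find_min hex (h ▸ Nat.lt_succ_self m))

/-- The easy half of the min-max principle: the first `j + 1` singular values would all exceed `ε`,
against only `t.card ≤ j` coordinate functionals. -/
theorem singularValue_le {A B : Type*}
    {T : lp (fun _ : A => ℂ) 2 →L[ℂ] lp (fun _ : B => ℂ) 2} {σ : ℕ → ℝ}
    {v : ℕ → lp (fun _ : A => ℂ) 2} {u : ℕ → lp (fun _ : B => ℂ) 2} (hσ : Antitone σ)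
    (hv : Orthonormal ℂ v) (hu : Orthonormal ℂ u) (hTv : ∀ j, T (v j) = (σ j : ℂ) • u j)
    (t : Finset A) {ε : ℝ} (hε : 0 ≤ ε)
    (hT : ∀ x : lp (fun _ : A => ℂ) 2, (∀ a ∈ t, x a = 0) → ‖T x‖ ≤ ε * ‖x‖) {j : ℕ}
    (hj : t.card ≤ j) : σ j ≤ ε := by
  by_contra! h
  have := card_le_of_norm_le hv hu hTv (fun a => innerSL ℂ (unitVec a)) t hε
    (fun x hx => hT x fun a ha => by
      have := hx a ha
      rwa [innerSL_apply_apply, inner_unitVec_left] at this) (Finset.range (j + 1))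
    fun i hi => h.trans_le (hσ (Nat.lt_succ_iff.1 (Finset.mem_range.1 hi)))
  rw [Finset.card_range] at this
  lia

variable {c : (κ → ℕ) × (ι → ℕ) → ℂ} {C : ℝ}

theorem norm_matrixOp_apply_le_of_box (hs : 0 < s) (hρ : 0 < ρ) (hC : 0 ≤ C)
    (hc : ∀ q, ‖c q‖ ≤ C * (Real.exp (-ρ * len q.1 ^ (1 / (2 * s))) *
      Real.exp (-ρ * len q.2 ^ (1 / (2 * s))))) (n : ℕ) (x : lp (fun _ : ι → ℕ => ℂ) 2)
    (hx : ∀ α : ι → ℕ, (∀ i, α i < n) → x α = 0) :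
    ‖matrixOp c x‖ ≤ C * (∑' α : κ → ℕ, Real.exp (-ρ * len α ^ (1 / (2 * s)))) *
      (∑' α : ι → ℕ, Real.exp (-(ρ / 2) * len α ^ (1 / (2 * s)))) *
        Real.exp (-(ρ / 2) * (n : ℝ) ^ (1 / (2 * s))) * ‖x‖ := by
  have h := norm_matrixOp_apply_le (summable_exp_neg_len hs hρ) (summable_exp_neg_len hs hρ)
    (fun a => (Real.exp_pos _).le) (fun b => (Real.exp_pos _).le) hc x
  refine h.trans ((mul_le_mul_of_nonneg_left (tsum_exp_mul_norm_le hs hρ n x hx) ?_).trans_eq ?_)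
  · exact mul_nonneg hC (tsum_nonneg fun b => (Real.exp_pos _).le)
  · ring

/-- The box of side `n` has `n ^ Fintype.card ι` points, and `n` is taken maximal with this number
at most `j`. Passing from `n` to `n + 1` through `(n + 1)^a ≤ 2^a (n^a + 1)` costs `2^a` in the rate
and `exp(ρ/2)` in the constant. -/
theorem exists_singularValue_le (hι : 0 < Fintype.card ι) (hs : 0 < s) (hρ : 0 < ρ) (hC : 0 ≤ C)
    (hc : ∀ q, ‖c q‖ ≤ C * (Real.exp (-ρ * len q.1 ^ (1 / (2 * s))) *
      Real.exp (-ρ * len q.2 ^ (1 / (2 * s)))))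
    {σ : ℕ → ℝ} {v : ℕ → lp (fun _ : ι → ℕ => ℂ) 2} {u : ℕ → lp (fun _ : κ → ℕ => ℂ) 2}
    (hσ : Antitone σ) (hv : Orthonormal ℂ v) (hu : Orthonormal ℂ u)
    (hTv : ∀ j, matrixOp c (v j) = (σ j : ℂ) • u j) :
    ∃ D : ℝ, 0 ≤ D ∧
      ∀ j, σ j ≤ D / expWeight (Fintype.card ι) s (ρ / 2 / 2 ^ (1 / (2 * s))) j := by
  classical
  set a := 1 / (2 * s) with ha
  have ha0 : 0 < a := by positivity
  set W := C * (∑' α : κ → ℕ, Real.exp (-ρ * len α ^ a)) *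
      (∑' α : ι → ℕ, Real.exp (-(ρ / 2) * len α ^ a)) with hW
  have hW0 : 0 ≤ W := mul_nonneg (mul_nonneg hC (tsum_nonneg fun b => (Real.exp_pos _).le))
    (tsum_nonneg fun b => (Real.exp_pos _).le)
  refine ⟨W * Real.exp (ρ / 2), by positivity, fun j => ?_⟩
  obtain ⟨n, hn, hn'⟩ := exists_pow_le_lt (Fintype.card ι) hι j
  have h1 := singularValue_le hσ hv hu hTv (Fintype.piFinset fun _ : ι => Finset.range n)
    (ε := W * Real.exp (-(ρ / 2) * (n : ℝ) ^ a)) (by positivity)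
    (fun x hx => norm_matrixOp_apply_le_of_box hs hρ hC hc n x fun α hα =>
      hx α (by simpa using hα)) (j := j) (by simpa using hn)
  refine h1.trans ?_
  rw [expWeight, mul_div_assoc, ← Real.exp_sub]
  refine mul_le_mul_of_nonneg_left (Real.exp_le_exp.2 ?_) hW0
  have h2 : ((j : ℝ) + 1) ^ (1 / (2 * Fintype.card ι * s)) ≤ ((n : ℝ) + 1) ^ a := by
    have hd : (0 : ℝ) < Fintype.card ι := by exact_mod_cast hι
    have : ((n : ℝ) + 1) ^ a =
        (((n : ℝ) + 1) ^ Fintype.card ι) ^ (1 / (2 * Fintype.card ι * s)) := by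
      rw [← Real.rpow_natCast, ← Real.rpow_mul (by positivity)]
      congr 1
      rw [ha]
      field_simp
    rw [this]
    refine Real.rpow_le_rpow (by positivity) ?_ (by positivity)
    exact_mod_cast hn'
  have h3 : ((n : ℝ) + 1) ^ a ≤ 2 ^ a * ((n : ℝ) ^ a + 1 ^ a) :=
    rpow_add_le_mul (by positivity) zero_le_one ha0
  rw [Real.one_rpow] at h3
  have h4 : ((j : ℝ) + 1) ^ (1 / (2 * Fintype.card ι * s)) / 2 ^ a ≤ (n : ℝ) ^ a + 1 := by
    rw [div_le_iff₀ (by positivity)]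
    linarith
  have h5 : ρ / 2 / 2 ^ a * ((j : ℝ) + 1) ^ (1 / (2 * Fintype.card ι * s)) =
      ρ / 2 * (((j : ℝ) + 1) ^ (1 / (2 * Fintype.card ι * s)) / 2 ^ a) := by ring
  rw [h5]
  nlinarith

theorem exists_finset_norm_matrixOp_le (hs : 0 < s) (hρ : 0 < ρ) (hC : 0 ≤ C)
    (hc : ∀ q, ‖c q‖ ≤ C * (Real.exp (-ρ * len q.1 ^ (1 / (2 * s))) *
      Real.exp (-ρ * len q.2 ^ (1 / (2 * s))))) {ε : ℝ} (hε : 0 < ε) :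
    ∃ t : Finset (ι → ℕ), ∀ x : lp (fun _ : ι → ℕ => ℂ) 2, (∀ α ∈ t, x α = 0) →
      ‖matrixOp c x‖ ≤ ε * ‖x‖ := by
  classical
  set W := C * (∑' α : κ → ℕ, Real.exp (-ρ * len α ^ (1 / (2 * s)))) *
      (∑' α : ι → ℕ, Real.exp (-(ρ / 2) * len α ^ (1 / (2 * s))))
  have hlim : Filter.Tendsto (fun n : ℕ => W * Real.exp (-(ρ / 2) * (n : ℝ) ^ (1 / (2 * s))))
      Filter.atTop (nhds (W * 0)) := by
    refine (Real.tendsto_exp_atBot.comp (Filter.Tendsto.const_mul_atTop_of_neg (by linarith)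
      ((tendsto_rpow_atTop ?_).comp tendsto_natCast_atTop_atTop))).const_mul W
    positivity
  rw [mul_zero] at hlim
  obtain ⟨n, hn⟩ := (hlim.eventually_le_const hε).exists
  refine ⟨Fintype.piFinset fun _ : ι => Finset.range n, fun x hx => ?_⟩
  exact (norm_matrixOp_apply_le_of_box hs hρ hC hc n x fun α hα => hx α (by simpa using hα)).trans
    (mul_le_mul_of_nonneg_right hn (norm_nonneg _))

/-- The components of the right singular vectors, weighted by the singular value. -/
theorem exists_singularVector_le (hs : 0 < s) (hρ : 0 < ρ) (hC : 0 ≤ C)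
    (hc : ∀ q, ‖c q‖ ≤ C * (Real.exp (-ρ * len q.1 ^ (1 / (2 * s))) *
      Real.exp (-ρ * len q.2 ^ (1 / (2 * s)))))
    {σ : ℕ → ℝ} {v : ℕ → lp (fun _ : ι → ℕ => ℂ) 2} {u : ℕ → lp (fun _ : κ → ℕ => ℂ) 2}
    (hσ : ∀ j, 0 ≤ σ j) (hu : Orthonormal ℂ u)
    (hTu : ∀ j, ContinuousLinearMap.adjoint (matrixOp c) (u j) = (σ j : ℂ) • v j) :
    ∃ D : ℝ, 0 ≤ D ∧ ∀ j β, σ j * ‖v j β‖ ≤ D * Real.exp (-ρ * len β ^ (1 / (2 * s))) := by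
  set w := ∑' α : κ → ℕ, Real.exp (-ρ * len α ^ (1 / (2 * s)))
  refine ⟨C * w, mul_nonneg hC (tsum_nonneg fun b => (Real.exp_pos _).le), fun j β => ?_⟩
  -- The component is paired with a unit vector `u j`, so it is at most the norm of the column `T
  -- e_β` of the matrix.
  have h1 : ((σ j : ℂ) • v j) β = starRingEnd ℂ (inner ℂ (u j) (matrixOp c (unitVec β))) := by
    rw [← hTu, ← inner_unitVec_left, ContinuousLinearMap.adjoint_inner_right, inner_conj_symm]
  have h2 : σ j * ‖v j β‖ ≤ ‖matrixOp c (unitVec β)‖ := by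
    have h3 : σ j * ‖v j β‖ = ‖((σ j : ℂ) • v j) β‖ := by
      rw [lp.coeFn_smul, Pi.smul_apply, norm_smul, Complex.norm_real, Real.norm_of_nonneg (hσ j)]
    rw [h3, h1, RCLike.norm_conj]
    refine (norm_inner_le_norm _ _).trans_eq ?_
    rw [hu.1, one_mul]
  refine h2.trans ((norm_matrixOp_apply_le (summable_exp_neg_len hs hρ)
    (summable_exp_neg_len hs hρ) (fun a => (Real.exp_pos _).le) (fun b => (Real.exp_pos _).le)
    hc _).trans_eq ?_)
  rw [tsum_eq_single β fun b hb => by rw [unitVec_apply_ne hb, norm_zero, mul_zero],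
    unitVec_apply_self, norm_one, mul_one]

end Decay

end Pilipovic
end

noncomputable section
namespace Pilipovic

/-! ### Bilinear expansion of the coefficients -/

section ExpansionCoefficients

variable {ι κ : Type*} [Fintype ι] [Fintype κ] {d : ℕ} {s r : ℝ}

/-- The choice `exp(-j Q_j)` beats every rate `R` once `j ≥ R`, and the finitely many earlier terms
go into the constant. One sequence thus serves all rates. -/
theorem exists_pos_le_mul_exp (Q : ℕ → ℝ) (hQ : ∀ j, 0 ≤ Q j) :
    ∃ ε : ℕ → ℝ, (∀ j, 0 < ε j) ∧
      ∀ R : ℝ, 0 ≤ R → ∃ C : ℝ, 0 ≤ C ∧ ∀ j, ε j ≤ C * Real.exp (-R * Q j) := by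
  refine ⟨fun j => Real.exp (-(j : ℝ) * Q j), fun j => Real.exp_pos _, fun R hR =>
    ⟨Real.exp (R * ∑ i ∈ Finset.range ⌈R⌉₊, Q i), (Real.exp_pos _).le, fun j => ?_⟩⟩
  have hS : 0 ≤ ∑ i ∈ Finset.range ⌈R⌉₊, Q i := Finset.sum_nonneg fun i _ => hQ i
  have hj := hQ j
  rw [← Real.exp_add, Real.exp_le_exp]
  rcases lt_or_ge j ⌈R⌉₊ with h | h
  · have h1 : Q j ≤ ∑ i ∈ Finset.range ⌈R⌉₊, Q i :=
      Finset.single_le_sum (fun i _ => hQ i) (Finset.mem_range.2 h)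
    have h2 : 0 ≤ (j : ℝ) * Q j := by positivity
    nlinarith
  · have h1 : R ≤ j := Nat.ceil_le.1 h
    nlinarith [mul_nonneg hR hS]

theorem exists_len_bound {v : ℕ → (ι → ℕ) → ℂ} {P : ℕ → Prop}
    (h : ∀ j, P j → ∃ t : Finset (ι → ℕ), ∀ α ∉ t, v j α = 0) :
    ∃ M : ℕ → ℝ, (∀ j, 0 ≤ M j) ∧ ∀ j, P j → ∀ α, v j α ≠ 0 → len α ≤ M j := by
  choose! t ht using h
  refine ⟨fun j => ∑ α ∈ t j, len α, fun j => Finset.sum_nonneg fun α _ => len_nonneg α,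
    fun j hj α hα => ?_⟩
  exact Finset.single_le_sum (f := fun α : ι → ℕ => len α) (fun β _ => len_nonneg β)
    (by_contra fun h => hα (ht j hj α h))

theorem expWeight_rpow (d : ℕ) (s r a : ℝ) (j : ℕ) :
    expWeight d s r j ^ a = expWeight d s (r * a) j := by
  rw [expWeight, expWeight, ← Real.exp_mul]
  ring_nf

/-- Since `|v| ≤ 1`, `σ^(1/4) |v| ≤ (σ |v|)^(1/8) σ^(1/8)`: the first factor decays in `β`, the
second in `j`, each with an eighth of its rate. Where `σ` vanishes the decay is supplied by `θ`. -/
theorem seqCoeffBound_of_singularVector {σ θ : ℕ → ℝ} {v : ℕ → (ι → ℕ) → ℂ} {ρ ρ₁ D₁ D₂ D₃ : ℝ}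
    (hσ : ∀ j, 0 ≤ σ j) (hθ : ∀ j, 0 ≤ θ j) (hv : ∀ j β, ‖v j β‖ ≤ 1) (hD₁ : 0 ≤ D₁) (hD₂ : 0 ≤ D₂)
    (hD₃ : 0 ≤ D₃) (h₁ : ∀ j, σ j ≤ D₁ / expWeight d s ρ₁ j)
    (h₂ : ∀ j β, σ j * ‖v j β‖ ≤ D₂ * Real.exp (-ρ * len β ^ (1 / (2 * s))))
    (hθσ : ∀ j, σ j ≠ 0 → θ j = σ j ^ (1 / 4 : ℝ))
    (h₃ : ∀ j, σ j = 0 → ∀ β, v j β ≠ 0 →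
      θ j ≤ D₃ * Real.exp (-r * len β ^ (1 / (2 * s))) / expWeight d s r j)
    (hr : r ≤ ρ / 8) (hr₁ : r ≤ ρ₁ / 8) :
    SeqCoeffBound d s r r fun j β => (θ j : ℂ) * v j β := by
  refine ⟨D₂ ^ (1 / 8 : ℝ) * D₁ ^ (1 / 8 : ℝ) + D₃, fun j β => ?_⟩
  have hx0 := norm_nonneg (v j β)
  have hx1 := hv j β
  have hw := expWeight_pos d s r j
  rw [norm_mul, Complex.norm_real, Real.norm_of_nonneg (hθ j)]
  by_cases h0 : σ j = 0
  · by_cases hvz : v j β = 0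
    · rw [hvz, norm_zero, mul_zero]
      positivity
    · calc θ j * ‖v j β‖ ≤ θ j := mul_le_of_le_one_right (hθ j) hx1
        _ ≤ _ := h₃ j h0 β hvz
        _ ≤ _ := by
          gcongr
          have : 0 ≤ D₂ ^ (1 / 8 : ℝ) * D₁ ^ (1 / 8 : ℝ) := by positivity
          linarith
  · have hs0 := hσ j
    have e1 : σ j ^ (1 / 4 : ℝ) * ‖v j β‖ ≤
        (σ j * ‖v j β‖) ^ (1 / 8 : ℝ) * σ j ^ (1 / 8 : ℝ) := by
      have e2 : σ j ^ (1 / 4 : ℝ) = σ j ^ (1 / 8 : ℝ) * σ j ^ (1 / 8 : ℝ) := by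
        rw [← Real.rpow_add_of_nonneg hs0 (by norm_num) (by norm_num)]
        norm_num
      have e3 : ‖v j β‖ ≤ ‖v j β‖ ^ (1 / 8 : ℝ) := by
        conv_lhs => rw [← Real.rpow_one ‖v j β‖]
        exact Real.rpow_le_rpow_of_exponent_ge' hx0 hx1 (by norm_num) (by norm_num)
      rw [e2, Real.mul_rpow hs0 hx0]
      calc _ ≤ σ j ^ (1 / 8 : ℝ) * σ j ^ (1 / 8 : ℝ) * ‖v j β‖ ^ (1 / 8 : ℝ) := by gcongr
        _ = _ := by ring
    have e4 : (σ j * ‖v j β‖) ^ (1 / 8 : ℝ) ≤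
        D₂ ^ (1 / 8 : ℝ) * Real.exp (-r * len β ^ (1 / (2 * s))) := by
      refine (Real.rpow_le_rpow (by positivity) (h₂ j β) (by norm_num)).trans ?_
      rw [Real.mul_rpow hD₂ (Real.exp_pos _).le, ← Real.exp_mul]
      have := Real.rpow_nonneg (len_nonneg β) (1 / (2 * s))
      refine mul_le_mul_of_nonneg_left (Real.exp_le_exp.2 ?_) (by positivity)
      nlinarith
    have e5 : σ j ^ (1 / 8 : ℝ) ≤ D₁ ^ (1 / 8 : ℝ) / expWeight d s r j := by
      refine (Real.rpow_le_rpow hs0 (h₁ j) (by norm_num)).trans ?_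
      rw [Real.div_rpow hD₁ (expWeight_pos ..).le, expWeight_rpow]
      have := expWeight_mono d s (show r ≤ ρ₁ * (1 / 8) by linarith) j
      gcongr
    rw [hθσ j h0]
    calc _ ≤ _ := e1
      _ ≤ (D₂ ^ (1 / 8 : ℝ) * Real.exp (-r * len β ^ (1 / (2 * s)))) *
          (D₁ ^ (1 / 8 : ℝ) / expWeight d s r j) := by gcongr
      _ = D₂ ^ (1 / 8 : ℝ) * D₁ ^ (1 / 8 : ℝ) * Real.exp (-r * len β ^ (1 / (2 * s))) /
          expWeight d s r j := by ring
      _ ≤ _ := by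
        gcongr
        linarith

theorem scalarEstimate_sqrt {σ : ℕ → ℝ} {ρ₁ D₁ : ℝ} (hσ : ∀ j, 0 ≤ σ j) (hD₁ : 0 ≤ D₁)
    (h₁ : ∀ j, σ j ≤ D₁ / expWeight d s ρ₁ j) (hr : r ≤ ρ₁ / 2) :
    ScalarEstimate d s r fun j => σ j ^ (1 / 2 : ℝ) := by
  refine ⟨D₁ ^ (1 / 2 : ℝ), fun j => ?_⟩
  have hw := expWeight_pos d s r j
  rw [mul_comm, ← le_div_iff₀ hw]
  refine (Real.rpow_le_rpow (hσ j) (h₁ j) (by norm_num)).trans ?_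
  rw [Real.div_rpow hD₁ (expWeight_pos ..).le, expWeight_rpow]
  have := expWeight_mono d s (show r ≤ ρ₁ * (1 / 2) by linarith) j
  gcongr

theorem CoeffBound.exists_mul_le {c : (κ ⊕ ι → ℕ) → ℂ} (hc : CoeffBound s r c) (hs : 0 < s)
    (hr : 0 ≤ r) :
    ∃ C : ℝ, 0 ≤ C ∧ ∀ q : (κ → ℕ) × (ι → ℕ), ‖c (Sum.elim q.1 q.2)‖ ≤
      C * (Real.exp (-(r / 2) * len q.1 ^ (1 / (2 * s))) *
        Real.exp (-(r / 2) * len q.2 ^ (1 / (2 * s)))) := by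
  obtain ⟨C, hC⟩ := hc
  refine ⟨|C|, abs_nonneg C, fun q => (hC _).trans ?_⟩
  have h := rpow_add_rpow_le (len_nonneg q.1) (len_nonneg q.2) (show 0 < 1 / (2 * s) by positivity)
  have hl : ((∑ i, Sum.elim q.1 q.2 i : ℕ) : ℝ) = len q.1 + len q.2 :=
    len_sum (Sum.elim q.1 q.2)
  rw [hl, ← Real.exp_add]
  refine mul_le_mul (le_abs_self C) (Real.exp_le_exp.2 ?_) (Real.exp_pos _).le (abs_nonneg C)
  nlinarith

/-- The coefficients of a kernel with stretched exponential decay have a bilinear expansion with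
orthogonal sequences, whose decay is controlled by every decay rate of the kernel. -/
theorem exists_bilinear_expansion [Nonempty ι] [Nonempty κ] (hs : 0 < s)
    {c : (κ ⊕ ι → ℕ) → ℂ} (hr : 0 < r) (hc : CoeffBound s r c) :
    ∃ (l : ℕ → ℝ) (a : ℕ → (ι → ℕ) → ℂ) (b : ℕ → (κ → ℕ) → ℂ), (∀ j, 0 ≤ l j) ∧
      (∀ j, a j ≠ 0) ∧ (∀ j, b j ≠ 0) ∧
      (∀ i j, i ≠ j → HasSum (fun β => a i β * starRingEnd ℂ (a j β)) 0) ∧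
      (∀ i j, i ≠ j → HasSum (fun α => b i α * starRingEnd ℂ (b j α)) 0) ∧
      (∀ α β, HasSum (fun j => (l j : ℂ) * (a j β * b j α)) (c (Sum.elim α β))) ∧
      ∃ k > 0, ∀ R > 0, CoeffBound s R c →
        ScalarEstimate (min (Fintype.card ι) (Fintype.card κ)) s (k * R) l ∧
        SeqCoeffBound (min (Fintype.card ι) (Fintype.card κ)) s (k * R) (k * R) a ∧
        SeqCoeffBound (min (Fintype.card ι) (Fintype.card κ)) s (k * R) (k * R) b := by
  set d := min (Fintype.card ι) (Fintype.card κ) with hd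
  set m : (κ → ℕ) × (ι → ℕ) → ℂ := fun q => c (Sum.elim q.1 q.2) with hm
  obtain ⟨C, hC0, hC⟩ := hc.exists_mul_le hs hr.le
  have hsum : Summable fun q => ‖m q‖ := Summable.of_nonneg_of_le (fun _ => norm_nonneg _) hC
    (((summable_exp_neg_len hs (half_pos hr)).mul_of_nonneg
      (summable_exp_neg_len hs (half_pos hr)) (fun _ => (Real.exp_pos _).le)
      fun _ => (Real.exp_pos _).le).mul_left C)
  obtain ⟨σ, v, u, hanti, hσ, hv, hu, hTv, hTu, hsupp, hexp⟩ :=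
    exists_singularValue_sequence (isCompactOperator_matrixOp hsum) fun ε hε =>
      exists_finset_norm_matrixOp_le hs (half_pos hr) hC0 hC hε
  have hadj := adjoint_matrixOp hsum
  have hTu' (j : ℕ) : matrixOp (fun q : (ι → ℕ) × (κ → ℕ) => starRingEnd ℂ (m q.swap)) (u j) =
      (σ j : ℂ) • v j := by rw [← hadj, hTu]
  have hTv' (j : ℕ) : ContinuousLinearMap.adjoint
      (matrixOp fun q : (ι → ℕ) × (κ → ℕ) => starRingEnd ℂ (m q.swap)) (v j) =
      (σ j : ℂ) • u j := by rw [← hadj, ContinuousLinearMap.adjoint_adjoint, hTv]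
  have hv1 (j : ℕ) (β : ι → ℕ) : ‖v j β‖ ≤ 1 :=
    (lp.norm_apply_le_norm two_ne_zero _ _).trans_eq (hv.1 j)
  have hu1 (j : ℕ) (α : κ → ℕ) : ‖u j α‖ ≤ 1 :=
    (lp.norm_apply_le_norm two_ne_zero _ _).trans_eq (hu.1 j)
  obtain ⟨M₁, hM₁, hM₁'⟩ := exists_len_bound (v := fun j β => starRingEnd ℂ (v j β))
    (P := fun j => σ j = 0) fun j hj => by simpa using (hsupp j hj).1
  obtain ⟨M₂, hM₂, hM₂'⟩ := exists_len_bound (v := fun j α => u j α)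
    (P := fun j => σ j = 0) fun j hj => (hsupp j hj).2
  -- For vanishing singular values the vectors are supported in `|β| ≤ M₁ j` and `|α| ≤ M₂ j`; the
  -- factor `ε` beats both weights there, at any rate.
  obtain ⟨ε, hε, hεR⟩ := exists_pos_le_mul_exp
    (fun j => (M₁ j + M₂ j) ^ (1 / (2 * s)) + ((j : ℝ) + 1) ^ (1 / (2 * d * s)))
    fun j => by have := hM₁ j; have := hM₂ j; positivity
  set θ : ℕ → ℝ := fun j => if σ j = 0 then ε j else σ j ^ (1 / 4 : ℝ) with hθ
  have hθσ (j : ℕ) (h : σ j ≠ 0) : θ j = σ j ^ (1 / 4 : ℝ) := if_neg h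
  have hθε (j : ℕ) (h : σ j = 0) : θ j = ε j := if_pos h
  have hθ0 (j : ℕ) : 0 < θ j := by
    by_cases h : σ j = 0
    · rw [hθε j h]
      exact hε j
    · rw [hθσ j h]
      exact Real.rpow_pos_of_pos ((hσ j).lt_of_ne' h) _
  have hθne (j : ℕ) : (θ j : ℂ) ≠ 0 := by exact_mod_cast (hθ0 j).ne'
  have hσθ (j : ℕ) : σ j ^ (1 / 2 : ℝ) * (θ j * θ j) = σ j := by
    by_cases h : σ j = 0
    · rw [h, Real.zero_rpow (by norm_num), zero_mul]
    · rw [hθσ j h, ← Real.rpow_add_of_nonneg (hσ j) (by norm_num) (by norm_num),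
        ← Real.rpow_add_of_nonneg (hσ j) (by norm_num) (by norm_num)]
      norm_num
  have hzero (R : ℝ) (hR : 0 ≤ R) : ∃ D : ℝ, 0 ≤ D ∧ ∀ j, σ j = 0 → ∀ L : ℝ, 0 ≤ L →
      L ≤ M₁ j + M₂ j → θ j ≤ D * Real.exp (-R * L ^ (1 / (2 * s))) / expWeight d s R j := by
    obtain ⟨D, hD, hDε⟩ := hεR R hR
    refine ⟨D, hD, fun j hj L hL0 hL => ?_⟩
    rw [hθε j hj, expWeight, mul_div_assoc, ← Real.exp_sub]
    refine (hDε j).trans (mul_le_mul_of_nonneg_left (Real.exp_le_exp.2 ?_) hD)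
    have := Real.rpow_le_rpow hL0 hL (show 0 ≤ 1 / (2 * s) by positivity)
    nlinarith
  -- `v` is conjugated because the expansion is bilinear while the decomposition is sesquilinear.
  -- The constant collects the losses in the rate: `1/2` for separating the two indices, `1/2` for
  -- the tail over the box, `2^(-1/(2s))` for the count of box points, and `1/8` for the eighth
  -- roots.
  refine ⟨fun j => σ j ^ (1 / 2 : ℝ), fun j β => (θ j : ℂ) * starRingEnd ℂ (v j β),
    fun j α => (θ j : ℂ) * u j α, fun j => Real.rpow_nonneg (hσ j) _, fun j h => ?_, fun j h => ?_,
    fun i j hij => ?_, fun i j hij => ?_, fun α β => ?_, (2 ^ (1 / (2 * s)))⁻¹ / 32, by positivity,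
    fun R hR hcR => ?_⟩
  · refine hv.ne_zero j (lp.ext (funext fun β => ?_))
    simpa [hθne j] using congrFun h β
  · refine hu.ne_zero j (lp.ext (funext fun α => ?_))
    simpa [hθne j] using congrFun h α
  · have h := (lp.hasSum_inner (v i) (v j)).mul_left ((θ i : ℂ) * θ j)
    rw [hv.2 hij, mul_zero] at h
    refine h.congr_fun fun β => ?_
    rw [RCLike.inner_apply, map_mul, Complex.conj_conj, Complex.conj_ofReal]
    ring
  · have h := (lp.hasSum_inner (u j) (u i)).mul_left ((θ i : ℂ) * θ j)
    rw [hu.2 hij.symm, mul_zero] at h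
    refine h.congr_fun fun α => ?_
    rw [RCLike.inner_apply, map_mul, Complex.conj_ofReal]
    ring
  · have h := hexp (unitVec β) (unitVec α)
    rw [inner_matrixOp hsum] at h
    refine h.congr_fun fun j => ?_
    rw [inner_unitVec_left, inner_unitVec_right]
    conv_rhs => rw [← hσθ j]
    push_cast
    ring
  · obtain ⟨C', hC'0, hC'⟩ := hcR.exists_mul_le hs hR.le
    have hC'' (q : (ι → ℕ) × (κ → ℕ)) : ‖starRingEnd ℂ (m q.swap)‖ ≤
        C' * (Real.exp (-(R / 2) * len q.1 ^ (1 / (2 * s))) *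
          Real.exp (-(R / 2) * len q.2 ^ (1 / (2 * s)))) := by
      rw [RCLike.norm_conj, mul_comm (Real.exp _)]
      exact hC' q.swap
    have hR2 := half_pos hR
    obtain ⟨D₁, hD₁, h₁⟩ : ∃ D : ℝ, 0 ≤ D ∧
        ∀ j, σ j ≤ D / expWeight d s (R / 2 / 2 / 2 ^ (1 / (2 * s))) j := by
      -- The singular values are those of `T` and of its adjoint; the boxes are taken in the index
      -- set of smaller dimension.
      rcases min_choice (Fintype.card ι) (Fintype.card κ) with h | h
      · rw [hd, h]
        exact exists_singularValue_le Fintype.card_pos hs hR2 hC'0 hC' hanti hv hu hTv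
      · rw [hd, h]
        exact exists_singularValue_le Fintype.card_pos hs hR2 hC'0 hC'' hanti hu hv hTu'
    obtain ⟨D₂, hD₂, h₂⟩ := exists_singularVector_le hs hR2 hC'0 hC' hσ hu hTu
    obtain ⟨D₂', hD₂', h₂'⟩ := exists_singularVector_le hs hR2 hC'0 hC'' hσ hv hTv'
    have ht : (2 ^ (1 / (2 * s)) : ℝ)⁻¹ ≤ 1 :=
      inv_le_one_of_one_le₀ (Real.one_le_rpow one_le_two (by positivity))
    have ht0 : 0 < (2 ^ (1 / (2 * s)) : ℝ)⁻¹ := by positivity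
    set t := (2 ^ (1 / (2 * s)) : ℝ)⁻¹
    obtain ⟨D₃, hD₃, h₃⟩ := hzero (t / 32 * R) (by positivity)
    have hk₁ : t / 32 * R ≤ R / 2 / 8 := by nlinarith
    have hk₂ : t / 32 * R ≤ R / 2 / 2 / 2 ^ (1 / (2 * s)) / 8 := by
      rw [div_eq_mul_inv (R / 2 / 2)]
      linarith
    have hk₃ : t / 32 * R ≤ R / 2 / 2 / 2 ^ (1 / (2 * s)) / 2 := by
      rw [div_eq_mul_inv (R / 2 / 2)]
      nlinarith [mul_pos ht0 hR]
    refine ⟨scalarEstimate_sqrt hσ hD₁ h₁ hk₃, ?_, ?_⟩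
    · refine seqCoeffBound_of_singularVector hσ (fun j => (hθ0 j).le)
        (fun j β => by rw [RCLike.norm_conj]; exact hv1 j β) hD₁ hD₂ hD₃ h₁
        (fun j β => by rw [RCLike.norm_conj]; exact h₂ j β) hθσ
        (fun j hj β hβ => h₃ j hj _ (len_nonneg β) ?_) hk₁ hk₂
      exact (hM₁' j hj β hβ).trans (le_add_of_nonneg_right (hM₂ j))
    · refine seqCoeffBound_of_singularVector hσ (fun j => (hθ0 j).le) hu1 hD₁ hD₂' hD₃ h₁
        h₂' hθσ (fun j hj β hβ => h₃ j hj _ (len_nonneg β) ?_) hk₁ hk₂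
      exact (hM₂' j hj β hβ).trans (le_add_of_nonneg_left (hM₁ j))

end ExpansionCoefficients

end Pilipovic
end

noncomputable section
namespace Pilipovic

/-! ### From coefficients to orthogonal expansions of kernels -/

section OrthogonalExpansion

variable {ι : Type*} [Fintype ι] {d d₁ d₂ : ℕ} {s r : ℝ} {p : ℝ≥0∞}
  {K : EuclideanSpace ℝ (Fin d₂) × EuclideanSpace ℝ (Fin d₁) → ℂ}

theorem ScalarEstimate.mono {r' : ℝ} {l : ℕ → ℝ} (hl : ScalarEstimate d s r l)
    (hl0 : ∀ j, 0 ≤ l j) (hr : r' ≤ r) : ScalarEstimate d s r' l := by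
  obtain ⟨C, hC⟩ := hl
  exact ⟨C, fun j => (mul_le_mul_of_nonneg_right (expWeight_mono d s hr j) (hl0 j)).trans (hC j)⟩

theorem SeqCoeffBound.mono {r' ρ : ℝ} {a : ℕ → (ι → ℕ) → ℂ} (ha : SeqCoeffBound d s r ρ a)
    (hr : r' ≤ r) : SeqCoeffBound d s r' ρ a := by
  obtain ⟨C, hC0, hC⟩ := ha.exists_nonneg
  refine ⟨C, fun j α => (hC j α).trans ?_⟩
  have h1 := expWeight_pos d s r' j
  have h2 := expWeight_mono d s hr j
  gcongr

theorem isOG_hermiteSeries {a : ℕ → (ι → ℕ) → ℂ} (ha : ∀ j, RapidDecay (a j)) (h0 : ∀ j, a j ≠ 0)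
    (horth : ∀ i j, i ≠ j → HasSum (fun β => a i β * starRingEnd ℂ (a j β)) 0) :
    IsOG fun j => hermiteSeries (a j) := by
  refine ⟨fun j => (ha j).memLp one_le_two, fun j hj => h0 j (funext fun β => ?_),
    fun i j hij => ((ha i).hasSum_integral_mul_star (ha j)).unique (horth i j hij)⟩
  rw [← (ha j).integral_hermiteSeries_mul β]
  refine integral_eq_zero_of_ae (hj.mono fun x hx => ?_)
  simp only [Pi.zero_apply] at hx ⊢
  rw [hx, zero_mul]

/-- The factor `k` and the sequences are fixed before the rate `R` is quantified. One admissible `R`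
settles the Roumieu case, and letting `R` grow settles the Beurling case with the same expansion. -/
theorem exists_hasOrthogonalExpansion (hd₁ : 1 ≤ d₁) (hd₂ : 1 ≤ d₂) (hp : 1 ≤ p) (hs : 0 < s)
    {c : (Fin d₂ ⊕ Fin d₁ → ℕ) → ℂ} (hr : 0 < r) (hc : CoeffBound s r c)
    (hK : IsHermiteSeries c (onSum K)) :
    ∃ k > 0, HasOrthogonalExpansion K fun l f₁ f₂ => ∀ R > 0, CoeffBound s R c →
      ∀ r' ≤ k * R, ∀ h, 2 * (2 + (max d₁ d₂ : ℕ)) * (2 * s / (k * R / 2)) ^ (2 * s) ≤ h →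
        ExpansionEstimates p s r' h l f₁ f₂ := by
  have : Nonempty (Fin d₁) := ⟨⟨0, hd₁⟩⟩
  have : Nonempty (Fin d₂) := ⟨⟨0, hd₂⟩⟩
  obtain ⟨l, a, b, hl, ha0, hb0, haa, hbb, hab, k, hk, hest⟩ :=
    exists_bilinear_expansion (ι := Fin d₁) (κ := Fin d₂) hs hr hc
  simp only [Fintype.card_fin] at hest
  obtain ⟨hlr, har, hbr⟩ := hest r hr hc
  have hkr : 0 < k * r := mul_pos hk hr
  have ha := har.rapidDecay hs hkr
  have hb := hbr.rapidDecay hs hkr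
  refine ⟨k, hk, l, fun j => hermiteSeries (a j), fun j => hermiteSeries (b j), hl,
    isOG_hermiteSeries ha ha0 haa, isOG_hermiteSeries hb hb0 hbb,
    fun j => (ha j).contDiff_hermiteSeries, fun j => (hb j).contDiff_hermiteSeries, fun z => ?_,
    fun R hR hcR r' hr' h hh => ?_⟩
  · obtain ⟨L, hL⟩ := hlr.exists_bound hl hkr.le
    obtain ⟨S, hS, hS'⟩ := exists_hasSum_mul_hermiteSeries (lt_min hd₁ hd₂) hs hkr hkr hl hL har hbr
      z.2 z.1
    have h1 := hasSum_hermiteFun_joinSum_iff.1 (hK (joinSum z.1 z.2))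
    have h2 : S = onSum K (joinSum z.1 z.2) := by
      refine (hS'.congr_fun fun q => ?_).unique h1
      rw [(hab q.1 q.2).tsum_eq]
    rw [onSum_joinSum] at h2
    rw [ExpansionAt, ← h2]
    exact hS
  · obtain ⟨hlR, haR, hbR⟩ := hest R hR hcR
    have hkR : 0 < k * R := mul_pos hk hR
    have hle (n : ℕ) (hn : n ≤ max d₁ d₂) :
        2 * (2 + (Fintype.card (Fin n) : ℝ)) * (2 * s / (k * R / 2)) ^ (2 * s) ≤ h := by
      refine le_trans ?_ hh
      rw [Fintype.card_fin]
      have : (n : ℝ) ≤ (max d₁ d₂ : ℕ) := by exact_mod_cast hn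
      gcongr
    exact ⟨hlR.mono hl hr', (haR.mono hr').functionEstimate hp hs hkR (hle _ (le_max_left _ _)),
      (hbR.mono hr').functionEstimate hp hs hkR (hle _ (le_max_right _ _))⟩

theorem hasOrthogonalExpansion_of_mem_roumieuSpace (hd₁ : 1 ≤ d₁) (hd₂ : 1 ≤ d₂) (hp : 1 ≤ p)
    (hs : 0 < s) (hK : onSum K ∈ roumieuSpace (Fin d₂ ⊕ Fin d₁) s) :
    HasOrthogonalExpansion K fun l f₁ f₂ =>
      ∃ r > 0, ∃ h > 0, ExpansionEstimates p s r h l f₁ f₂ := by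
  obtain ⟨c, ⟨r, hr, hc⟩, hcK⟩ := hK
  obtain ⟨k, hk, l, f₁, f₂, h1, h2, h3, h4, h5, h6, H⟩ :=
    exists_hasOrthogonalExpansion hd₁ hd₂ hp hs hr hc hcK
  exact ⟨l, f₁, f₂, h1, h2, h3, h4, h5, h6, k * r, mul_pos hk hr, _, by positivity,
    H r hr hc _ le_rfl _ le_rfl⟩

theorem hasOrthogonalExpansion_of_mem_beurlingSpace (hd₁ : 1 ≤ d₁) (hd₂ : 1 ≤ d₂) (hp : 1 ≤ p)
    (hs : 0 < s) (hK : onSum K ∈ beurlingSpace (Fin d₂ ⊕ Fin d₁) s) :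
    HasOrthogonalExpansion K fun l f₁ f₂ =>
      ∀ r > 0, ∀ h > 0, ExpansionEstimates p s r h l f₁ f₂ := by
  obtain ⟨c, hc, hcK⟩ := hK
  obtain ⟨k, hk, l, f₁, f₂, h1, h2, h3, h4, h5, h6, H⟩ :=
    exists_hasOrthogonalExpansion hd₁ hd₂ hp hs one_pos (hc 1 one_pos) hcK
  refine ⟨l, f₁, f₂, h1, h2, h3, h4, h5, h6, fun r hr h hh => ?_⟩
  set q : ℝ := 2 * (2 + (max d₁ d₂ : ℕ)) with hq
  have hq0 : 0 < q := by positivity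
  -- The rate `ρ = k R` must be at least `r` and large enough that the threshold `q (4s/ρ)^(2s)`
  -- does not exceed `h`, that is `4s/ρ ≤ t`.
  set t : ℝ := (h / q) ^ (1 / (2 * s)) with ht
  have ht0 : 0 < t := by positivity
  set ρ := max r (4 * s / t) with hρ
  have hρ0 : 0 < ρ := hr.trans_le (le_max_left _ _)
  have hkρ : k * (ρ / k) = ρ := by field_simp
  refine H (ρ / k) (by positivity) (hc _ (by positivity)) r
    ((le_max_left _ _).trans_eq hkρ.symm) h ?_
  rw [hkρ]
  have e1 : 2 * s / (ρ / 2) ≤ t := by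
    have : 4 * s ≤ ρ * t := (div_le_iff₀ ht0).1 (le_max_right _ _)
    rw [div_le_iff₀ (by positivity)]
    linarith
  have e2 : (2 * s / (ρ / 2)) ^ (2 * s) ≤ h / q := by
    refine (Real.rpow_le_rpow (by positivity) e1 (by positivity)).trans_eq ?_
    rw [ht, ← Real.rpow_mul (by positivity), one_div_mul_cancel (by positivity), Real.rpow_one]
  calc q * (2 * s / (ρ / 2)) ^ (2 * s) ≤ q * (h / q) := by gcongr
    _ = h := by field_simp

end OrthogonalExpansion

end Pilipovic
end

theorem theorem5p2 (d₁ d₂ : ℕ) (hd₁ : 1 ≤ d₁) (hd₂ : 1 ≤ d₂) (p : ℝ≥0∞) (hp : 1 ≤ p)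
    (s : ℝ) (hs : 0 < s)
    (K : EuclideanSpace ℝ (Fin d₂) × EuclideanSpace ℝ (Fin d₁) → ℂ) (hK : ContDiff ℝ ∞ K) :
    (Pilipovic.onSum K ∈ Pilipovic.roumieuSpace (Fin d₂ ⊕ Fin d₁) s →
      Pilipovic.HasOrthogonalExpansion K fun l f₁ f₂ =>
        ∃ r > 0, ∃ h > 0, Pilipovic.ExpansionEstimates p s r h l f₁ f₂) ∧
    (Pilipovic.onSum K ∈ Pilipovic.beurlingSpace (Fin d₂ ⊕ Fin d₁) s →
      Pilipovic.HasOrthogonalExpansion K fun l f₁ f₂ =>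
        ∀ r > 0, ∀ h > 0, Pilipovic.ExpansionEstimates p s r h l f₁ f₂) ∧
    ((Pilipovic.HasExpansion K fun l f₁ f₂ =>
        ∃ r > 0, ∃ h > 0, Pilipovic.ExpansionEstimates p s r h l f₁ f₂) →
      Pilipovic.onSum K ∈ Pilipovic.roumieuSpace (Fin d₂ ⊕ Fin d₁) s) ∧
    ((Pilipovic.HasExpansion K fun l f₁ f₂ =>
        ∀ r > 0, ∀ h > 0, Pilipovic.ExpansionEstimates p s r h l f₁ f₂) →
      Pilipovic.onSum K ∈ Pilipovic.beurlingSpace (Fin d₂ ⊕ Fin d₁) s) := by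
  have hKc := hK.continuous
  refine ⟨fun H => Pilipovic.hasOrthogonalExpansion_of_mem_roumieuSpace hd₁ hd₂ hp hs H,
    fun H => Pilipovic.hasOrthogonalExpansion_of_mem_beurlingSpace hd₁ hd₂ hp hs H,
    fun H => Pilipovic.onSum_mem_roumieuSpace hKc hd₁ hd₂ hp hs H,
    fun H => Pilipovic.onSum_mem_beurlingSpace hKc hd₁ hd₂ hp hs H⟩
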